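/- **Setting.** Let $d\ge1$, $\Omega=(0,1)^d$. Let $\mathrm P:[0,\infty)\to\mathbb R$ be continuous, smooth on $(0,\infty)$, strictly increasing, and satisfy McCann's condition $(d-1)(\mathrm P(r)-\mathrm P(0))\le d\,r\,\mathrm P'(r)$ for all $r>0$ (automatic for $d=1$). Let $h$ satisfy $\mathrm P'(r)=r\,h''(r)$ for $r>0$ ($h$ is determined up to an affine function), and put $h_*(s)=s\,h(1/s)$ for $s>0$. Let $V$ be smooth on $\overline\Omega$ with $\nabla^2V\ge\lambda\mathbb 1$ in $\Omega$ for some $\lambda\in\mathbb R$, and let $\bar u$ be a continuous, strictly positive density on $\overline\Omega$. Denote by $\mathrm{Diff}^+$ the orientation-preserving $C^1$-diffeomorphisms of $\overline\Omega$ onto itself that fix the corners. For $\mathfrak T\in\mathrm{Diff}^+$ let $\mathfrak T_\#\bar u=(\bar u/\det \mathrm D\mathfrak T)\circ\mathfrak T^{-1}$, and define $$\mathbf E(\mathfrak T)=\int_\Omega\Big[h_*\Big(\frac{\det \mathrm D\mathfrak T}{\bar u}\Big)+V\circ\mathfrak T\Big]\bar u\,dx\in(-\infty,+\infty],$$ also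 for $\mathfrak T$ replaced by $\mathfrak t\circ\mathfrak T$ with $\mathfrak t$ as below, where $h_*:=+\infty$ at arguments $s\le0$. Let $\mathfrak b_k:\mathbb R^d\to\mathbb R$, $k\in\mathcal I_\delta$, be finitely many $C^\infty$ functions that are even and $2$-periodic in each coordinate, and let $\mathrm T\mathfrak X_\delta$ be their linear span. Let $\mathfrak X_\delta$ be the set of $\phi(x)=\frac12|x|^2+\psi(x)$ with $\psi\in\mathrm T\mathfrak X_\delta$ such that $\phi$ is convex on $\overline\Omega$ and $\nabla\phi(\Omega)\subseteq\Omega$, let $\mathfrak X_\delta^+=\{\phi\in\mathfrak X_\delta:\inf_\Omega\det\nabla^2\phi>0\}$, and let $\nabla\mathfrak X_\delta$, $\nabla\mathfrak X_\delta^+$ be the corresponding sets of gradient maps. For $\tau>0$ and $\mathfrak T\in\mathrm{Diff}^+$ put $$\Phi_{\mathfrak T}(\mathfrak t)=\frac1{2\tau}\|\mathfrak t-\mathrm{id}\|^2_{L^2(\mathfrak T_\#\bar u)}+\mathbf E(\mathfrak t\circ\mathfrak T).$$ **Theorem.** The function $s\mapsto s^{d/2-1}h_*(s)$ is not integrable at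 $s=0$ if and only if $r\mapsto r^{-(d/2+2)}h(r)$ is not integrable at $r=+\infty$. Assume that this is the case, and that $\tau>0$ satisfies $\lambda+\tau^{-1}>0$. Then for every $\mathfrak T^0\in\mathrm{Diff}^+$ there is exactly one sequence $(\mathfrak t^n)_{n\ge1}$ such that, with $\mathfrak T^n=\mathfrak t^n\circ\mathfrak T^{n-1}$, each $\mathfrak t^n$ minimizes $\Phi_{\mathfrak T^{n-1}}$ over $\nabla\mathfrak X_\delta^+$, and the same sequence is the only one for which each $\mathfrak t^n$ minimizes $\Phi_{\mathfrak T^{n-1}}$ over $\nabla\mathfrak X_\delta$. For every $n\ge1$: 1. $\mathfrak T^{n-1}\in\mathrm{Diff}^+$; the sets $\nabla\mathfrak X_\delta$ and $\nabla\mathfrak X_\delta^+$ are convex, $\Phi_{\mathfrak T^{n-1}}$ is convex on them, is nowhere $-\infty$ on $\nabla\mathfrak X_\delta$, and is finite on $\nabla\mathfrak X_\delta^+$. 2. $\mathfrak t^n\in\nabla\mathfrak X_\delta^+$, and $\Phi_{\mathfrak T^{n-1}}(\mathfrak t^n)<\Phi_{\mathfrak T^{n-1}}(\mathfrak s)$ for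 all $\mathfrak s\in\nabla\mathfrak X_\delta$ with $\mathfrak s\ne\mathfrak t^n$. 3. $\mathfrak t^n$ is the only $\mathfrak t\in\nabla\mathfrak X_\delta^+$ that solves the Euler–Lagrange system $$\Big\langle\frac{\mathfrak t-\mathrm{id}}\tau-\mathbf v(\mathfrak t;\mathfrak T^{n-1}),\nabla\psi\Big\rangle_{L^2(\mathfrak T^{n-1}_\#\bar u)}=0\qquad\text{for all }\psi\in\mathrm T\mathfrak X_\delta .$$ Here $\mathbf v(\mathfrak t;\mathfrak T)=\mathbf v[(\mathfrak t\circ\mathfrak T)_\#\bar u]\circ\mathfrak t$ and $\mathbf v[u]=-\nabla[h'(u)+V]$. If $\mathfrak T^0_\#\bar u\in C^1(\overline\Omega)$, the system in 3 holds literally, with classical derivatives. For arbitrary $\mathfrak T^0\in\mathrm{Diff}^+$ it holds, again with uniqueness, in the weak sense: with $u=(\mathfrak t\circ\mathfrak T)_\#\bar u$ and $\zeta=\nabla\psi\circ\mathfrak t^{-1}$, the pairing $\langle\mathbf v(\mathfrak t;\mathfrak T),\nabla\psi\rangle_{L^2(\mathfrak T_\#\bar u)}$ is understood as $\int_\Omega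 \mathrm P(u)\operatorname{div}\zeta\,dx-\int_\Omega u\,\nabla V\cdot\zeta\,dx$. -/

import Mathlib

open Set Filter Topology MeasureTheory
open scoped ENNReal ContDiff

noncomputable section

namespace FokkerPlanck

/-- Points of `ℝ^d` with the Euclidean norm. -/
abbrev Pt (d : ℕ) : Type := EuclideanSpace ℝ (Fin d)

/-- The open unit cube `Ω = (0,1)^d`. -/
def cube (d : ℕ) : Set (Pt d) := {x | ∀ i, x i ∈ Ioo (0 : ℝ) 1}

/-- The closed unit cube, the closure of `Ω`. -/
def closedCube (d : ℕ) : Set (Pt d) := {x | ∀ i, x i ∈ Icc (0 : ℝ) 1}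

/-- `f` is even and `2`-periodic with respect to each coordinate. A symmetric-periodic function
on `Ω` has exactly one continuous extension to `ℝ^d` with this property, and is identified with
that extension. -/
def IsSymPeriodic {d : ℕ} (f : Pt d → ℝ) : Prop :=
  (∀ (i : Fin d) (x : Pt d), f (x - EuclideanSpace.single i (2 * x i)) = f x) ∧
    ∀ (i : Fin d) (x : Pt d), f (x + EuclideanSpace.single i 2) = f x

/-- The Jacobian determinant `det DT` of a map given on the closed cube. -/
def jac {d : ℕ} (T : Pt d → Pt d) (x : Pt d) : ℝ :=
  (fderivWithin ℝ T (closedCube d) x).det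

/-- The class of orientation-preserving `C^1`-diffeomorphisms of the closed cube onto itself that
fix the corners. (The inverse of a `C^1` bijection with non-vanishing Jacobian is `C^1`.) -/
structure IsDiffPlus {d : ℕ} (T : Pt d → Pt d) : Prop where
  contDiffOn : ContDiffOn ℝ 1 T (closedCube d)
  bijOn : BijOn T (closedCube d) (closedCube d)
  jac_pos : ∀ x ∈ closedCube d, 0 < jac T x
  corner : ∀ x : Pt d, (∀ i, x i = 0 ∨ x i = 1) → T x = x

/-- The measure on `Ω` with Lebesgue density `u`. -/
def densMeasure {d : ℕ} (u : Pt d → ℝ) : Measure (Pt d) :=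
  (volume.restrict (cube d)).withDensity fun x => ENNReal.ofReal (u x)

/-- The push-forward `T_# u` as a measure. -/
def pushMeasure {d : ℕ} (T : Pt d → Pt d) (u : Pt d → ℝ) : Measure (Pt d) :=
  (densMeasure u).map T

/-- The density of the push-forward, `T_# u = (u / det DT) ∘ T⁻¹`. -/
def pushDensity {d : ℕ} (T : Pt d → Pt d) (u : Pt d → ℝ) (y : Pt d) : ℝ :=
  u (Function.invFunOn T (closedCube d) y) / jac T (Function.invFunOn T (closedCube d) y)

/-- `h_*(s) = s h(1/s)` for `s > 0`. -/
def hStar (h : ℝ → ℝ) (s : ℝ) : ℝ := s * h (1 / s)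

/-- `h_*` continued by `+∞` to arguments `s ≤ 0`. If `h_*` is convex and unbounded near `0`, this is
the lower semicontinuous continuation. -/
def hStarExt (h : ℝ → ℝ) (s : ℝ) : EReal := if 0 < s then (hStar h s : EReal) else ⊤

/-- The integral `∫ f⁺ - ∫ f⁻` of an extended real function. -/
def extIntegral {d : ℕ} (f : Pt d → EReal) (μ : Measure (Pt d)) : EReal :=
  ((∫⁻ x, (f x).toENNReal ∂μ : ℝ≥0∞) : EReal) - ((∫⁻ x, (-f x).toENNReal ∂μ : ℝ≥0∞) : EReal)

/-- The energy `E(T) = ∫_Ω [h_*(det DT / ū) + V ∘ T] dū`, with values in `(-∞, +∞]`. -/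
def energy {d : ℕ} (h : ℝ → ℝ) (V ubar : Pt d → ℝ) (T : Pt d → Pt d) : EReal :=
  extIntegral (fun x => hStarExt h (jac T x / ubar x) + (V (T x) : EReal)) (densMeasure ubar)

/-- The functional minimized in one time step from `T`:
`t ↦ (1/2τ) ‖t - id‖²_{L²(T_# ū)} + E(t ∘ T)`. -/
def stepFunctional {d : ℕ} (h : ℝ → ℝ) (V ubar : Pt d → ℝ) (τ : ℝ) (T t : Pt d → Pt d) : EReal :=
  ((1 / (2 * τ) * ∫ x, ‖t x - x‖ ^ 2 ∂(pushMeasure T ubar) : ℝ) : EReal) + energy h V ubar (t ∘ T)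

/-- The linear span of the ansatz functions `b k`, `k ∈ I`. -/
def ansatzSpace {d : ℕ} {ι : Type*} (b : ι → Pt d → ℝ) (I : Finset ι) : Set (Pt d → ℝ) :=
  {ψ | ∃ z : ι → ℝ, ψ = fun x => ∑ k ∈ I, z k * b k x}

/-- The admissible potentials: `φ = |x|²/2 + ψ` with `ψ` in the ansatz space, such that `φ` is
convex on the closed cube and `∇φ(Ω) ⊆ Ω`. -/
def potentials {d : ℕ} {ι : Type*} (b : ι → Pt d → ℝ) (I : Finset ι) : Set (Pt d → ℝ) :=
  {φ | (∃ ψ ∈ ansatzSpace b I, φ = fun x => ‖x‖ ^ 2 / 2 + ψ x) ∧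
    ConvexOn ℝ (closedCube d) φ ∧ MapsTo (gradient φ) (cube d) (cube d)}

/-- The regular admissible potentials: `inf_Ω det ∇²φ > 0`. -/
def regularPotentials {d : ℕ} {ι : Type*} (b : ι → Pt d → ℝ) (I : Finset ι) : Set (Pt d → ℝ) :=
  {φ | φ ∈ potentials b I ∧ ∃ c > 0, ∀ x ∈ cube d, c ≤ (fderiv ℝ (gradient φ) x).det}

/-- The gradient maps of the admissible potentials. -/
def gradMaps {d : ℕ} {ι : Type*} (b : ι → Pt d → ℝ) (I : Finset ι) : Set (Pt d → Pt d) :=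
  gradient '' potentials b I

/-- The gradient maps of the regular admissible potentials. -/
def regularGradMaps {d : ℕ} {ι : Type*} (b : ι → Pt d → ℝ) (I : Finset ι) : Set (Pt d → Pt d) :=
  gradient '' regularPotentials b I

/-- Minimization of `Φ` over `A` is a convex problem: `A` is convex, and so is `Φ` on `A`. -/
def IsConvexProblem {F : Type*} [AddCommGroup F] [Module ℝ F] (A : Set F) (Φ : F → EReal) : Prop :=
  Convex ℝ A ∧ ∀ x ∈ A, ∀ y ∈ A, ∀ α β : ℝ, 0 ≤ α → 0 ≤ β → α + β = 1 →
    Φ (α • x + β • y) ≤ (α : EReal) * Φ x + (β : EReal) * Φ y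

/-- The concatenations `T^0 = T0`, `T^{n+1} = t^{n+1} ∘ T^n`; here `t n` stands for `t^{n+1}`. -/
def lagrangianMap {d : ℕ} (T0 : Pt d → Pt d) (t : ℕ → Pt d → Pt d) : ℕ → Pt d → Pt d
  | 0 => T0
  | n + 1 => t n ∘ lagrangianMap T0 t n

/-- `t` is obtained by the minimizing movement scheme with admissible set `A`, started at `T0`. -/
def IsScheme {d : ℕ} (h : ℝ → ℝ) (V ubar : Pt d → ℝ) (τ : ℝ) (A : Set (Pt d → Pt d))
    (T0 : Pt d → Pt d) (t : ℕ → Pt d → Pt d) : Prop :=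
  ∀ n, t n ∈ A ∧ IsMinOn (stepFunctional h V ubar τ (lagrangianMap T0 t n)) A (t n)

/-- The velocity field `v[u] = -∇[h'(u) + V]`. -/
def velocity {d : ℕ} (h : ℝ → ℝ) (V u : Pt d → ℝ) (x : Pt d) : Pt d :=
  -gradient (fun y => deriv h (u y) + V y) x

/-- `v(t; T) = v[(t ∘ T)_# ū] ∘ t`. -/
def velocityAlong {d : ℕ} (h : ℝ → ℝ) (V ubar : Pt d → ℝ) (t T : Pt d → Pt d) (x : Pt d) : Pt d :=
  velocity h V (pushDensity (t ∘ T) ubar) (t x)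

/-- The discrete Euler--Lagrange system
`⟨(t - id)/τ - v(t; T), ∇ψ⟩_{L²(T_# ū)} = 0` for all `ψ` in the ansatz space. -/
def EulerLagrange {d : ℕ} {ι : Type*} (h : ℝ → ℝ) (V ubar : Pt d → ℝ) (τ : ℝ)
    (b : ι → Pt d → ℝ) (I : Finset ι) (T t : Pt d → Pt d) : Prop :=
  ∀ ψ ∈ ansatzSpace b I,
    ∫ x, inner ℝ (τ⁻¹ • (t x - x) - velocityAlong h V ubar t T x) (gradient ψ x)
      ∂(pushMeasure T ubar) = 0

/-- The pairing `⟨v[u], ζ⟩_{L²(u)}` for a density `u` that need not be differentiable and a vector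
field `ζ` that is tangential at the boundary. Since `P'(r) = r h''(r)`, one has
`u v[u] = -∇P(u) - u ∇V`, and the derivative is moved from `P(u)` to `ζ`. -/
def weakVelocityPairing {d : ℕ} (P : ℝ → ℝ) (V u : Pt d → ℝ) (ζ : Pt d → Pt d) : ℝ :=
  (∫ x in cube d, P (u x) * LinearMap.trace ℝ (Pt d) (fderiv ℝ ζ x : Pt d →ₗ[ℝ] Pt d)) -
    ∫ x in cube d, u x * inner ℝ (gradient V x) (ζ x)

/-- The discrete Euler--Lagrange system with the velocity in the weak sense, meaningful for every
diffeomorphism `T`. It uses `⟨v(t; T), ∇ψ⟩_{L²(T_# ū)} = ⟨v[u], ∇ψ ∘ t⁻¹⟩_{L²(u)}` for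
`u = (t ∘ T)_# ū`. -/
def WeakEulerLagrange {d : ℕ} {ι : Type*} (P : ℝ → ℝ) (V ubar : Pt d → ℝ) (τ : ℝ)
    (b : ι → Pt d → ℝ) (I : Finset ι) (T t : Pt d → Pt d) : Prop :=
  ∀ ψ ∈ ansatzSpace b I,
    (∫ x, inner ℝ (τ⁻¹ • (t x - x)) (gradient ψ x) ∂(pushMeasure T ubar)) -
      weakVelocityPairing P V (pushDensity (t ∘ T) ubar)
        (fun y => gradient ψ (Function.invFunOn t (closedCube d) y)) = 0

end FokkerPlanck

end

/-! A step from `T` with reference density `ubar` is a step from the identity with reference density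
`T_# ubar`, so everything reduces to one minimization with a continuous positive density `ρ`;
induction then works because each minimizer is again a diffeomorphism of the required class.

Geometry. Evenness and periodicity of the potential make its gradient tangential on every face of
the cube. If `Dt` is positive semidefinite on the closed cube (`Adm`), then `t` is monotone in each
coordinate, so it maps the closed cube into itself; if `det Dt > 0` as well (`Reg`), it is a
diffeomorphism fixing the corners.

Convexity. Up to a linear term, `h_*` is the nonincreasing function `kStar`, with derivative `P 0 -
P (1 / s)`. The linear term contributes only a constant, since `det Dt` has integral `1`. McCann's
condition says that `s ↦ kStar (a * s ^ d)` is convex, and Minkowski's inequality says that `det ^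
(1 / d)` is concave; together they make the internal energy convex in `t`. The transport cost plus
`V` is strongly convex with modulus `lam + τ⁻¹ > 0`, which gives uniqueness.

Existence. The maps in `Adm` with displacement in the finite-dimensional span form a compact set
(`isCompact_admCoords`), and Fatou's lemma gives lower semicontinuity.

Non-degeneracy is the heart of the matter (`Adm.reg_of_stepEnergy_ne_top`). By the reflection
symmetry, `det Dt` is nonnegative near each of its zeros along every coordinate direction or even
across the face, so its gradient vanishes there, also on the boundary
(`IsField.fderiv_det_eq_zero`). Hence `det Dt ≤ C |x - x₀|²` near a zero `x₀`, and the energy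
dominates the integral of `kStar (C' |x - x₀|²)` over the cube. In polar coordinates this is the
integral of `s ^ (d / 2 - 1) * kStar s` near `0`, which diverges by assumption. So finite energy
forces `Reg`.

Euler–Lagrange system. `Reg` is stable under small perturbations in the span, so the minimizer is a
free critical point, and by convexity every regular critical point is the minimizer
(`weakExpr_eq_zero_iff`). Jacobi's formula and the change of variables `y = s x` turn the first
variation into the weak system; for `C¹` densities the divergence theorem for tangential fields
turns it into the classical one. -/

noncomputable section

namespace FokkerPlanck

/-! ### Determinants: Minkowski's inequality, positivity, Jacobi's formula. -/

section Determinant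

open scoped MatrixOrder in
theorem _root_.Matrix.PosSemidef.exists_eq_conjTranspose_mul_self {n : ℕ}
    {A : Matrix (Fin n) (Fin n) ℝ} (hA : A.PosSemidef) :
    ∃ B : Matrix (Fin n) (Fin n) ℝ, A = B.conjTranspose * B :=
  CStarAlgebra.nonneg_iff_eq_star_mul_self.mp hA.nonneg

/-- The inequality of arithmetic and geometric means for the eigenvalues. -/
theorem _root_.Matrix.PosSemidef.det_rpow_le_trace_div {n : ℕ} (hn : 0 < n)
    {A : Matrix (Fin n) (Fin n) ℝ} (hA : A.PosSemidef) :
    A.det ^ (1 / (n : ℝ)) ≤ A.trace / n := by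
  have hn' : (0 : ℝ) < n := by exact_mod_cast hn
  have h := Real.geom_mean_le_arith_mean Finset.univ (fun _ : Fin n => (1 : ℝ))
    hA.isHermitian.eigenvalues (fun _ _ => zero_le_one) (by simpa using hn)
    (fun i _ => hA.eigenvalues_nonneg i)
  have h1 := hA.isHermitian.det_eq_prod_eigenvalues
  have h2 := hA.isHermitian.trace_eq_sum_eigenvalues
  simp only [RCLike.ofReal_real_eq_id, id_eq] at h1 h2
  rw [h1, h2]
  simpa [one_div] using h

/-- Conjugation by a factor `B` of `C = Bᴴ B` reduces this to `C = 1`. It bounds `det ^ (1 / n)` by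
functionals linear in `A`, and concavity follows once one of them is attained. -/
theorem _root_.Matrix.PosSemidef.det_rpow_mul_le_trace_mul {n : ℕ} (hn : 0 < n)
    {A C : Matrix (Fin n) (Fin n) ℝ} (hA : A.PosSemidef) (hC : C.PosSemidef) (hdet : C.det = 1) :
    A.det ^ (1 / (n : ℝ)) ≤ (A * C).trace / n := by
  obtain ⟨B, rfl⟩ := hC.exists_eq_conjTranspose_mul_self
  have h := (hA.mul_mul_conjTranspose_same B).det_rpow_le_trace_div hn
  have h1 : (B * A * B.conjTranspose).det = A.det := by
    rw [Matrix.det_mul] at hdet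
    rw [Matrix.det_mul, Matrix.det_mul]
    linear_combination A.det * hdet
  have h2 : (B * A * B.conjTranspose).trace = (A * (B.conjTranspose * B)).trace := by
    rw [← Matrix.mul_assoc, Matrix.trace_mul_comm (A * B.conjTranspose), Matrix.mul_assoc]
  rwa [h1, h2] at h

theorem _root_.Matrix.PosSemidef.concave_det_rpow {n : ℕ} (hn : 0 < n)
    {A B : Matrix (Fin n) (Fin n) ℝ} (hA : A.PosSemidef) (hB : B.PosSemidef)
    {α β : ℝ} (hα : 0 < α) (hβ : 0 < β) :
    α * A.det ^ (1 / (n : ℝ)) + β * B.det ^ (1 / (n : ℝ)) ≤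
      (α • A + β • B).det ^ (1 / (n : ℝ)) := by
  have hn' : (0 : ℝ) < n := by exact_mod_cast hn
  have hn1 : (1 / (n : ℝ)) ≠ 0 := by positivity
  have hM : (α • A + β • B).PosSemidef := (hA.smul hα.le).add (hB.smul hβ.le)
  rcases hM.det_nonneg.eq_or_lt with h0 | hpos
  -- A null vector of the sum is a null vector of both summands, because both quadratic forms are
  -- nonnegative; so both sides are zero.
  · obtain ⟨v, hv, hMv⟩ := Matrix.exists_mulVec_eq_zero_iff.2 h0.symm
    have hq : α * (star v ⬝ᵥ A.mulVec v) + β * (star v ⬝ᵥ B.mulVec v) = 0 := by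
      have := congrArg (fun w => star v ⬝ᵥ w) hMv
      simpa [Matrix.add_mulVec, Matrix.smul_mulVec, dotProduct_add] using this
    have hAv := hA.dotProduct_mulVec_nonneg v
    have hBv := hB.dotProduct_mulVec_nonneg v
    have hA0 : star v ⬝ᵥ A.mulVec v = 0 := by nlinarith
    have hB0 : star v ⬝ᵥ B.mulVec v = 0 := by nlinarith
    have dA : A.det = 0 :=
      Matrix.exists_mulVec_eq_zero_iff.1 ⟨v, hv, (hA.dotProduct_mulVec_zero_iff v).1 hA0⟩
    have dB : B.det = 0 :=
      Matrix.exists_mulVec_eq_zero_iff.1 ⟨v, hv, (hB.dotProduct_mulVec_zero_iff v).1 hB0⟩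
    rw [dA, dB, ← h0, Real.zero_rpow hn1]; simp
  · set M := α • A + β • B with hMdef
    have hMu : IsUnit M.det := hpos.ne'.isUnit
    -- The normalization `det (c • M⁻¹) = 1` picks the linear functional for which equality holds at
    -- `M`.
    set c : ℝ := M.det ^ (1 / (n : ℝ)) with hc
    have hcpos : 0 < c := Real.rpow_pos_of_pos hpos _
    have hcn : c ^ n = M.det := by
      rw [hc, ← Real.rpow_natCast, ← Real.rpow_mul hpos.le]; field_simp; simp
    have hC : (c • M⁻¹).PosSemidef := hM.inv.smul hcpos.le
    have hdet : (c • M⁻¹).det = 1 := by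
      rw [Matrix.det_smul, Fintype.card_fin, hcn, Matrix.det_nonsing_inv, Ring.inverse_eq_inv',
        mul_inv_cancel₀ hpos.ne']
    have h1 := hA.det_rpow_mul_le_trace_mul hn hC hdet
    have h2 := hB.det_rpow_mul_le_trace_mul hn hC hdet
    have h3 : α * ((A * (c • M⁻¹)).trace / n) + β * ((B * (c • M⁻¹)).trace / n) = c := by
      have : (M * (c • M⁻¹)).trace = c * n := by
        rw [Matrix.mul_smul, Matrix.mul_nonsing_inv _ hMu, Matrix.trace_smul, Matrix.trace_one]
        simp
      nth_rewrite 1 [hMdef] at this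
      rw [Matrix.add_mul, Matrix.smul_mul, Matrix.smul_mul, Matrix.trace_add, Matrix.trace_smul,
        Matrix.trace_smul, smul_eq_mul, smul_eq_mul] at this
      field_simp
      linarith
    rw [← h3]
    gcongr

variable {d : ℕ}

theorem posSemidef_toMatrix {A : Pt d →L[ℝ] Pt d} (hA : A.IsPositive) :
    (LinearMap.toMatrix (EuclideanSpace.basisFun (Fin d) ℝ).toBasis
      (EuclideanSpace.basisFun (Fin d) ℝ).toBasis (A : Pt d →ₗ[ℝ] Pt d)).PosSemidef := by
  rw [LinearMap.posSemidef_toMatrix_iff]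
  exact hA

theorem det_eq_det_toMatrix (A : Pt d →L[ℝ] Pt d) :
    A.det = (LinearMap.toMatrix (EuclideanSpace.basisFun (Fin d) ℝ).toBasis
      (EuclideanSpace.basisFun (Fin d) ℝ).toBasis (A : Pt d →ₗ[ℝ] Pt d)).det := by
  rw [LinearMap.det_toMatrix]

theorem det_nonneg_of_isPositive {A : Pt d →L[ℝ] Pt d} (hA : A.IsPositive) : 0 ≤ A.det := by
  rw [det_eq_det_toMatrix]; exact (posSemidef_toMatrix hA).det_nonneg

/-- Minkowski's determinant inequality. -/
theorem concave_det_rpow (hd : 0 < d) {A B : Pt d →L[ℝ] Pt d} (hA : A.IsPositive)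
    (hB : B.IsPositive) {α β : ℝ} (hα : 0 < α) (hβ : 0 < β) :
    α * A.det ^ (1 / (d : ℝ)) + β * B.det ^ (1 / (d : ℝ)) ≤
      (α • A + β • B).det ^ (1 / (d : ℝ)) := by
  simp only [det_eq_det_toMatrix]
  convert (posSemidef_toMatrix hA).concave_det_rpow hd (posSemidef_toMatrix hB) hα hβ using 3
  exact (map_add _ _ _).trans (congrArg₂ _ (map_smul _ _ _) (map_smul _ _ _))

theorem inner_pos_of_isPositive_of_det_pos {A : Pt d →L[ℝ] Pt d} (hA : A.IsPositive)
    (hdet : 0 < A.det) {v : Pt d} (hv : v ≠ 0) : 0 < inner ℝ (A v) v := by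
  refine lt_of_le_of_ne (hA.inner_nonneg_left v) fun h => hv ?_
  have hAv : A v = 0 := by
    by_contra hne
    have hn : 0 < ‖A v‖ ^ 2 := by positivity
    set w := A v with hw
    have hq := hA.inner_nonneg_left w
    -- The form at `v - s • w` equals `s² ⟨A w, w⟩ - 2 s ‖w‖²`, and this `s` satisfies `s ⟨A w, w⟩ <
    -- ‖w‖²`, which makes it negative.
    set s := ‖w‖ ^ 2 / (inner ℝ (A w) w + 1) with hs
    have hspos : 0 < s := by positivity
    have h1 := hA.inner_nonneg_left (v - s • w)
    have h2 : inner ℝ (A w) v = ‖w‖ ^ 2 := by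
      rw [hA.inner_left_eq_inner_right, ← hw, real_inner_self_eq_norm_sq]
    rw [map_sub, map_smul, ← hw] at h1
    simp only [inner_sub_left, inner_sub_right, inner_smul_left, inner_smul_right, h2, ← h,
      real_inner_self_eq_norm_sq, conj_trivial] at h1
    have h3 : s * (inner ℝ (A w) w + 1) = ‖w‖ ^ 2 := by rw [hs]; field_simp
    nlinarith
  have hinj : Function.Injective (A : Pt d →ₗ[ℝ] Pt d) :=
    (LinearEquiv.ofIsUnitDet (f := (A : Pt d →ₗ[ℝ] Pt d))
      (v := (EuclideanSpace.basisFun (Fin d) ℝ).toBasis)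
      (v' := (EuclideanSpace.basisFun (Fin d) ℝ).toBasis)
      (by rw [← det_eq_det_toMatrix]; exact hdet.ne'.isUnit)).injective
  exact hinj (by simpa using hAv)

theorem det_pos_of_inner_pos {A : Pt d →L[ℝ] Pt d} (hA : A.IsPositive)
    (h : ∀ v ≠ 0, 0 < inner ℝ (A v) v) : 0 < A.det := by
  refine lt_of_le_of_ne (det_nonneg_of_isPositive hA) fun h0 => ?_
  have : ((A : Pt d →ₗ[ℝ] Pt d)).det = 0 := h0.symm
  obtain ⟨v, hv, hv0⟩ := (Submodule.ne_bot_iff _).1 (LinearMap.bot_lt_ker_of_det_eq_zero this).ne'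
  have := h v hv0
  rw [show A v = 0 from hv] at this
  simp at this

/-- By Minkowski's inequality a single non-degenerate summand suffices. This makes maps between a
degenerate and a regular one regular. -/
theorem det_pos_add (hd : 0 < d) {A B : Pt d →L[ℝ] Pt d} (hA : A.IsPositive)
    (hB : B.IsPositive) {α β : ℝ} (hα : 0 < α) (hβ : 0 < β) (h : 0 < A.det ∨ 0 < B.det) :
    0 < (α • A + β • B).det := by
  have h1 := concave_det_rpow hd hA hB hα hβ
  have h2 : 0 < α * A.det ^ (1 / (d : ℝ)) + β * B.det ^ (1 / (d : ℝ)) := by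
    have hA0 := det_nonneg_of_isPositive hA
    have hB0 := det_nonneg_of_isPositive hB
    rcases h with h | h
    · have := Real.rpow_pos_of_pos h (1 / (d : ℝ)); positivity
    · have := Real.rpow_pos_of_pos h (1 / (d : ℝ)); positivity
  have hM : (α • A + β • B).IsPositive :=
    (hA.smul_of_nonneg hα.le).add (hB.smul_of_nonneg hβ.le)
  refine lt_of_le_of_ne (det_nonneg_of_isPositive hM) fun h0 => ?_
  rw [← h0, Real.zero_rpow (by positivity)] at h1
  linarith

/-- Jacobi's formula along a line. -/
theorem hasDerivAt_det_add_smul (A B : Pt d →L[ℝ] Pt d) (A' : Pt d →L[ℝ] Pt d)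
    (hAA' : A ∘L A' = 1) :
    HasDerivAt (fun ε : ℝ => (A + ε • B).det)
      (A.det * LinearMap.trace ℝ (Pt d) ((B ∘L A' : Pt d →L[ℝ] Pt d) : Pt d →ₗ[ℝ] Pt d)) 0 := by
  set e := (EuclideanSpace.basisFun (Fin d) ℝ).toBasis
  have hA'A : A' ∘L A = 1 := by
    have : (A : Pt d →ₗ[ℝ] Pt d) * (A' : Pt d →ₗ[ℝ] Pt d) = 1 := by
      ext1 x; exact congrArg (fun f : Pt d →L[ℝ] Pt d => f x) hAA'
    have := mul_eq_one_comm.1 this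
    ext1 x; exact congrArg (fun f : Pt d →ₗ[ℝ] Pt d => f x) this
  set M := LinearMap.toMatrix e e ((B ∘L A' : Pt d →L[ℝ] Pt d) : Pt d →ₗ[ℝ] Pt d) with hM
  -- Factoring out `A` leaves the determinant of a perturbation of the identity, whose linear
  -- coefficient is the trace.
  have key : ∀ ε : ℝ, (A + ε • B).det = (1 + ε • M).det * A.det := by
    intro ε
    have h1 : A + ε • B = (1 + ε • (B ∘L A')) ∘L A := by
      rw [ContinuousLinearMap.add_comp, ContinuousLinearMap.smul_comp,
        ContinuousLinearMap.comp_assoc, hA'A]; rfl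
    have h2 : (A + ε • B).det = (1 + ε • (B ∘L A') : Pt d →L[ℝ] Pt d).det * A.det := by
      rw [h1]
      exact LinearMap.det_comp _ _
    rw [h2, det_eq_det_toMatrix (1 + ε • (B ∘L A'))]
    congr 2
    have : ((1 + ε • (B ∘L A') : Pt d →L[ℝ] Pt d) : Pt d →ₗ[ℝ] Pt d)
      = 1 + ε • ((B ∘L A' : Pt d →L[ℝ] Pt d) : Pt d →ₗ[ℝ] Pt d) := rfl
    rw [this, map_add, map_smul, LinearMap.toMatrix_one]
  have h3 : HasDerivAt (fun ε : ℝ => (1 + ε • M).det) M.trace 0 := by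
    obtain ⟨q, hq⟩ : ∃ q : Polynomial ℝ, ∀ r : ℝ,
        (1 + r • M).det = 1 + M.trace * r + q.eval r * r ^ 2 := ⟨_, fun r => Matrix.det_one_add_smul r M⟩
    simp_rw [hq]
    have := ((hasDerivAt_id (0 : ℝ)).const_mul M.trace).const_add 1 |>.add
      ((q.hasDerivAt 0).mul ((hasDerivAt_id (0 : ℝ)).pow 2))
    exact (this.congr_deriv (by simp)).congr_of_eventuallyEq (Eventually.of_forall fun r => by simp)
  have h4 := h3.mul_const A.det
  have ht : M.trace = LinearMap.trace ℝ (Pt d)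
      ((B ∘L A' : Pt d →L[ℝ] Pt d) : Pt d →ₗ[ℝ] Pt d) := by
    rw [hM, LinearMap.trace_eq_matrix_trace ℝ e]
  rw [ht, mul_comm] at h4
  exact h4.congr_of_eventuallyEq (Eventually.of_forall key)

theorem contDiff_det : ContDiff ℝ ∞ (fun A : Pt d →L[ℝ] Pt d => A.det) := by
  have : (fun A : Pt d →L[ℝ] Pt d => A.det) = fun A : Pt d →L[ℝ] Pt d => _ :=
    funext fun A => (det_eq_det_toMatrix A).trans (Matrix.det_apply _)
  rw [this]
  refine ContDiff.sum fun σ _ => ?_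
  refine ContDiff.const_smul _ ?_
  refine contDiff_prod fun i _ => ?_
  exact ((Matrix.entryLinearMap ℝ ℝ (σ i) i ∘ₗ (LinearMap.toMatrix
    (EuclideanSpace.basisFun (Fin d) ℝ).toBasis
    (EuclideanSpace.basisFun (Fin d) ℝ).toBasis).toLinearMap ∘ₗ
    ContinuousLinearMap.coeLM ℝ).toContinuousLinearMap).contDiff

end Determinant

/-! ### The open and the closed cube: topology, convexity, null boundary. -/

section Cube

variable {d : ℕ}

theorem cube_eq_preimage : cube d = WithLp.ofLp ⁻¹' (univ.pi fun _ : Fin d => Ioo (0 : ℝ) 1) := by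
  ext x; simp [cube]

theorem closedCube_eq_preimage :
    closedCube d = WithLp.ofLp ⁻¹' (univ.pi fun _ : Fin d => Icc (0 : ℝ) 1) := by
  ext x; simp [closedCube, Pi.le_def, forall_and]

theorem isOpen_cube : IsOpen (cube d) := by
  rw [cube_eq_preimage]
  exact (isOpen_set_pi finite_univ fun _ _ => isOpen_Ioo).preimage (PiLp.continuous_ofLp 2 _)

theorem isCompact_closedCube : IsCompact (closedCube d) := by
  rw [closedCube_eq_preimage]
  exact (PiLp.homeomorph 2 (fun _ : Fin d => ℝ)).isCompact_preimage.2
    (isCompact_univ_pi fun _ => isCompact_Icc)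

theorem convex_cube : Convex ℝ (cube d) := fun _ hx _ hy _ _ ha hb hab i =>
  convex_Ioo (0 : ℝ) 1 (hx i) (hy i) ha hb hab

theorem convex_closedCube : Convex ℝ (closedCube d) := fun _ hx _ hy _ _ ha hb hab i =>
  convex_Icc (0 : ℝ) 1 (hx i) (hy i) ha hb hab

theorem cube_subset_closedCube : cube d ⊆ closedCube d := fun _ hx i => Ioo_subset_Icc_self (hx i)

theorem measurableSet_cube : MeasurableSet (cube d) := isOpen_cube.measurableSet

theorem measurableSet_closedCube : MeasurableSet (closedCube d) :=
  isCompact_closedCube.isClosed.measurableSet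

/-- The midpoint of the cube. -/
def center (d : ℕ) : Pt d := WithLp.toLp 2 fun _ => 1 / 2

theorem center_mem_cube : center d ∈ cube d := fun i => by simp [center]; norm_num

theorem cube_nonempty : (cube d).Nonempty := ⟨_, center_mem_cube⟩

theorem closedCube_nonempty : (closedCube d).Nonempty :=
  cube_nonempty.mono cube_subset_closedCube

theorem combo_mem_cube {x y : Pt d} (hx : x ∈ closedCube d) (hy : y ∈ cube d) {s : ℝ}
    (hs : s ∈ Ioc (0 : ℝ) 1) : (1 - s) • x + s • y ∈ cube d := fun i => by
  have h1 := hx i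
  have h2 := hy i
  simp only [PiLp.add_apply, PiLp.smul_apply, smul_eq_mul, mem_Ioo]
  constructor
  · nlinarith [h1.1, h2.1, hs.1, hs.2, mul_pos hs.1 h2.1, mul_nonneg (sub_nonneg.2 hs.2) h1.1]
  · nlinarith [h1.2, h2.2, hs.1, hs.2, mul_pos hs.1 (sub_pos.2 h2.2),
      mul_nonneg (sub_nonneg.2 hs.2) (sub_nonneg.2 h1.2)]

theorem closedCube_subset_closure_cube : closedCube d ⊆ closure (cube d) := by
  intro x hx
  have h1 : Tendsto (fun s : ℝ => (1 - s) • x + s • center d) (𝓝[>] 0) (𝓝 x) := by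
    have : Continuous fun s : ℝ => (1 - s) • x + s • center d := by fun_prop
    have := this.tendsto 0
    simp only [sub_zero, one_smul, zero_smul, add_zero] at this
    exact this.mono_left nhdsWithin_le_nhds
  refine mem_closure_of_tendsto h1 ?_
  filter_upwards [Ioc_mem_nhdsGT (zero_lt_one' ℝ)] with s hs
  exact combo_mem_cube hx center_mem_cube hs

theorem closure_cube : closure (cube d) = closedCube d :=
  (closure_minimal cube_subset_closedCube isCompact_closedCube.isClosed).antisymm
    closedCube_subset_closure_cube

theorem cube_subset_interior : cube d ⊆ interior (closedCube d) :=
  isOpen_cube.subset_interior_iff.2 cube_subset_closedCube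

theorem closedCube_mem_nhds {x : Pt d} (hx : x ∈ cube d) : closedCube d ∈ 𝓝 x :=
  mem_of_superset (isOpen_cube.mem_nhds hx) cube_subset_closedCube

theorem uniqueDiffOn_closedCube : UniqueDiffOn ℝ (closedCube d) :=
  uniqueDiffOn_convex convex_closedCube ⟨_, cube_subset_interior center_mem_cube⟩

theorem cube_ae_eq_closedCube : (cube d : Set (Pt d)) =ᵐ[volume] closedCube d := by
  rw [cube_eq_preimage, closedCube_eq_preimage]
  refine (EuclideanSpace.volume_preserving_symm_measurableEquiv_toLp (Fin d)).quasiMeasurePreserving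
    |>.preimage_ae_eq ?_
  rw [Set.pi_univ_Icc]
  exact Measure.univ_pi_Ioo_ae_eq_Icc (μ := fun _ : Fin d => (volume : Measure ℝ))

theorem restrict_cube : volume.restrict (cube d) = volume.restrict (closedCube d) :=
  Measure.restrict_congr_set cube_ae_eq_closedCube

theorem volume_closedCube : volume (closedCube d) = 1 := by
  rw [closedCube_eq_preimage,
    (PiLp.volume_preserving_ofLp (Fin d)).measure_preimage
      (MeasurableSet.univ_pi fun _ => measurableSet_Icc).nullMeasurableSet, volume_pi_pi]
  simp

theorem volume_cube : volume (cube d) = 1 := by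
  rw [measure_congr cube_ae_eq_closedCube, volume_closedCube]

end Cube

/-! ### Gradients of even periodic functions and their symmetries. -/

section Fields

variable {d : ℕ}

/-- Gradients of smooth functions that are even and `2`-periodic in each coordinate. -/
def IsField (g : Pt d → Pt d) : Prop :=
  ∃ ψ : Pt d → ℝ, ContDiff ℝ ∞ ψ ∧ IsSymPeriodic ψ ∧ g = gradient ψ

theorem contDiff_gradient {ψ : Pt d → ℝ} (h : ContDiff ℝ ∞ ψ) : ContDiff ℝ ∞ (gradient ψ) := by
  have h1 : ContDiff ℝ ∞ (fderiv ℝ ψ) := h.fderiv_right (by simp)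
  exact (InnerProductSpace.toDual ℝ (Pt d)).symm.contDiff.comp h1

theorem inner_fderiv_gradient {ψ : Pt d → ℝ} (h : ContDiff ℝ ∞ ψ) (x v w : Pt d) :
    inner ℝ (fderiv ℝ (gradient ψ) x v) w = fderiv ℝ (fderiv ℝ ψ) x v w := by
  have h1 : DifferentiableAt ℝ (fderiv ℝ ψ) x :=
    ((h.fderiv_right (m := ∞) (by simp)).differentiable (by simp)) x
  have h2 : HasFDerivAt (fun y => inner ℝ w (gradient ψ y))
      (innerSL ℝ w ∘L fderiv ℝ (gradient ψ) x) x :=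
    (innerSL ℝ w).hasFDerivAt.comp x
      ((contDiff_gradient h).differentiable (by simp) x).hasFDerivAt
  have h3 : HasFDerivAt (fun y => inner ℝ w (gradient ψ y))
      ((ContinuousLinearMap.apply ℝ ℝ w) ∘L fderiv ℝ (fderiv ℝ ψ) x) x := by
    refine ((ContinuousLinearMap.apply ℝ ℝ w).hasFDerivAt.comp x
      h1.hasFDerivAt).congr_of_eventuallyEq (Eventually.of_forall fun y => ?_)
    simp
  have := congrArg (fun f : Pt d →L[ℝ] ℝ => f v) (h2.unique h3)
  rw [real_inner_comm]
  simpa using this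

theorem inner_fderiv_gradient_symm {ψ : Pt d → ℝ} (h : ContDiff ℝ ∞ ψ) (x v w : Pt d) :
    inner ℝ (fderiv ℝ (gradient ψ) x v) w = inner ℝ v (fderiv ℝ (gradient ψ) x w) := by
  rw [real_inner_comm _ v, inner_fderiv_gradient h, inner_fderiv_gradient h]
  exact (h.contDiffAt.isSymmSndFDerivAt (by simpa using ENat.LEInfty.out)).eq v w

theorem gradient_add' {f g : Pt d → ℝ} (hf : Differentiable ℝ f) (hg : Differentiable ℝ g) :
    gradient (fun x => f x + g x) = gradient f + gradient g := by
  ext1 x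
  simp only [gradient, Pi.add_apply, ← map_add]
  rw [fderiv_fun_add (hf x) (hg x)]

theorem gradient_smul' {f : Pt d → ℝ} (hf : Differentiable ℝ f) (c : ℝ) :
    gradient (fun x => c * f x) = c • gradient f := by
  ext1 x
  simp only [gradient, Pi.smul_apply]
  rw [fderiv_const_mul (hf x), map_smulₛₗ]
  simp

namespace IsField

theorem zero : IsField (0 : Pt d → Pt d) :=
  ⟨fun _ => 0, contDiff_const, ⟨fun _ _ => rfl, fun _ _ => rfl⟩, by simp; rfl⟩

theorem add {g g' : Pt d → Pt d} (h : IsField g) (h' : IsField g') : IsField (g + g') := by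
  obtain ⟨ψ, h1, h2, rfl⟩ := h
  obtain ⟨ψ', h1', h2', rfl⟩ := h'
  refine ⟨fun x => ψ x + ψ' x, h1.add h1', ⟨fun i x => ?_, fun i x => ?_⟩,
    (gradient_add' (h1.differentiable (by simp)) (h1'.differentiable (by simp))).symm⟩
  · simp only [h2.1, h2'.1]
  · simp only [h2.2, h2'.2]

theorem smul {g : Pt d → Pt d} (h : IsField g) (c : ℝ) : IsField (c • g) := by
  obtain ⟨ψ, h1, h2, rfl⟩ := h
  refine ⟨fun x => c * ψ x, contDiff_const.mul h1, ⟨fun i x => ?_, fun i x => ?_⟩,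
    (gradient_smul' (h1.differentiable (by simp)) c).symm⟩
  · simp only [h2.1]
  · simp only [h2.2]

theorem contDiff {g : Pt d → Pt d} (h : IsField g) : ContDiff ℝ ∞ g := by
  obtain ⟨ψ, h1, -, rfl⟩ := h
  exact contDiff_gradient h1

theorem differentiable {g : Pt d → Pt d} (h : IsField g) : Differentiable ℝ g :=
  h.contDiff.differentiable (by simp)

theorem continuous_fderiv {g : Pt d → Pt d} (h : IsField g) : Continuous (fderiv ℝ g) :=
  h.contDiff.continuous_fderiv (by simp)

theorem inner_symm {g : Pt d → Pt d} (h : IsField g) (x v w : Pt d) :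
    inner ℝ (fderiv ℝ g x v) w = inner ℝ v (fderiv ℝ g x w) := by
  obtain ⟨ψ, h1, -, rfl⟩ := h
  exact inner_fderiv_gradient_symm h1 x v w

/-- The reflection of the `i`-th coordinate. -/
def refl (i : Fin d) : Pt d →L[ℝ] Pt d :=
  1 - (2 : ℝ) • (EuclideanSpace.proj i : Pt d →L[ℝ] ℝ).smulRight (EuclideanSpace.single i (1 : ℝ))

theorem refl_apply (i : Fin d) (x : Pt d) :
    refl i x = x - EuclideanSpace.single i (2 * x i) := by
  ext j
  by_cases h : j = i <;> simp [refl, h]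

theorem refl_apply_same (i : Fin d) (x : Pt d) : refl i x i = -x i := by
  rw [refl_apply]; simp; ring

theorem refl_apply_ne {i j : Fin d} (h : j ≠ i) (x : Pt d) : refl i x j = x j := by
  rw [refl_apply]; simp [h]

theorem refl_refl (i : Fin d) (x : Pt d) : refl i (refl i x) = x := by
  ext j
  by_cases h : j = i
  · subst h; rw [refl_apply_same, refl_apply_same, neg_neg]
  · rw [refl_apply_ne h, refl_apply_ne h]

theorem inner_refl (i : Fin d) (x y : Pt d) : inner ℝ (refl i x) y = inner ℝ x (refl i y) := by
  rw [refl_apply, refl_apply, inner_sub_left, inner_sub_right]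
  simp [EuclideanSpace.inner_single_left, EuclideanSpace.inner_single_right]
  ring

/-- Chain rule for a reflection-invariant potential; the reflection is its own adjoint and its own
inverse. -/
theorem apply_refl {g : Pt d → Pt d} (h : IsField g) (i : Fin d) (x : Pt d) :
    g (refl i x) = refl i (g x) := by
  obtain ⟨ψ, h1, h2, rfl⟩ := h
  have hd := h1.differentiable (by simp)
  have hc : ψ ∘ refl i = ψ := by ext y; simp only [Function.comp, refl_apply]; exact h2.1 i y
  refine ext_inner_right ℝ fun v => ?_
  have h3 : fderiv ℝ ψ x = fderiv ℝ ψ (refl i x) ∘L refl i := by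
    conv_lhs => rw [← hc]
    rw [fderiv_comp x (hd _) (refl i).differentiableAt, ContinuousLinearMap.fderiv]
  rw [inner_refl, inner_gradient_left, inner_gradient_left, h3, ContinuousLinearMap.comp_apply,
    refl_refl]

theorem apply_add_single {g : Pt d → Pt d} (h : IsField g) (i : Fin d) (x : Pt d) :
    g (x + EuclideanSpace.single i 2) = g x := by
  obtain ⟨ψ, h1, h2, rfl⟩ := h
  have hc : (fun y => ψ (y + EuclideanSpace.single i 2)) = ψ := funext fun y => h2.2 i y
  have : fderiv ℝ ψ (x + EuclideanSpace.single i 2) = fderiv ℝ ψ x := by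
    conv_rhs => rw [← hc]
    rw [fderiv_comp_add_right]
  simp only [gradient, this]

theorem refl_add_single_of_eq_one {i : Fin d} {x : Pt d} (hx : x i = 1) :
    refl i x + EuclideanSpace.single i 2 = x := by
  rw [refl_apply, hx, mul_one, sub_add_cancel]

theorem refl_of_eq_zero {i : Fin d} {x : Pt d} (hx : x i = 0) : refl i x = x := by
  rw [refl_apply, hx]; simp

/-- A point of the face is fixed by the reflection, followed by a translation by one period if `x i
= 1`. Equivariance then makes the normal component equal to its negative. -/
theorem tangential {g : Pt d → Pt d} (h : IsField g) {i : Fin d} {x : Pt d}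
    (hx : x i = 0 ∨ x i = 1) : g x i = 0 := by
  have h1 : g x = refl i (g x) := by
    rw [← h.apply_refl]
    rcases hx with hx | hx
    · rw [refl_of_eq_zero hx]
    · rw [← h.apply_add_single i (refl i x), refl_add_single_of_eq_one hx]
  have h2 := congrArg (fun y : Pt d => y i) h1
  simp only [refl_apply_same] at h2
  linarith

theorem apply_add_single_zmul {g : Pt d → Pt d} (h : IsField g) (i : Fin d) (n : ℤ) (x : Pt d) :
    g (x + EuclideanSpace.single i (2 * (n : ℝ))) = g x := by
  have key : Function.Periodic (fun s : ℝ => g (x + EuclideanSpace.single i s)) 2 := fun s => by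
    have : EuclideanSpace.single i (s + 2) =
        EuclideanSpace.single i s + (EuclideanSpace.single i 2 : Pt d) := by
      ext j; by_cases hj : j = i <;> simp [hj]
    simp only [this, ← add_assoc, h.apply_add_single]
  have h0 : (EuclideanSpace.single i (0 : ℝ) : Pt d) = 0 := by ext j; simp
  have := key.int_mul n 0
  simp only [zero_add, h0, add_zero] at this
  rwa [mul_comm] at this

/-- Reflections and translations fold the whole space onto the closed cube, one coordinate at a
time. The functional sees maps only on the cube, while uniqueness is asserted for maps on `ℝ^d`;
this lemma bridges the two. -/
theorem eq_zero_of_eqOn {g : Pt d → Pt d} (h : IsField g) (h0 : ∀ x ∈ closedCube d, g x = 0) :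
    g = 0 := by
  have key : ∀ (s : Finset (Fin d)) (x : Pt d), (∀ i ∉ s, x i ∈ Icc (0 : ℝ) 1) → g x = 0 := by
    intro s
    induction s using Finset.induction_on with
    | empty => exact fun x hx => h0 x fun i => hx i (by simp)
    | insert i s hi ih =>
      intro x hx
      -- Subtracting `2 * n` brings the coordinate into `[-1, 1)`; a negative result is then
      -- reflected.
      set n : ℤ := ⌊(x i + 1) / 2⌋ with hn
      set y := x + EuclideanSpace.single i (2 * ((-n : ℤ) : ℝ)) with hy
      have hyi : y i = x i - 2 * n := by simp [hy]; ring
      have h1 := Int.floor_le ((x i + 1) / 2)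
      have h2 := Int.lt_floor_add_one ((x i + 1) / 2)
      rw [← hn] at h1 h2
      have hyj : ∀ j, j ≠ i → y j = x j := fun j hj => by simp [hy, hj]
      have hgy : g y = g x := h.apply_add_single_zmul i (-n) x
      rw [← hgy]
      rcases le_or_gt 0 (y i) with h3 | h3
      · refine ih y fun j hj => ?_
        by_cases hji : j = i
        · subst hji; exact ⟨h3, by rw [hyi]; linarith⟩
        · rw [hyj j hji]; exact hx j (by simp [hji, hj])
      · have : g (refl i y) = 0 := by
          refine ih _ fun j hj => ?_
          by_cases hji : j = i
          · subst hji; rw [refl_apply_same]; exact ⟨by linarith, by rw [hyi]; linarith⟩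
          · rw [refl_apply_ne hji, hyj j hji]; exact hx j (by simp [hji, hj])
        rw [h.apply_refl] at this
        rw [← refl_refl i (g y), this, map_zero]
  exact funext fun x => key Finset.univ x (by simp)

/-- The Jacobian determinant of `id + g` has the symmetries of the potential. -/
theorem det_refl {g : Pt d → Pt d} (h : IsField g) (i : Fin d) (x : Pt d) :
    (1 + fderiv ℝ g (refl i x)).det = (1 + fderiv ℝ g x).det := by
  have h1 : fderiv ℝ g (refl i x) = refl i ∘L fderiv ℝ g x ∘L refl i := by
    have h2 : fderiv ℝ g (refl i x) ∘L refl i = refl i ∘L fderiv ℝ g x := by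
      have : g ∘ refl i = refl i ∘ g := funext (h.apply_refl i)
      have h3 := congrArg (fun f => fderiv ℝ f x) this
      rwa [fderiv_comp x (h.differentiable _) (refl i).differentiableAt,
        fderiv_comp x (refl i).differentiableAt (h.differentiable _),
        ContinuousLinearMap.fderiv, ContinuousLinearMap.fderiv] at h3
    ext1 v
    have := congrArg (fun f : Pt d →L[ℝ] Pt d => f (refl i v)) h2
    simpa [refl_refl] using this
  have hRR : refl i ∘L refl i = 1 := by ext1 v; exact refl_refl i v
  have hdet : (refl i).det * (refl i).det = 1 := by
    have : (refl i ∘L refl i).det = (refl i).det * (refl i).det := LinearMap.det_comp _ _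
    rw [← this, hRR]; exact LinearMap.det_id
  have h4 : (1 + fderiv ℝ g (refl i x)) = refl i ∘L (1 + fderiv ℝ g x) ∘L refl i := by
    rw [h1]
    ext1 v
    simp [refl_refl]
  have h5 : (refl i ∘L (1 + fderiv ℝ g x) ∘L refl i).det =
      (refl i).det * ((1 + fderiv ℝ g x).det * (refl i).det) :=
    (LinearMap.det_comp _ _).trans (congrArg _ (LinearMap.det_comp _ _))
  rw [h4, h5]
  linear_combination (1 + fderiv ℝ g x).det * hdet

theorem fderiv_add_single {g : Pt d → Pt d} (h : IsField g) (i : Fin d) (x : Pt d) :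
    fderiv ℝ g (x + EuclideanSpace.single i 2) = fderiv ℝ g x := by
  have hc : (fun y => g (y + EuclideanSpace.single i 2)) = g :=
    funext fun y => h.apply_add_single i y
  conv_rhs => rw [← hc]
  rw [fderiv_comp_add_right]

theorem contDiff_det {g : Pt d → Pt d} (h : IsField g) :
    ContDiff ℝ ∞ (fun x => (1 + fderiv ℝ g x).det) :=
  FokkerPlanck.contDiff_det.comp (contDiff_const.add (h.contDiff.fderiv_right (by simp)))

theorem _root_.FokkerPlanck.refl_add_smul_single (i : Fin d) (x : Pt d) (s : ℝ) :
    refl i (x + s • EuclideanSpace.single i 1) = refl i x - s • EuclideanSpace.single i 1 := by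
  ext j
  by_cases h : j = i
  · subst h
    rw [refl_apply_same, PiLp.sub_apply, refl_apply_same]; simp; ring
  · rw [refl_apply_ne h, PiLp.sub_apply, refl_apply_ne h]; simp [h]

/-- A smooth function with an interior-type minimum on the closed cube and the reflection symmetry
has vanishing derivative there. -/
theorem fderiv_det_eq_zero {g : Pt d → Pt d} (h : IsField g)
    (hnn : ∀ x ∈ closedCube d, 0 ≤ (1 + fderiv ℝ g x).det) {x₀ : Pt d} (hx₀ : x₀ ∈ closedCube d)
    (h0 : (1 + fderiv ℝ g x₀).det = 0) :
    fderiv ℝ (fun x => (1 + fderiv ℝ g x).det) x₀ = 0 := by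
  set J := fun x => (1 + fderiv ℝ g x).det with hJ
  have hJd : Differentiable ℝ J := h.contDiff_det.differentiable (by simp)
  have key : ∀ i : Fin d, fderiv ℝ J x₀ (EuclideanSpace.single i 1) = 0 := by
    intro i
    set f : ℝ → ℝ := fun s => J (x₀ + s • EuclideanSpace.single i 1) with hf
    have hfd : HasDerivAt f (fderiv ℝ J x₀ (EuclideanSpace.single i 1)) 0 := by
      have h1 : HasDerivAt (fun s : ℝ => x₀ + s • EuclideanSpace.single i (1 : ℝ))
          (EuclideanSpace.single i 1) 0 := by
        simpa using ((hasDerivAt_id (0 : ℝ)).smul_const (EuclideanSpace.single i (1 : ℝ))).const_add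
          x₀
      have h2 : HasFDerivAt J (fderiv ℝ J x₀) (x₀ + (0 : ℝ) • EuclideanSpace.single i (1 : ℝ)) := by
        simpa using (hJd x₀).hasFDerivAt
      exact h2.comp_hasDerivAt 0 h1
    -- On a face the determinant is even in the normal direction, so its normal derivative vanishes.
    -- Otherwise short segments in direction `i` stay in the closed cube, where the value zero is a
    -- minimum.
    by_cases hb : x₀ i = 0 ∨ x₀ i = 1
    · have heven : ∀ s, f (-s) = f s := by
        intro s
        simp only [hf, hJ]
        rw [← h.det_refl i (x₀ + s • EuclideanSpace.single i 1), refl_add_smul_single]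
        rcases hb with hb | hb
        · rw [refl_of_eq_zero hb, neg_smul, sub_eq_add_neg]
        · rw [← h.fderiv_add_single i (refl i x₀ - s • EuclideanSpace.single i 1),
            sub_add_eq_add_sub, refl_add_single_of_eq_one hb, neg_smul, sub_eq_add_neg]
      have h3 : HasDerivAt f (-(fderiv ℝ J x₀ (EuclideanSpace.single i 1))) 0 := by
        have h4 : HasDerivAt f (fderiv ℝ J x₀ (EuclideanSpace.single i 1)) (-0) := by simpa using hfd
        have h5 := h4.comp (0 : ℝ) (hasDerivAt_neg 0)
        rw [mul_neg_one] at h5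
        exact h5.congr_of_eventuallyEq (Eventually.of_forall fun s => (heven s).symm)
      have := hfd.unique h3
      linarith
    · push Not at hb
      have hlt : x₀ i ∈ Ioo (0 : ℝ) 1 :=
        ⟨lt_of_le_of_ne (hx₀ i).1 (Ne.symm hb.1), lt_of_le_of_ne (hx₀ i).2 hb.2⟩
      have hmin : IsLocalMin f 0 := by
        have hcont : Tendsto (fun s : ℝ => x₀ i + s) (𝓝 0) (𝓝 (x₀ i)) := by
          have : Continuous fun s : ℝ => x₀ i + s := by fun_prop
          simpa using this.tendsto 0
        filter_upwards [hcont.eventually (isOpen_Ioo.mem_nhds hlt)] with s hs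
        have h00 : f 0 = 0 := by simp [hf, hJ, h0]
        rw [h00]
        refine hnn _ fun j => ?_
        by_cases hj : j = i
        · subst hj; simpa using Ioo_subset_Icc_self hs
        · simpa [hj] using hx₀ j
      exact hmin.hasDerivAt_eq_zero hfd
  refine ContinuousLinearMap.coe_injective
    ((EuclideanSpace.basisFun (Fin d) ℝ).toBasis.ext fun i => ?_)
  simpa using key i

end IsField

end Fields

/-! ### Admissible and regular maps of the cube. -/

section Admissible

variable {d : ℕ}

/-- Perturbations `t` of the identity by a field, such that `Dt` is positive semidefinite on the
closed cube. -/
structure Adm (t : Pt d → Pt d) : Prop where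
  field : IsField (t - id)
  psd : ∀ x ∈ closedCube d, (fderiv ℝ t x).IsPositive

/-- Admissible maps with non-degenerate derivative. -/
structure Reg (t : Pt d → Pt d) : Prop extends Adm t where
  det_pos : ∀ x ∈ closedCube d, 0 < (fderiv ℝ t x).det

theorem IsField.contDiff_of_sub_id {t : Pt d → Pt d} (h : IsField (t - id)) : ContDiff ℝ ∞ t := by
  simpa using h.contDiff.add contDiff_id

theorem IsField.fderiv_of_sub_id {t : Pt d → Pt d} (h : IsField (t - id)) (x : Pt d) :
    fderiv ℝ t x = 1 + fderiv ℝ (t - id) x := by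
  have h1 := (h.differentiable x).hasFDerivAt.add (hasFDerivAt_id x)
  rw [sub_add_cancel] at h1
  rw [h1.fderiv, add_comm]; rfl

theorem IsField.isPositive_iff {t : Pt d → Pt d} (h : IsField (t - id)) {x : Pt d} :
    (fderiv ℝ t x).IsPositive ↔ ∀ v, 0 ≤ inner ℝ (fderiv ℝ t x v) v := by
  refine ⟨fun h v => h.inner_nonneg_left v, fun h1 => ?_⟩
  rw [ContinuousLinearMap.isPositive_def]
  refine ⟨fun v w => ?_, h1⟩
  rw [h.fderiv_of_sub_id]
  simp only [ContinuousLinearMap.coe_coe, add_apply, inner_add_left,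
    inner_add_right, one_apply_eq_self, h.inner_symm]

theorem IsField.apply_coord {t : Pt d → Pt d} (h : IsField (t - id)) {x : Pt d} {i : Fin d}
    (hx : x i = 0 ∨ x i = 1) : t x i = x i := by
  have := h.tangential hx
  simp only [Pi.sub_apply, id, PiLp.sub_apply] at this
  linarith

namespace Adm

theorem contDiff {t : Pt d → Pt d} (h : Adm t) : ContDiff ℝ ∞ t := h.field.contDiff_of_sub_id

theorem continuous {t : Pt d → Pt d} (h : Adm t) : Continuous t := h.contDiff.continuous

theorem differentiable {t : Pt d → Pt d} (h : Adm t) : Differentiable ℝ t :=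
  h.contDiff.differentiable (by simp)

theorem continuous_fderiv {t : Pt d → Pt d} (h : Adm t) : Continuous (fderiv ℝ t) :=
  h.contDiff.continuous_fderiv (by simp)

theorem continuous_det {t : Pt d → Pt d} (h : Adm t) : Continuous fun x => (fderiv ℝ t x).det :=
  contDiff_det.continuous.comp h.continuous_fderiv

theorem det_nonneg {t : Pt d → Pt d} (h : Adm t) {x : Pt d} (hx : x ∈ closedCube d) :
    0 ≤ (fderiv ℝ t x).det := det_nonneg_of_isPositive (h.psd x hx)

theorem id : Adm (id : Pt d → Pt d) :=
  ⟨by simpa using IsField.zero, fun x _ => by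
    rw [fderiv_id]; exact ContinuousLinearMap.isPositive_id⟩

theorem fderiv_combo {t s : Pt d → Pt d} (ht : Adm t) (hs : Adm s) (α β : ℝ) (x : Pt d) :
    fderiv ℝ (α • t + β • s) x = α • fderiv ℝ t x + β • fderiv ℝ s x :=
  (((ht.differentiable x).hasFDerivAt.const_smul α).add
    ((hs.differentiable x).hasFDerivAt.const_smul β)).fderiv

theorem combo_sub_id (t s : Pt d → Pt d) {α β : ℝ} (hαβ : α + β = 1) :
    α • t + β • s - _root_.id = α • (t - _root_.id) + β • (s - _root_.id) := by
  rw [← eq_sub_iff_add_eq'] at hαβ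
  subst hαβ
  module

theorem combo {t s : Pt d → Pt d} (ht : Adm t) (hs : Adm s) {α β : ℝ} (hα : 0 ≤ α) (hβ : 0 ≤ β)
    (hαβ : α + β = 1) : Adm (α • t + β • s) := by
  refine ⟨?_, fun x hx => ?_⟩
  · rw [combo_sub_id t s hαβ]
    exact (ht.field.smul α).add (hs.field.smul β)
  · rw [ht.fderiv_combo hs]
    exact ((ht.psd x hx).smul_of_nonneg hα).add ((hs.psd x hx).smul_of_nonneg hβ)

theorem hasDerivAt_coord {t : Pt d → Pt d} (ht : Adm t) (x : Pt d) (i : Fin d) (s : ℝ) :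
    HasDerivAt (fun s => t (x + s • EuclideanSpace.single i (1 : ℝ)) i)
      (inner ℝ (fderiv ℝ t (x + s • EuclideanSpace.single i (1 : ℝ)) (EuclideanSpace.single i 1))
        (EuclideanSpace.single i (1 : ℝ))) s := by
  have h1 : HasDerivAt (fun s : ℝ => x + s • EuclideanSpace.single i (1 : ℝ))
      (EuclideanSpace.single i 1) s := by
    simpa using ((hasDerivAt_id s).smul_const (EuclideanSpace.single i (1 : ℝ))).const_add x
  have h2 := (ht.differentiable (x + s • EuclideanSpace.single i (1 : ℝ))).hasFDerivAt.comp_hasDerivAt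
    s h1
  have h3 := (EuclideanSpace.proj i : Pt d →L[ℝ] ℝ).hasFDerivAt.comp_hasDerivAt s h2
  exact h3.congr_deriv (by simp [EuclideanSpace.inner_single_right])

theorem update_mem {x : Pt d} (hx : x ∈ closedCube d) {i : Fin d} {s : ℝ}
    (hs : x i + s ∈ Icc (0 : ℝ) 1) : x + s • EuclideanSpace.single i (1 : ℝ) ∈ closedCube d := by
  intro j
  by_cases hj : j = i
  · subst hj; simpa using hs
  · simpa [hj] using hx j

/-- The derivative is a diagonal entry of the positive semidefinite `Dt`. The parameter range is
exactly the segment through `x` from one `i`-face to the other. -/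
theorem monotoneOn_coord {t : Pt d → Pt d} (ht : Adm t) {x : Pt d} (hx : x ∈ closedCube d)
    (i : Fin d) :
    MonotoneOn (fun s => t (x + s • EuclideanSpace.single i (1 : ℝ)) i) (Icc (-x i) (1 - x i)) := by
  refine monotoneOn_of_deriv_nonneg (convex_Icc _ _)
    (fun s _ => (ht.hasDerivAt_coord x i s).continuousAt.continuousWithinAt)
    (fun s _ => (ht.hasDerivAt_coord x i s).differentiableAt.differentiableWithinAt) fun s hs => ?_
  rw [interior_Icc] at hs
  rw [(ht.hasDerivAt_coord x i s).deriv]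
  exact (ht.psd _ (update_mem hx ⟨by linarith [hs.1], by linarith [hs.2]⟩)).inner_nonneg_left _

theorem coord_lower (ht : IsField (t - _root_.id)) (x : Pt d) (i : Fin d) :
    t (x + (-x i) • EuclideanSpace.single i (1 : ℝ)) i = 0 := by
  rw [ht.apply_coord (Or.inl (by simp))]; simp

theorem coord_upper (ht : IsField (t - _root_.id)) (x : Pt d) (i : Fin d) :
    t (x + (1 - x i) • EuclideanSpace.single i (1 : ℝ)) i = 1 := by
  rw [ht.apply_coord (Or.inr (by simp))]; simp

/-- The component `t i` is monotone along the `i`-segment through `x` and takes the values `0` and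
`1` at its ends. -/
theorem mapsTo {t : Pt d → Pt d} (ht : Adm t) : MapsTo t (closedCube d) (closedCube d) := by
  intro x hx i
  have h0 : x + (0 : ℝ) • EuclideanSpace.single i (1 : ℝ) = x := by simp
  have hm := ht.monotoneOn_coord hx i
  have hxi := hx i
  have m0 : (0 : ℝ) ∈ Icc (-x i) (1 - x i) := ⟨by linarith [hxi.1], by linarith [hxi.2]⟩
  have m1 : -x i ∈ Icc (-x i) (1 - x i) := ⟨le_rfl, by linarith⟩
  have m2 : 1 - x i ∈ Icc (-x i) (1 - x i) := ⟨by linarith, le_rfl⟩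
  have h1 := hm m1 m0 m0.1
  have h2 := hm m0 m2 m0.2
  simp only [h0, coord_lower ht.field, coord_upper ht.field] at h1 h2
  exact ⟨h1, h2⟩

end Adm

namespace Reg

theorem id : Reg (id : Pt d → Pt d) :=
  { Adm.id with
    det_pos := fun x _ => by
      have : (ContinuousLinearMap.id ℝ (Pt d)).det = 1 := LinearMap.det_id
      rw [fderiv_id, this]; exact one_pos }

theorem inner_pos {t : Pt d → Pt d} (ht : Reg t) {x : Pt d} (hx : x ∈ closedCube d) {v : Pt d}
    (hv : v ≠ 0) : 0 < inner ℝ (fderiv ℝ t x v) v :=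
  inner_pos_of_isPositive_of_det_pos (ht.psd x hx) (ht.det_pos x hx) hv

/-- The strict version of the monotonicity argument. Only the `i`-th coordinate has to be interior,
so the lemma also shows that preimages of points of an `i`-face lie on an `i`-face. -/
theorem coord_mem {t : Pt d → Pt d} (ht : Reg t) {x : Pt d} (hxc : x ∈ closedCube d) {i : Fin d}
    (hxi : x i ∈ Ioo (0 : ℝ) 1) : t x i ∈ Ioo (0 : ℝ) 1 := by
  have h0 : x + (0 : ℝ) • EuclideanSpace.single i (1 : ℝ) = x := by simp
  have hm : StrictMonoOn (fun s => t (x + s • EuclideanSpace.single i (1 : ℝ)) i)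
      (Icc (-x i) (1 - x i)) := by
    refine strictMonoOn_of_deriv_pos (convex_Icc _ _)
      (fun s _ => (ht.hasDerivAt_coord x i s).continuousAt.continuousWithinAt) fun s hs => ?_
    rw [interior_Icc] at hs
    rw [(ht.hasDerivAt_coord x i s).deriv]
    exact ht.inner_pos (Adm.update_mem hxc ⟨by linarith [hs.1], by linarith [hs.2]⟩) (by simp)
  have m0 : (0 : ℝ) ∈ Icc (-x i) (1 - x i) := ⟨by linarith [hxi.1], by linarith [hxi.2]⟩
  have m1 : -x i ∈ Icc (-x i) (1 - x i) := ⟨le_rfl, by linarith⟩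
  have m2 : 1 - x i ∈ Icc (-x i) (1 - x i) := ⟨by linarith, le_rfl⟩
  have h1 := hm m1 m0 (by linarith [hxi.1])
  have h2 := hm m0 m2 (by linarith [hxi.2])
  simp only [h0, Adm.coord_lower ht.field, Adm.coord_upper ht.field] at h1 h2
  exact ⟨h1, h2⟩

theorem mapsTo_cube {t : Pt d → Pt d} (ht : Reg t) : MapsTo t (cube d) (cube d) :=
  fun _ hx i => ht.coord_mem (cube_subset_closedCube hx) (hx i)

/-- Strict monotonicity: `⟨t (x + s v), v⟩` is strictly increasing along the segment from `x` to `y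
= x + v`. -/
theorem injOn {t : Pt d → Pt d} (ht : Reg t) : InjOn t (closedCube d) := by
  intro x hx y hy hxy
  by_contra hne
  set v := y - x with hv
  have hv0 : v ≠ 0 := sub_ne_zero.2 (Ne.symm hne)
  have hd : ∀ s : ℝ, HasDerivAt (fun s : ℝ => inner ℝ (t (x + s • v)) v)
      (inner ℝ (fderiv ℝ t (x + s • v) v) v) s := by
    intro s
    have h1 : HasDerivAt (fun s : ℝ => x + s • v) v s := by
      simpa using ((hasDerivAt_id s).smul_const v).const_add x
    have h2 := (ht.differentiable (x + s • v)).hasFDerivAt.comp_hasDerivAt s h1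
    simpa using h2.inner ℝ (hasDerivAt_const s v)
  have hm : StrictMonoOn (fun s : ℝ => inner ℝ (t (x + s • v)) v) (Icc 0 1) := by
    refine strictMonoOn_of_deriv_pos (convex_Icc _ _)
      (fun s _ => (hd s).continuousAt.continuousWithinAt) fun s hs => ?_
    rw [interior_Icc] at hs
    rw [(hd s).deriv]
    refine ht.inner_pos ?_ hv0
    exact convex_closedCube.add_smul_sub_mem hx hy ⟨hs.1.le, hs.2.le⟩
  have := hm (left_mem_Icc.2 zero_le_one) (right_mem_Icc.2 zero_le_one) zero_lt_one
  simp [hv, hxy] at this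

/-- The derivative of a regular map as a continuous linear equivalence. -/
theorem exists_equiv {t : Pt d → Pt d} (ht : Reg t) {x : Pt d} (hx : x ∈ closedCube d) :
    ∃ e : Pt d ≃L[ℝ] Pt d, HasStrictFDerivAt t (e : Pt d →L[ℝ] Pt d) x := by
  refine ⟨ContinuousLinearMap.toContinuousLinearEquivOfDetNeZero (fderiv ℝ t x)
    (ht.det_pos x hx).ne', ?_⟩
  rw [ContinuousLinearMap.coe_toContinuousLinearEquivOfDetNeZero]
  exact ht.contDiff.contDiffAt.hasStrictFDerivAt (by simp)

/-- The image of the open cube is open by the inverse function theorem. It is relatively closed in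
the open cube, since faces go to faces and the closed cube has compact image. The cube is connected.
-/
theorem surjOn_cube {t : Pt d → Pt d} (ht : Reg t) : SurjOn t (cube d) (cube d) := by
  have hcl : t '' closedCube d ∩ cube d ⊆ t '' cube d := by
    rintro y ⟨⟨x, hx, rfl⟩, hy⟩
    refine ⟨x, fun i => ?_, rfl⟩
    have hxi := hx i
    refine ⟨lt_of_le_of_ne hxi.1 fun h => ?_, lt_of_le_of_ne hxi.2 fun h => ?_⟩
    · have := ht.field.apply_coord (Or.inl h.symm)
      exact (hy i).1.ne' (by rw [this, ← h])
    · have := ht.field.apply_coord (Or.inr h)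
      exact (hy i).2.ne (by rw [this, h])
  have hopen : IsOpen (t '' cube d) := by
    rw [isOpen_iff_mem_nhds]
    rintro _ ⟨x, hx, rfl⟩
    obtain ⟨e, he⟩ := ht.exists_equiv (cube_subset_closedCube hx)
    rw [← he.map_nhds_eq_of_equiv]
    exact image_mem_map (isOpen_cube.mem_nhds hx)
  have hclosed : IsClosed (t '' closedCube d) :=
    (isCompact_closedCube.image ht.continuous).isClosed
  have hpre : IsPreconnected (cube d) := convex_cube.isPreconnected
  intro y hy
  by_contra hne
  obtain ⟨z, hz, hz1, hz2⟩ := hpre (t '' cube d) (t '' closedCube d)ᶜ hopen hclosed.isOpen_compl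
    (fun z hz => by
      by_cases h : z ∈ t '' closedCube d
      · exact Or.inl (hcl ⟨h, hz⟩)
      · exact Or.inr h)
    ⟨t (center d), ht.mapsTo_cube center_mem_cube, mem_image_of_mem _ center_mem_cube⟩
    ⟨y, hy, fun h => hne (hcl ⟨h, hy⟩)⟩
  exact hz2 (image_mono cube_subset_closedCube hz1)

theorem bijOn {t : Pt d → Pt d} (ht : Reg t) : BijOn t (closedCube d) (closedCube d) := by
  refine ⟨ht.mapsTo, ht.injOn, ?_⟩
  have hclosed : IsClosed (t '' closedCube d) :=
    (isCompact_closedCube.image ht.continuous).isClosed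
  intro y hy
  rw [← closure_cube] at hy
  refine closure_minimal ?_ hclosed hy
  exact (ht.surjOn_cube).trans (image_mono cube_subset_closedCube)

theorem jac_eq {t : Pt d → Pt d} (ht : DifferentiableAt ℝ t x) (hx : x ∈ closedCube d) :
    jac t x = (fderiv ℝ t x).det := by
  rw [jac, ht.fderivWithin (uniqueDiffOn_closedCube x hx)]

theorem isDiffPlus {t : Pt d → Pt d} (ht : Reg t) : IsDiffPlus t where
  contDiffOn := (ht.contDiff.of_le (by simp)).contDiffOn
  bijOn := ht.bijOn
  jac_pos := fun x hx => by rw [jac_eq (ht.differentiable x) hx]; exact ht.det_pos x hx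
  corner := fun x hx => by ext i; exact ht.field.apply_coord (hx i)

theorem combo (hd : 0 < d) {t s : Pt d → Pt d} (ht : Adm t) (hs : Adm s) (h : Reg t ∨ Reg s)
    {α β : ℝ} (hα : 0 < α) (hβ : 0 < β) (hαβ : α + β = 1) : Reg (α • t + β • s) :=
  { ht.combo hs hα.le hβ.le hαβ with
    det_pos := fun x hx => by
      rw [ht.fderiv_combo hs]
      exact det_pos_add hd (ht.psd x hx) (hs.psd x hx) hα hβ
        (h.imp (fun h => h.det_pos x hx) (fun h => h.det_pos x hx)) }

end Reg

/-! ### From admissible potentials to maps with displacement in a finite-dimensional span. -/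

section Potentials

theorem hasGradientAt_half_norm_sq_add {ψ : Pt d → ℝ} (h : ContDiff ℝ ∞ ψ) (x : Pt d) :
    HasGradientAt (fun x => ‖x‖ ^ 2 / 2 + ψ x) (x + gradient ψ x) x := by
  rw [hasGradientAt_iff_hasFDerivAt]
  have h1 := ((hasStrictFDerivAt_norm_sq x).hasFDerivAt.const_mul (1 / 2 : ℝ)).add
    (h.differentiable (by simp) x).hasFDerivAt
  have h2 : (fun x => ‖x‖ ^ 2 / 2 + ψ x) = (fun y : Pt d => 1 / 2 * ‖y‖ ^ 2) + ψ := by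
    ext y; simp; ring
  rw [h2]
  refine h1.congr_fderiv ?_
  ext v
  simp

theorem gradient_half_norm_sq_add {ψ : Pt d → ℝ} (h : ContDiff ℝ ∞ ψ) :
    gradient (fun x => ‖x‖ ^ 2 / 2 + ψ x) = fun x => x + gradient ψ x :=
  gradient_eq fun x => hasGradientAt_half_norm_sq_add h x

theorem hasDerivAt_line {φ : Pt d → ℝ} {t : Pt d → Pt d} (hφ : ∀ x, HasGradientAt φ (t x) x)
    (x v : Pt d) (s : ℝ) :
    HasDerivAt (fun s : ℝ => φ (x + s • v)) (inner ℝ (t (x + s • v)) v) s := by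
  have h1 : HasDerivAt (fun s : ℝ => x + s • v) v s := by
    simpa using ((hasDerivAt_id s).smul_const v).const_add x
  exact ((hφ (x + s • v)).hasFDerivAt.comp_hasDerivAt s h1).congr_deriv (by simp)

theorem hasDerivAt_inner_line {t : Pt d → Pt d} (ht : Differentiable ℝ t) (x v : Pt d) (s : ℝ) :
    HasDerivAt (fun s : ℝ => inner ℝ (t (x + s • v)) v)
      (inner ℝ (fderiv ℝ t (x + s • v) v) v) s := by
  have h1 : HasDerivAt (fun s : ℝ => x + s • v) v s := by
    simpa using ((hasDerivAt_id s).smul_const v).const_add x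
  have h2 := (ht (x + s • v)).hasFDerivAt.comp_hasDerivAt s h1
  simpa using h2.inner ℝ (hasDerivAt_const s v)

theorem convexOn_closedCube_iff {φ : Pt d → ℝ} {t : Pt d → Pt d}
    (hφ : ∀ x, HasGradientAt φ (t x) x) (ht : ContDiff ℝ ∞ t) :
    ConvexOn ℝ (closedCube d) φ ↔ ∀ x ∈ closedCube d, ∀ v, 0 ≤ inner ℝ (fderiv ℝ t x v) v := by
  have htd : Differentiable ℝ t := ht.differentiable (by simp)
  constructor
  · intro hc
    -- At interior points convexity can be tested on a short line in any direction; boundary points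
    -- follow by continuity of the derivative.
    have hcube : ∀ x ∈ cube d, ∀ v, 0 ≤ inner ℝ (fderiv ℝ t x v) v := by
      intro x hx v
      have hcont : Continuous fun s : ℝ => x + s • v := by fun_prop
      have hn : (fun s : ℝ => x + s • v) ⁻¹' cube d ∈ 𝓝 (0 : ℝ) :=
        (isOpen_cube.preimage hcont).mem_nhds (by simpa using hx)
      obtain ⟨ε, hε, hball⟩ := Metric.mem_nhds_iff.1 hn
      have hcv : ConvexOn ℝ (Metric.ball (0 : ℝ) ε) fun s : ℝ => φ (x + s • v) := by
        refine ⟨convex_ball _ _, fun a ha b hb α β hα hβ hαβ => ?_⟩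
        have h1 := hc.2 (cube_subset_closedCube (hball ha)) (cube_subset_closedCube (hball hb))
          hα hβ hαβ
        convert h1 using 2
        have hα' : α = 1 - β := by linarith
        subst hα'
        simp only [smul_eq_mul]
        module
      have hmono : MonotoneOn (fun s : ℝ => inner ℝ (t (x + s • v)) v) (Metric.ball 0 ε) := by
        have h1 := hcv.monotoneOn_deriv
          (fun s _ => (hasDerivAt_line hφ x v s).differentiableAt)
        intro a ha b hb hab
        have := h1 ha hb hab
        rwa [(hasDerivAt_line hφ x v a).deriv, (hasDerivAt_line hφ x v b).deriv] at this
      have h2 := hasDerivAt_inner_line htd x v 0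
      have h3 := hmono.derivWithin_nonneg (x := 0)
      rw [derivWithin_of_isOpen Metric.isOpen_ball (Metric.mem_ball_self hε), h2.deriv] at h3
      simpa using h3
    intro x hx v
    have hcl : IsClosed {x | 0 ≤ inner ℝ (fderiv ℝ t x v) v} := by
      refine isClosed_le continuous_const ?_
      have := ht.continuous_fderiv (by simp)
      fun_prop
    rw [← closure_cube] at hx
    exact closure_minimal (fun y hy => hcube y hy v) hcl hx
  · intro h
    refine ⟨convex_closedCube, fun x hx y hy α β hα hβ hαβ => ?_⟩
    have hc : ConvexOn ℝ (Icc (0 : ℝ) 1) fun s : ℝ => φ (x + s • (y - x)) := by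
      have hdiff : ∀ s, DifferentiableAt ℝ (fun s : ℝ => φ (x + s • (y - x))) s := fun s =>
        (hasDerivAt_line hφ x (y - x) s).differentiableAt
      have hderiv : deriv (fun s : ℝ => φ (x + s • (y - x))) =
          fun s : ℝ => inner ℝ (t (x + s • (y - x))) (y - x) :=
        funext fun s => (hasDerivAt_line hφ x (y - x) s).deriv
      refine convexOn_of_deriv2_nonneg (convex_Icc _ _)
        (fun s _ => (hdiff s).continuousAt.continuousWithinAt)
        (fun s _ => (hdiff s).differentiableWithinAt) ?_ fun s hs => ?_
      · rw [hderiv]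
        exact fun s _ =>
          (hasDerivAt_inner_line htd x (y - x) s).differentiableAt.differentiableWithinAt
      · rw [interior_Icc] at hs
        rw [Function.iterate_succ, Function.iterate_one, Function.comp, hderiv,
          (hasDerivAt_inner_line htd x (y - x) s).deriv]
        exact h _ (convex_closedCube.add_smul_sub_mem hx hy ⟨hs.1.le, hs.2.le⟩) _
    have h1 := hc.2 (left_mem_Icc.2 zero_le_one) (right_mem_Icc.2 zero_le_one) hα hβ hαβ
    have h2 : x + (α • (0 : ℝ) + β • (1 : ℝ)) • (y - x) = α • x + β • y := by
      have hα' : α = 1 - β := by linarith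
      subst hα'
      simp only [smul_eq_mul]
      module
    simp only [h2] at h1
    simpa using h1

variable {ι : Type*} {b : ι → Pt d → ℝ} {I : Finset ι}

theorem ansatz_contDiff (hb : ∀ k ∈ I, ContDiff ℝ ∞ (b k)) {ψ : Pt d → ℝ}
    (hψ : ψ ∈ ansatzSpace b I) : ContDiff ℝ ∞ ψ := by
  obtain ⟨z, rfl⟩ := hψ
  exact ContDiff.sum fun k hk => contDiff_const.mul (hb k hk)

theorem ansatz_isField (hb : ∀ k ∈ I, ContDiff ℝ ∞ (b k)) (hs : ∀ k ∈ I, IsSymPeriodic (b k))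
    {ψ : Pt d → ℝ} (hψ : ψ ∈ ansatzSpace b I) : IsField (gradient ψ) := by
  refine ⟨ψ, ansatz_contDiff hb hψ, ?_, rfl⟩
  obtain ⟨z, rfl⟩ := hψ
  exact ⟨fun i x => Finset.sum_congr rfl fun k hk => by rw [(hs k hk).1],
    fun i x => Finset.sum_congr rfl fun k hk => by rw [(hs k hk).2]⟩

/-- The span of the gradients of the ansatz functions. -/
def fieldSpan (b : ι → Pt d → ℝ) (I : Finset ι) : Submodule ℝ (Pt d → Pt d) :=
  Submodule.span ℝ ((fun k => gradient (b k)) '' I)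

instance : FiniteDimensional ℝ (fieldSpan b I) :=
  FiniteDimensional.span_of_finite ℝ (I.finite_toSet.image _)

theorem gradient_ansatz (hb : ∀ k ∈ I, ContDiff ℝ ∞ (b k)) (z : ι → ℝ) :
    gradient (fun x => ∑ k ∈ I, z k * b k x) = ∑ k ∈ I, z k • gradient (b k) := by
  classical
  induction I using Finset.induction_on with
  | empty => ext1 x; simp
  | insert i s hi ih =>
    simp only [Finset.sum_insert hi]
    have h1 : ContDiff ℝ ∞ (b i) := hb i (by simp)
    have h2 : ∀ k ∈ s, ContDiff ℝ ∞ (b k) := fun k hk => hb k (by simp [hk])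
    rw [gradient_add' (f := fun x => z i * b i x) (g := fun x => ∑ k ∈ s, z k * b k x)
      ((contDiff_const.mul h1).differentiable (by simp))
      ((ContDiff.sum fun k hk => contDiff_const.mul (h2 k hk)).differentiable (by simp)), ih h2,
      gradient_smul' (h1.differentiable (by simp))]

theorem mem_fieldSpan_iff (hb : ∀ k ∈ I, ContDiff ℝ ∞ (b k)) {g : Pt d → Pt d} :
    g ∈ fieldSpan b I ↔ ∃ ψ ∈ ansatzSpace b I, g = gradient ψ := by
  constructor
  · intro hg
    rw [fieldSpan, Submodule.mem_span_image_finset_iff_exists_fun] at hg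
    obtain ⟨z, rfl⟩ := hg
    classical
    refine ⟨_, ⟨fun k => if h : k ∈ I then z ⟨k, h⟩ else 0, rfl⟩, ?_⟩
    rw [gradient_ansatz hb, ← Finset.sum_coe_sort I]
    simp
  · rintro ⟨_, ⟨z, rfl⟩, rfl⟩
    rw [gradient_ansatz hb]
    exact Submodule.sum_mem _ fun k hk => Submodule.smul_mem _ _
      (Submodule.subset_span (mem_image_of_mem _ hk))

theorem isField_of_mem_fieldSpan (hb : ∀ k ∈ I, ContDiff ℝ ∞ (b k))
    (hs : ∀ k ∈ I, IsSymPeriodic (b k)) {g : Pt d → Pt d} (hg : g ∈ fieldSpan b I) : IsField g := by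
  obtain ⟨ψ, hψ, rfl⟩ := (mem_fieldSpan_iff hb).1 hg
  exact ansatz_isField hb hs hψ

/-- Only an inclusion: the condition `∇φ(Ω) ⊆ Ω` is not part of `Adm`. Dropping it yields a closed
set for the existence argument and costs nothing, as the minimizer turns out to be regular. -/
theorem adm_of_mem_gradMaps (hb : ∀ k ∈ I, ContDiff ℝ ∞ (b k)) (hs : ∀ k ∈ I, IsSymPeriodic (b k))
    {t : Pt d → Pt d} (ht : t ∈ gradMaps b I) : Adm t ∧ t - id ∈ fieldSpan b I := by
  obtain ⟨φ, ⟨⟨ψ, hψ, rfl⟩, hc, -⟩, rfl⟩ := ht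
  have hψd := ansatz_contDiff hb hψ
  have h1 : gradient (fun x => ‖x‖ ^ 2 / 2 + ψ x) - id = gradient ψ := by
    rw [gradient_half_norm_sq_add hψd]; ext1 x; simp
  have h2 : IsField (gradient (fun x => ‖x‖ ^ 2 / 2 + ψ x) - id) := by
    rw [h1]; exact ansatz_isField hb hs hψ
  refine ⟨⟨h2, fun x hx => h2.isPositive_iff.2 ?_⟩, ?_⟩
  · refine (convexOn_closedCube_iff (fun x => ?_) h2.contDiff_of_sub_id).1 hc x hx
    rw [gradient_half_norm_sq_add hψd]
    exact hasGradientAt_half_norm_sq_add hψd x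
  · rw [h1]; exact (mem_fieldSpan_iff hb).2 ⟨ψ, hψ, rfl⟩

/-- For non-degenerate maps nothing is lost: regular maps preserve the open cube. The infimum
condition on the open cube is positivity on the closed cube, by continuity and compactness. -/
theorem mem_regularGradMaps_iff (hb : ∀ k ∈ I, ContDiff ℝ ∞ (b k))
    (hs : ∀ k ∈ I, IsSymPeriodic (b k)) {t : Pt d → Pt d} :
    t ∈ regularGradMaps b I ↔ Reg t ∧ t - id ∈ fieldSpan b I := by
  constructor
  · rintro ⟨φ, ⟨hφ, c, hc, hdet⟩, rfl⟩
    obtain ⟨h1, h2⟩ := adm_of_mem_gradMaps hb hs ⟨φ, hφ, rfl⟩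
    refine ⟨⟨h1, fun x hx => hc.trans_le ?_⟩, h2⟩
    rw [← closure_cube] at hx
    exact closure_minimal (s := cube d) hdet (isClosed_le continuous_const h1.continuous_det) hx
  · rintro ⟨h1, h2⟩
    obtain ⟨ψ, hψ, hg⟩ := (mem_fieldSpan_iff hb).1 h2
    have hψd := ansatz_contDiff hb hψ
    have ht : gradient (fun x => ‖x‖ ^ 2 / 2 + ψ x) = t := by
      rw [gradient_half_norm_sq_add hψd, ← hg]; ext1 x; simp
    refine ⟨_, ⟨⟨⟨ψ, hψ, rfl⟩, ?_, ?_⟩, ?_⟩, ht⟩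
    · refine (convexOn_closedCube_iff (t := t) (fun x => ?_) h1.contDiff).2
        fun x hx => (h1.psd x hx).inner_nonneg_left
      rw [← ht, gradient_half_norm_sq_add hψd]
      exact hasGradientAt_half_norm_sq_add hψd x
    · rw [ht]; exact h1.mapsTo_cube
    · rw [ht]
      obtain ⟨x₀, hx₀, hmin⟩ := isCompact_closedCube.exists_isMinOn closedCube_nonempty
        h1.continuous_det.continuousOn
      exact ⟨_, h1.det_pos x₀ hx₀, fun x hx => hmin (cube_subset_closedCube hx)⟩

theorem regularGradMaps_subset : regularGradMaps b I ⊆ gradMaps b I :=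
  image_mono fun _ h => h.1

theorem convex_gradMaps (hb : ∀ k ∈ I, ContDiff ℝ ∞ (b k)) : Convex ℝ (gradMaps b I) := by
  rintro _ ⟨φ, ⟨⟨_, ⟨z, rfl⟩, rfl⟩, hc, hm⟩, rfl⟩ _ ⟨φ', ⟨⟨_, ⟨z', rfl⟩, rfl⟩, hc', hm'⟩, rfl⟩
    α β hα hβ hαβ
  set ψ : Pt d → ℝ := fun x => ∑ k ∈ I, z k * b k x
  set ψ' : Pt d → ℝ := fun x => ∑ k ∈ I, z' k * b k x
  have hψ : ContDiff ℝ ∞ ψ := ansatz_contDiff hb ⟨z, rfl⟩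
  have hψ' : ContDiff ℝ ∞ ψ' := ansatz_contDiff hb ⟨z', rfl⟩
  have hsum : (fun x => α * ψ x + β * ψ' x) ∈ ansatzSpace b I :=
    ⟨fun k => α * z k + β * z' k, by
      ext x; simp only [ψ, ψ', Finset.mul_sum, ← Finset.sum_add_distrib]
      exact Finset.sum_congr rfl fun k _ => by ring⟩
  have hgrad : gradient (fun x => ‖x‖ ^ 2 / 2 + (α * ψ x + β * ψ' x)) =
      α • gradient (fun x => ‖x‖ ^ 2 / 2 + ψ x) + β • gradient (fun x => ‖x‖ ^ 2 / 2 + ψ' x) := by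
    rw [gradient_half_norm_sq_add (ansatz_contDiff hb hsum), gradient_half_norm_sq_add hψ,
      gradient_half_norm_sq_add hψ',
      gradient_add' (f := fun x => α * ψ x) (g := fun x => β * ψ' x)
        ((contDiff_const.mul hψ).differentiable (by simp))
        ((contDiff_const.mul hψ').differentiable (by simp)),
      gradient_smul' (hψ.differentiable (by simp)), gradient_smul' (hψ'.differentiable (by simp))]
    have hα' : α = 1 - β := by linarith
    subst hα'
    ext1 x
    simp only [Pi.add_apply, Pi.smul_apply]
    module
  refine ⟨_, ⟨⟨_, hsum, rfl⟩, ?_, ?_⟩, hgrad⟩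
  · refine ((hc.smul hα).add (hc'.smul hβ)).congr fun x _ => ?_
    have hα' : α = 1 - β := by linarith
    subst hα'
    simp only [Pi.add_apply, smul_eq_mul]
    ring
  · rw [hgrad]
    exact fun x hx => convex_cube (hm hx) (hm' hx) hα hβ hαβ

end Potentials
end Admissible

/-! ### Change of variables, push-forward densities, and reduction of a step to the identity. -/

section ChangeOfVariables

variable {d : ℕ}

/-- Continuous and strictly positive on the closed cube. -/
structure PosCont (u : Pt d → ℝ) : Prop where
  cont : ContinuousOn u (closedCube d)
  pos : ∀ x ∈ closedCube d, 0 < u x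

theorem ae_cube_mem : ∀ᵐ x ∂(volume.restrict (cube d)), x ∈ cube d :=
  ae_restrict_mem measurableSet_cube

theorem aemeasurable_cube {F : Type*} [TopologicalSpace F] [MeasurableSpace F] [BorelSpace F]
    [TopologicalSpace.PseudoMetrizableSpace F]
    {f : Pt d → F} (hf : ContinuousOn f (closedCube d)) :
    AEMeasurable f (volume.restrict (cube d)) :=
  (hf.mono cube_subset_closedCube).aemeasurable measurableSet_cube

theorem integrable_cube {F : Type*} [NormedAddCommGroup F] {f : Pt d → F}
    (hf : ContinuousOn f (closedCube d)) : Integrable f (volume.restrict (cube d)) := by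
  rw [restrict_cube]; exact hf.integrableOn_compact isCompact_closedCube

theorem densMeasure_ac (u : Pt d → ℝ) : densMeasure u ≪ volume.restrict (cube d) :=
  withDensity_absolutelyContinuous _ _

namespace PosCont

variable {u : Pt d → ℝ}

theorem aemeasurable_ofReal (hu : PosCont u) :
    AEMeasurable (fun x => ENNReal.ofReal (u x)) (volume.restrict (cube d)) :=
  (aemeasurable_cube hu.cont).ennreal_ofReal

theorem lintegral_densMeasure (hu : PosCont u) (f : Pt d → ℝ≥0∞) :
    ∫⁻ x, f x ∂densMeasure u = ∫⁻ x in cube d, ENNReal.ofReal (u x) * f x :=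
  lintegral_withDensity_eq_lintegral_mul_non_measurable₀ _ hu.aemeasurable_ofReal (by simp) f

theorem integral_densMeasure (hu : PosCont u) {F : Type*} [NormedAddCommGroup F] [NormedSpace ℝ F]
    (f : Pt d → F) : ∫ x, f x ∂densMeasure u = ∫ x in cube d, u x • f x := by
  rw [densMeasure, integral_withDensity_eq_integral_toReal_smul₀ hu.aemeasurable_ofReal (by simp)]
  refine setIntegral_congr_fun measurableSet_cube fun x hx => ?_
  simp only [ENNReal.toReal_ofReal (hu.pos x (cube_subset_closedCube hx)).le]

theorem integrable_densMeasure (hu : PosCont u) {F : Type*} [NormedAddCommGroup F]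
    [NormedSpace ℝ F] {f : Pt d → F} :
    Integrable f (densMeasure u) ↔ IntegrableOn (fun x => u x • f x) (cube d) := by
  rw [densMeasure, integrable_withDensity_iff_integrable_smul₀' hu.aemeasurable_ofReal (by simp)]
  refine integrableOn_congr_fun (fun x hx => ?_) measurableSet_cube
  simp only [ENNReal.toReal_ofReal (hu.pos x (cube_subset_closedCube hx)).le]

theorem integrable_of_continuousOn (hu : PosCont u) {F : Type*} [NormedAddCommGroup F]
    [NormedSpace ℝ F] {f : Pt d → F} (hf : ContinuousOn f (closedCube d)) :
    Integrable f (densMeasure u) :=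
  hu.integrable_densMeasure.2 (integrable_cube (hu.cont.smul hf))

theorem isFiniteMeasure (hu : PosCont u) : IsFiniteMeasure (densMeasure u) := by
  have := hu.integrable_of_continuousOn (continuousOn_const (c := (1 : ℝ)))
  exact ((integrable_const_iff (c := (1 : ℝ))).1 this).resolve_left one_ne_zero

theorem exists_bounds (hu : PosCont u) :
    ∃ m M, 0 < m ∧ ∀ x ∈ closedCube d, m ≤ u x ∧ u x ≤ M := by
  obtain ⟨x₀, hx₀, hmin⟩ := isCompact_closedCube.exists_isMinOn closedCube_nonempty hu.cont
  obtain ⟨x₁, _, hmax⟩ := isCompact_closedCube.exists_isMaxOn closedCube_nonempty hu.cont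
  exact ⟨u x₀, u x₁, hu.pos x₀ hx₀, fun x hx => ⟨hmin hx, hmax hx⟩⟩

end PosCont

theorem ae_densMeasure_mem (u : Pt d → ℝ) : ∀ᵐ x ∂densMeasure u, x ∈ cube d :=
  (densMeasure_ac u).ae_le ae_cube_mem

namespace IsDiffPlus

variable {T S : Pt d → Pt d}

theorem continuousOn (hT : IsDiffPlus T) : ContinuousOn T (closedCube d) :=
  hT.contDiffOn.continuousOn

theorem hasFDerivWithinAt (hT : IsDiffPlus T) {x : Pt d} (hx : x ∈ closedCube d) :
    HasFDerivWithinAt T (fderivWithin ℝ T (closedCube d) x) (closedCube d) x :=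
  (hT.contDiffOn.differentiableOn one_ne_zero x hx).hasFDerivWithinAt

theorem continuousOn_jac (hT : IsDiffPlus T) : ContinuousOn (jac T) (closedCube d) :=
  contDiff_det.continuous.comp_continuousOn
    (hT.contDiffOn.continuousOn_fderivWithin uniqueDiffOn_closedCube le_rfl)

theorem lintegral_comp (hT : IsDiffPlus T) (f : Pt d → ℝ≥0∞) :
    ∫⁻ y in cube d, f y = ∫⁻ x in cube d, ENNReal.ofReal (jac T x) * f (T x) := by
  rw [restrict_cube]
  nth_rewrite 1 [← hT.bijOn.image_eq]
  rw [lintegral_image_eq_lintegral_abs_det_fderiv_mul volume measurableSet_closedCube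
    (fun x hx => hT.hasFDerivWithinAt hx) hT.bijOn.injOn]
  refine setLIntegral_congr_fun measurableSet_closedCube fun x hx => ?_
  rw [show |(fderivWithin ℝ T (closedCube d) x).det| = jac T x from abs_of_pos (hT.jac_pos x hx)]

theorem integral_comp (hT : IsDiffPlus T) {F : Type*} [NormedAddCommGroup F] [NormedSpace ℝ F]
    (f : Pt d → F) : ∫ y in cube d, f y = ∫ x in cube d, jac T x • f (T x) := by
  rw [restrict_cube]
  nth_rewrite 1 [← hT.bijOn.image_eq]
  rw [integral_image_eq_integral_abs_det_fderiv_smul volume measurableSet_closedCube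
    (fun x hx => hT.hasFDerivWithinAt hx) hT.bijOn.injOn]
  refine setIntegral_congr_fun measurableSet_closedCube fun x hx => ?_
  rw [show |(fderivWithin ℝ T (closedCube d) x).det| = jac T x from abs_of_pos (hT.jac_pos x hx)]

theorem integral_jac (hT : IsDiffPlus T) : ∫ x in cube d, jac T x = 1 := by
  have := hT.integral_comp (fun _ => (1 : ℝ))
  simpa [Measure.real, volume_cube] using this.symm

theorem inv_mem (hT : IsDiffPlus T) {y : Pt d} (hy : y ∈ closedCube d) :
    Function.invFunOn T (closedCube d) y ∈ closedCube d :=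
  Function.invFunOn_mem (hT.bijOn.surjOn hy)

theorem apply_inv (hT : IsDiffPlus T) {y : Pt d} (hy : y ∈ closedCube d) :
    T (Function.invFunOn T (closedCube d) y) = y :=
  Function.invFunOn_eq (hT.bijOn.surjOn hy)

theorem inv_apply (hT : IsDiffPlus T) {x : Pt d} (hx : x ∈ closedCube d) :
    Function.invFunOn T (closedCube d) (T x) = x :=
  hT.bijOn.injOn (hT.inv_mem (hT.bijOn.mapsTo hx)) hx (hT.apply_inv (hT.bijOn.mapsTo hx))

/-- A continuous bijection on a compact set is closed: preimages under the inverse are images of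
compact sets. -/
theorem continuousOn_inv (hT : IsDiffPlus T) :
    ContinuousOn (Function.invFunOn T (closedCube d)) (closedCube d) := by
  rw [continuousOn_iff_isClosed]
  intro C hC
  refine ⟨T '' (C ∩ closedCube d), ?_, ?_⟩
  · exact ((isCompact_closedCube.inter_left hC).image_of_continuousOn
      (hT.continuousOn.mono inter_subset_right)).isClosed
  · ext y
    constructor
    · rintro ⟨h1, hy⟩
      exact ⟨⟨_, ⟨h1, hT.inv_mem hy⟩, hT.apply_inv hy⟩, hy⟩
    · rintro ⟨⟨x, ⟨hxC, hx⟩, rfl⟩, hy⟩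
      exact ⟨by rw [mem_preimage, hT.inv_apply hx]; exact hxC, hy⟩

theorem posCont_pushDensity (hT : IsDiffPlus T) {u : Pt d → ℝ} (hu : PosCont u) :
    PosCont (pushDensity T u) where
  cont := by
    have hm : MapsTo (Function.invFunOn T (closedCube d)) (closedCube d) (closedCube d) :=
      fun y hy => hT.inv_mem hy
    exact (hu.cont.comp hT.continuousOn_inv hm).div
      (hT.continuousOn_jac.comp hT.continuousOn_inv hm) fun y hy => (hT.jac_pos _ (hm hy)).ne'
  pos := fun y hy => div_pos (hu.pos _ (hT.inv_mem hy)) (hT.jac_pos _ (hT.inv_mem hy))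

theorem pushDensity_apply (hT : IsDiffPlus T) (u : Pt d → ℝ) {x : Pt d} (hx : x ∈ closedCube d) :
    pushDensity T u (T x) = u x / jac T x := by
  rw [pushDensity, hT.inv_apply hx]

theorem jac_mul_pushDensity (hT : IsDiffPlus T) (u : Pt d → ℝ) {x : Pt d}
    (hx : x ∈ closedCube d) : jac T x * pushDensity T u (T x) = u x := by
  rw [hT.pushDensity_apply u hx, mul_div_cancel₀ _ (hT.jac_pos x hx).ne']

theorem lintegral_comp_densMeasure (hT : IsDiffPlus T) {u : Pt d → ℝ} (hu : PosCont u)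
    (f : Pt d → ℝ≥0∞) :
    ∫⁻ x, f (T x) ∂densMeasure u = ∫⁻ y, f y ∂densMeasure (pushDensity T u) := by
  rw [hu.lintegral_densMeasure, (hT.posCont_pushDensity hu).lintegral_densMeasure,
    hT.lintegral_comp (fun y => ENNReal.ofReal (pushDensity T u y) * f y)]
  refine setLIntegral_congr_fun measurableSet_cube fun x hx => ?_
  have hxc := cube_subset_closedCube hx
  rw [← mul_assoc, ← ENNReal.ofReal_mul (hT.jac_pos x hxc).le, hT.jac_mul_pushDensity u hxc]

theorem pushMeasure_eq (hT : IsDiffPlus T) {u : Pt d → ℝ} (hu : PosCont u) :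
    pushMeasure T u = densMeasure (pushDensity T u) := by
  have hm : AEMeasurable T (densMeasure u) :=
    (aemeasurable_cube hT.continuousOn).mono_ac (densMeasure_ac u)
  ext s hs
  rw [pushMeasure, Measure.map_apply_of_aemeasurable hm hs, ← lintegral_indicator_one hs,
    ← hT.lintegral_comp_densMeasure hu, ← lintegral_indicator_one₀ (hm.nullMeasurableSet_preimage hs)]
  rfl

theorem comp (hS : IsDiffPlus S) (hT : IsDiffPlus T) : IsDiffPlus (S ∘ T) where
  contDiffOn := hS.contDiffOn.comp hT.contDiffOn hT.bijOn.mapsTo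
  bijOn := hS.bijOn.comp hT.bijOn
  jac_pos := fun x hx => by
    have h : fderivWithin ℝ (S ∘ T) (closedCube d) x =
        fderivWithin ℝ S (closedCube d) (T x) ∘L fderivWithin ℝ T (closedCube d) x :=
      ((hS.hasFDerivWithinAt (hT.bijOn.mapsTo hx)).comp x (hT.hasFDerivWithinAt hx)
        hT.bijOn.mapsTo).fderivWithin (uniqueDiffOn_closedCube x hx)
    rw [jac, h]
    have h2 : (fderivWithin ℝ S (closedCube d) (T x) ∘L fderivWithin ℝ T (closedCube d) x).det =
        jac S (T x) * jac T x := LinearMap.det_comp _ _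
    rw [h2]
    exact mul_pos (hS.jac_pos _ (hT.bijOn.mapsTo hx)) (hT.jac_pos x hx)
  corner := fun x hx => by rw [Function.comp, hT.corner x hx, hS.corner x hx]

theorem jac_comp (hS : DifferentiableOn ℝ S (closedCube d)) (hT : IsDiffPlus T) {x : Pt d}
    (hx : x ∈ closedCube d) : jac (S ∘ T) x = jac S (T x) * jac T x := by
  have h : fderivWithin ℝ (S ∘ T) (closedCube d) x =
      fderivWithin ℝ S (closedCube d) (T x) ∘L fderivWithin ℝ T (closedCube d) x :=
    ((hS _ (hT.bijOn.mapsTo hx)).hasFDerivWithinAt.comp x (hT.hasFDerivWithinAt hx)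
      hT.bijOn.mapsTo).fderivWithin (uniqueDiffOn_closedCube x hx)
  rw [jac, h]
  exact LinearMap.det_comp _ _

theorem pushDensity_comp (hS : IsDiffPlus S) (hT : IsDiffPlus T) (u : Pt d → ℝ) {y : Pt d}
    (hy : y ∈ closedCube d) : pushDensity (S ∘ T) u y = pushDensity S (pushDensity T u) y := by
  obtain ⟨x, hx, rfl⟩ := (hS.comp hT).bijOn.surjOn hy
  rw [(hS.comp hT).pushDensity_apply u hx, Function.comp, hS.pushDensity_apply _
    (hT.bijOn.mapsTo hx), hT.pushDensity_apply u hx,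
    jac_comp (hS.contDiffOn.differentiableOn one_ne_zero) hT hx, div_div, mul_comm]

theorem _root_.FokkerPlanck.pushMeasure_id (u : Pt d → ℝ) :
    pushMeasure _root_.id u = densMeasure u := Measure.map_id

/-- A step starting from `T` is a step starting from the identity, with the reference density
replaced by its push-forward. -/
theorem stepFunctional_eq (hT : IsDiffPlus T) {u : Pt d → ℝ} (hu : PosCont u) (h : ℝ → ℝ)
    (V : Pt d → ℝ) (τ : ℝ) {t : Pt d → Pt d} (ht : Differentiable ℝ t) :
    stepFunctional h V u τ T t = stepFunctional h V (pushDensity T u) τ _root_.id t := by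
  have hpt : ∀ x ∈ cube d, hStarExt h (jac (t ∘ T) x / u x) + (V ((t ∘ T) x) : EReal) =
      (fun y => hStarExt h (jac t y / pushDensity T u y) + (V (t y) : EReal)) (T x) := by
    intro x hx
    have hxc := cube_subset_closedCube hx
    have h1 : jac (t ∘ T) x / u x = jac t (T x) / pushDensity T u (T x) := by
      rw [jac_comp ht.differentiableOn hT hxc, hT.pushDensity_apply u hxc]
      have := (hT.jac_pos x hxc).ne'
      have := (hu.pos x hxc).ne'
      field_simp
    simp only [h1, Function.comp]
  have hext : ∀ F G : Pt d → EReal, (∀ x ∈ cube d, F x = G (T x)) →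
      extIntegral F (densMeasure u) = extIntegral G (densMeasure (pushDensity T u)) := by
    intro F G hFG
    rw [extIntegral, extIntegral, ← hT.lintegral_comp_densMeasure hu,
      ← hT.lintegral_comp_densMeasure hu]
    refine congrArg₂ (fun a b : ℝ≥0∞ => (a : EReal) - (b : EReal)) (lintegral_congr_ae ?_)
      (lintegral_congr_ae ?_)
    all_goals
      filter_upwards [ae_densMeasure_mem u] with x hx
      rw [hFG x hx]
  rw [stepFunctional, stepFunctional, pushMeasure_id, hT.pushMeasure_eq hu, energy, energy,
    Function.comp_id]
  congr 1
  exact hext _ _ hpt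

theorem _root_.FokkerPlanck.weakVelocityPairing_congr {P : ℝ → ℝ} {V u u' : Pt d → ℝ}
    {ζ : Pt d → Pt d} (h : ∀ x ∈ cube d, u x = u' x) :
    weakVelocityPairing P V u ζ = weakVelocityPairing P V u' ζ := by
  rw [weakVelocityPairing, weakVelocityPairing]
  congr 1
  · exact setIntegral_congr_fun measurableSet_cube fun x hx => by simp only [h x hx]
  · exact setIntegral_congr_fun measurableSet_cube fun x hx => by simp only [h x hx]

theorem weakEulerLagrange_iff (hT : IsDiffPlus T) {u : Pt d → ℝ} (hu : PosCont u) {P : ℝ → ℝ}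
    {V : Pt d → ℝ} {τ : ℝ} {ι : Type*} {b : ι → Pt d → ℝ} {I : Finset ι} {t : Pt d → Pt d}
    (ht : IsDiffPlus t) :
    WeakEulerLagrange P V u τ b I T t ↔
      WeakEulerLagrange P V (pushDensity T u) τ b I _root_.id t := by
  refine forall₂_congr fun ψ _ => ?_
  rw [pushMeasure_id, hT.pushMeasure_eq hu, Function.comp_id,
    weakVelocityPairing_congr fun x hx => ht.pushDensity_comp hT u (cube_subset_closedCube hx)]

theorem eulerLagrange_iff (hT : IsDiffPlus T) {u : Pt d → ℝ} (hu : PosCont u) {h : ℝ → ℝ}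
    {V : Pt d → ℝ} {τ : ℝ} {ι : Type*} {b : ι → Pt d → ℝ} {I : Finset ι} {t : Pt d → Pt d}
    (ht : IsDiffPlus t) (htm : MapsTo t (cube d) (cube d)) :
    EulerLagrange h V u τ b I T t ↔
      EulerLagrange h V (pushDensity T u) τ b I _root_.id t := by
  refine forall₂_congr fun ψ _ => ?_
  rw [pushMeasure_id, hT.pushMeasure_eq hu]
  refine Eq.congr (integral_congr_ae ?_) rfl
  filter_upwards [ae_densMeasure_mem _] with x hx
  have : velocityAlong h V u t T x = velocityAlong h V (pushDensity T u) t _root_.id x := by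
    rw [velocityAlong, velocityAlong, velocity, velocity, Function.comp_id]
    congr 1
    -- The velocity involves a derivative, and the two densities agree only on the closed cube. So
    -- `t x` has to be an interior point, which is why `htm` is required.
    refine Filter.EventuallyEq.gradient_eq ?_
    filter_upwards [isOpen_cube.mem_nhds (htm hx)] with y hy
    rw [ht.pushDensity_comp hT u (cube_subset_closedCube hy)]
  rw [this]

end IsDiffPlus

/-- The mass of the Jacobian determinant is that of the cube, also for degenerate maps. -/
theorem Adm.integral_det (hd : 0 < d) {t : Pt d → Pt d} (ht : Adm t) :
    ∫ x in cube d, (fderiv ℝ t x).det = 1 := by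
  have hreg : ∀ {s : Pt d → Pt d}, Reg s → ∫ x in cube d, (fderiv ℝ s x).det = 1 := by
    intro s hs
    rw [← hs.isDiffPlus.integral_jac]
    exact setIntegral_congr_fun measurableSet_cube fun x hx =>
      (Reg.jac_eq (hs.differentiable x) (cube_subset_closedCube hx)).symm
  -- Interpolation with the identity makes the map regular for `0 < a < 1`, where the change of
  -- variables applies; then `a → 0`.
  set f : ℝ → ℝ := fun a => ∫ x in closedCube d,
    (a • fderiv ℝ (_root_.id : Pt d → Pt d) x + (1 - a) • fderiv ℝ t x).det with hf
  have hcont : Continuous f := by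
    refine continuous_parametric_integral_of_continuous ?_ isCompact_closedCube
    refine contDiff_det.continuous.comp ?_
    have h1 := ht.continuous_fderiv
    have h2 : Continuous (fderiv ℝ (_root_.id : Pt d → Pt d)) := Adm.id.continuous_fderiv
    fun_prop
  have h1 : ∀ a ∈ Ioo (0 : ℝ) 1, f a = 1 := by
    intro a ha
    rw [← hreg (Reg.combo hd Adm.id ht (Or.inl Reg.id) ha.1 (sub_pos.2 ha.2) (by ring)), hf,
      restrict_cube]
    simp only [Adm.id.fderiv_combo ht]
  have h2 : Tendsto f (𝓝[>] 0) (𝓝 (f 0)) := (hcont.tendsto 0).mono_left nhdsWithin_le_nhds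
  have h3 : Tendsto f (𝓝[>] 0) (𝓝 1) := by
    refine tendsto_const_nhds.congr' ?_
    filter_upwards [Ioo_mem_nhdsGT (zero_lt_one' ℝ)] with a ha
    exact (h1 a ha).symm
  have h4 := tendsto_nhds_unique h2 h3
  rw [restrict_cube, ← h4, hf]
  refine setIntegral_congr_fun measurableSet_closedCube fun x _ => ?_
  have : (0 : ℝ) • fderiv ℝ (_root_.id : Pt d → Pt d) x + (1 - 0 : ℝ) • fderiv ℝ t x =
      fderiv ℝ t x := by ext v; simp
  simp only [this]

end ChangeOfVariables

/-! ### The internal energy density: monotonicity, McCann's condition, non-integrability. -/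

section InternalEnergy

/-- The assumptions on the pressure function and the internal energy density. -/
structure PressureData (d : ℕ) (P h : ℝ → ℝ) : Prop where
  pos_dim : 0 < d
  P_cont : ContinuousOn P (Ici 0)
  P_smooth : ContDiffOn ℝ ∞ P (Ioi 0)
  P_mono : StrictMonoOn P (Ici 0)
  mccann : ∀ r > 0, ((d : ℝ) - 1) * (P r - P 0) ≤ (d : ℝ) * (r * deriv P r)
  h_smooth : ContDiffOn ℝ 2 h (Ioi 0)
  deriv_P : ∀ r > 0, deriv P r = r * deriv (deriv h) r

/-- The slope at infinity of the affine part of `h_*`. -/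
def affConst (P h : ℝ → ℝ) : ℝ := P 1 - P 0 - deriv h 1 + h 1

/-- The nonincreasing normalization of `h_*`. -/
def kStar (P h : ℝ → ℝ) (s : ℝ) : ℝ := hStar h s - affConst P h * s

namespace PressureData

variable {d : ℕ} {P h : ℝ → ℝ}

theorem hasDerivAt_P (D : PressureData d P h) {r : ℝ} (hr : 0 < r) :
    HasDerivAt P (deriv P r) r :=
  ((D.P_smooth.contDiffAt (Ioi_mem_nhds hr)).differentiableAt (by simp)).hasDerivAt

theorem hasDerivAt_h (D : PressureData d P h) {r : ℝ} (hr : 0 < r) :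
    HasDerivAt h (deriv h r) r :=
  ((D.h_smooth.contDiffAt (Ioi_mem_nhds hr)).differentiableAt (by simp)).hasDerivAt

theorem hasDerivAt_deriv_h (D : PressureData d P h) {r : ℝ} (hr : 0 < r) :
    HasDerivAt (deriv h) (deriv (deriv h) r) r := by
  have h1 : ContDiffOn ℝ 1 (deriv h) (Ioi 0) := by
    have := (contDiffOn_succ_iff_deriv_of_isOpen (n := 1) isOpen_Ioi).1
      (by simpa [one_add_one_eq_two] using D.h_smooth)
    exact this.2.2
  exact ((h1.contDiffAt (Ioi_mem_nhds hr)).differentiableAt (by simp)).hasDerivAt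

/-- The relation `P' = r h''` says that `r h' - h - P` has zero derivative; the value at `r = 1`
fixes the constant. -/
theorem legendre (D : PressureData d P h) {r : ℝ} (hr : 0 < r) :
    r * deriv h r - h r = P r - P 0 - affConst P h := by
  have key : ∀ r ∈ Ioi (0 : ℝ), HasDerivAt (fun r => r * deriv h r - h r - P r) 0 r := by
    intro r hr
    have := (((hasDerivAt_id r).mul (D.hasDerivAt_deriv_h hr)).sub (D.hasDerivAt_h hr)).sub
      (D.hasDerivAt_P hr)
    refine this.congr_deriv ?_
    rw [D.deriv_P r hr]; simp
  have := (convex_Ioi (0 : ℝ)).is_const_of_fderivWithin_eq_zero (𝕜 := ℝ)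
    (f := fun r => r * deriv h r - h r - P r)
    (fun r hr => (key r hr).differentiableAt.differentiableWithinAt)
    (fun r hr => by
      rw [fderivWithin_of_isOpen isOpen_Ioi hr, (key r hr).hasFDerivAt.fderiv]; ext; simp)
    hr (show (1 : ℝ) ∈ Ioi (0 : ℝ) from mem_Ioi.2 zero_lt_one)
  rw [affConst]; linarith

/-- The derivative of `h_*` at `s` is minus the Legendre expression at `r = 1 / s`. Subtracting the
slope `affConst` leaves minus the pressure difference, which is negative, so `kStar` is decreasing
for every choice of the affine part of `h`. -/
theorem hasDerivAt_kStar (D : PressureData d P h) {s : ℝ} (hs : 0 < s) :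
    HasDerivAt (kStar P h) (P 0 - P (1 / s)) s := by
  have hr : 0 < 1 / s := by positivity
  have h1 : HasDerivAt (fun s : ℝ => 1 / s) (-(s ^ 2)⁻¹) s := by
    simpa [one_div] using hasDerivAt_inv hs.ne'
  have h2 := ((hasDerivAt_id s).mul ((D.hasDerivAt_h hr).comp s h1)).sub
    ((hasDerivAt_id s).const_mul (affConst P h))
  refine h2.congr_deriv ?_
  have h3 := D.legendre hr
  simp only [id, Function.comp]
  have h4 : s * (deriv h (1 / s) * -(s ^ 2)⁻¹) = -(1 / s * deriv h (1 / s)) := by field_simp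
  linarith

theorem continuousOn_kStar (D : PressureData d P h) : ContinuousOn (kStar P h) (Ioi 0) :=
  fun _ hs => (D.hasDerivAt_kStar hs).continuousAt.continuousWithinAt

theorem P_lt (D : PressureData d P h) {r : ℝ} (hr : 0 < r) : P 0 < P r :=
  D.P_mono self_mem_Ici hr.le hr

theorem antitoneOn_kStar (D : PressureData d P h) : AntitoneOn (kStar P h) (Ioi 0) := by
  refine antitoneOn_of_deriv_nonpos (convex_Ioi 0) D.continuousOn_kStar ?_ ?_
  · rw [interior_Ioi]
    exact fun s hs => (D.hasDerivAt_kStar hs).differentiableAt.differentiableWithinAt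
  · rw [interior_Ioi]
    intro s hs
    rw [(D.hasDerivAt_kStar hs).deriv]
    have := D.P_lt (r := 1 / s) (by have : 0 < s := hs; positivity)
    linarith

/-- McCann's condition. -/
theorem convexOn_kStar_pow (D : PressureData d P h) {a : ℝ} (ha : 0 < a) :
    ConvexOn ℝ (Ioi 0) fun s => kStar P h (a * s ^ d) := by
  obtain ⟨e, rfl⟩ : ∃ e, d = e + 1 := ⟨d - 1, (Nat.succ_pred_eq_of_pos D.pos_dim).symm⟩
  have hd1 : ∀ s ∈ Ioi (0 : ℝ), HasDerivAt (fun s => kStar P h (a * s ^ (e + 1)))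
      ((P 0 - P (1 / (a * s ^ (e + 1)))) * (a * ((e + 1) * s ^ e))) s := by
    intro s hs
    have hs' : (0 : ℝ) < s := hs
    have h1 : HasDerivAt (fun s : ℝ => a * s ^ (e + 1)) (a * ((e + 1) * s ^ e)) s := by
      simpa using (hasDerivAt_pow (e + 1) s).const_mul a
    exact (D.hasDerivAt_kStar (by positivity)).comp s h1
  -- This is the first derivative without its constant factor `a * (e + 1)`. Its monotonicity is
  -- McCann's condition at `r = 1 / (a * s ^ d)`.
  have hd2 : ∀ s ∈ Ioi (0 : ℝ), HasDerivAt (fun s => (P 0 - P (1 / (a * s ^ (e + 1)))) * s ^ e)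
      (deriv P (1 / (a * s ^ (e + 1))) * ((e + 1) / (a * s ^ (e + 2))) * s ^ e +
        (P 0 - P (1 / (a * s ^ (e + 1)))) * (e * s ^ (e - 1))) s := by
    intro s hs
    have hs' : (0 : ℝ) < s := hs
    have h1 : HasDerivAt (fun s : ℝ => a * s ^ (e + 1)) (a * ((e + 1) * s ^ e)) s := by
      simpa using (hasDerivAt_pow (e + 1) s).const_mul a
    have h2 := h1.fun_inv (by positivity)
    have h3 : HasDerivAt (fun s : ℝ => 1 / (a * s ^ (e + 1))) (-((e + 1) / (a * s ^ (e + 2)))) s := by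
      simp only [one_div]
      refine h2.congr_deriv ?_
      field_simp
      ring
    have h4 := (((D.hasDerivAt_P (r := 1 / (a * s ^ (e + 1))) (by positivity)).comp s h3).const_sub
      (P 0)).mul (hasDerivAt_pow e s)
    refine h4.congr_deriv ?_
    simp only [Function.comp]
    ring
  have hmono : MonotoneOn (fun s => (P 0 - P (1 / (a * s ^ (e + 1)))) * s ^ e) (Ioi 0) := by
    refine monotoneOn_of_deriv_nonneg (convex_Ioi 0)
      (fun s hs => (hd2 s hs).continuousAt.continuousWithinAt) ?_ ?_
    · rw [interior_Ioi]
      exact fun s hs => (hd2 s hs).differentiableAt.differentiableWithinAt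
    · rw [interior_Ioi]
      intro s hs
      have hs' : (0 : ℝ) < s := hs
      rw [(hd2 s hs).deriv]
      refine nonneg_of_mul_nonneg_right (a := s) ?_ hs'
      set r := 1 / (a * s ^ (e + 1)) with hr
      have hrpos : 0 < r := by positivity
      have hm := D.mccann r hrpos
      -- For `e = 0` the exponent is a truncated difference, but the factor `e` vanishes.
      have h1 : (e : ℝ) * s ^ (e - 1) * s = e * s ^ e := by
        rcases e with _ | e
        · simp
        · simp [pow_succ]; ring
      have h2 : (e + 1 : ℝ) / (a * s ^ (e + 2)) * s = (e + 1) * r := by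
        rw [hr]; field_simp; ring
      have h3 : s * (deriv P r * ((e + 1) / (a * s ^ (e + 2))) * s ^ e +
          (P 0 - P r) * (e * s ^ (e - 1))) =
          s ^ e * ((e + 1) * (r * deriv P r) - e * (P r - P 0)) := by
        linear_combination deriv P r * s ^ e * h2 + (P 0 - P r) * h1
      rw [h3]
      push_cast at hm
      refine mul_nonneg (by positivity) ?_
      linarith
  refine MonotoneOn.convexOn_of_deriv (convex_Ioi 0)
    (fun s hs => (hd1 s hs).continuousAt.continuousWithinAt) ?_ ?_
  · rw [interior_Ioi]
    exact fun s hs => (hd1 s hs).differentiableAt.differentiableWithinAt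
  · rw [interior_Ioi]
    intro x hx y hy hxy
    rw [(hd1 x hx).deriv, (hd1 y hy).deriv]
    have := hmono hx hy hxy
    simp only at this
    have hae : 0 ≤ a * (e + 1) := by positivity
    nlinarith [mul_le_mul_of_nonneg_left this hae]

/-- Displacement convexity of the internal energy density. -/
theorem kStar_det_convex (D : PressureData d P h) {A B : Pt d →L[ℝ] Pt d} (hA : A.IsPositive)
    (hB : B.IsPositive) (hA' : 0 < A.det) (hB' : 0 < B.det) {α β : ℝ} (hα : 0 < α) (hβ : 0 < β)
    (hαβ : α + β = 1) {ρ : ℝ} (hρ : 0 < ρ) :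
    kStar P h ((α • A + β • B).det / ρ) ≤ α * kStar P h (A.det / ρ) + β * kStar P h (B.det / ρ) := by
  have hd : (d : ℝ) ≠ 0 := by exact_mod_cast D.pos_dim.ne'
  have hpow : ∀ {x : ℝ}, 0 < x → (x ^ (1 / (d : ℝ))) ^ d = x := fun hx => by
    rw [← Real.rpow_natCast, ← Real.rpow_mul hx.le, one_div_mul_cancel hd, Real.rpow_one]
  have hC := det_pos_add D.pos_dim hA hB hα hβ (Or.inl hA')
  set δA := A.det ^ (1 / (d : ℝ))
  set δB := B.det ^ (1 / (d : ℝ))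
  have hδA : 0 < δA := Real.rpow_pos_of_pos hA' _
  have hδB : 0 < δB := Real.rpow_pos_of_pos hB' _
  have h1 := concave_det_rpow D.pos_dim hA hB hα hβ
  have h2 : (α * δA + β * δB) ^ d ≤ (α • A + β • B).det := by
    rw [← hpow hC]
    exact pow_le_pow_left₀ (by positivity) h1 d
  have h3 := (D.convexOn_kStar_pow (a := 1 / ρ) (by positivity)).2 hδA hδB hα.le hβ.le hαβ
  simp only [smul_eq_mul] at h3
  -- Minkowski's inequality bounds the determinant from below, which is the useful direction because
  -- `kStar` is nonincreasing.
  have h4 : kStar P h ((α • A + β • B).det / ρ) ≤ kStar P h (1 / ρ * (α * δA + β * δB) ^ d) := by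
    refine D.antitoneOn_kStar ?_ ?_ ?_
    · exact mem_Ioi.2 (by positivity)
    · exact mem_Ioi.2 (by positivity)
    · rw [one_div, inv_mul_eq_div]; gcongr
  rw [hpow hA', hpow hB', one_div, inv_mul_eq_div _ A.det, inv_mul_eq_div _ B.det] at h3
  rw [one_div] at h4
  exact h4.trans h3

theorem _root_.FokkerPlanck.integrableAtFilter_nhdsGT_iff {f : ℝ → ℝ} :
    IntegrableAtFilter f (𝓝[>] 0) volume ↔ ∃ ε > 0, IntegrableOn f (Ioo 0 ε) := by
  constructor
  · rintro ⟨s, hs, hf⟩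
    obtain ⟨ε, hε, hsub⟩ := (mem_nhdsGT_iff_exists_Ioo_subset).1 hs
    exact ⟨ε, hε, hf.mono_set hsub⟩
  · rintro ⟨ε, hε, hf⟩
    exact ⟨_, Ioo_mem_nhdsGT hε, hf⟩

/-- The condition on `h_*` carries over to its normalization. -/
theorem not_integrableOn_kStar (D : PressureData d P h)
    (hn : ¬ IntegrableAtFilter (fun s : ℝ => s ^ ((d : ℝ) / 2 - 1) * hStar h s) (𝓝[>] 0) volume)
    {ε : ℝ} (hε : 0 < ε) :
    ¬ IntegrableOn (fun s : ℝ => s ^ ((d : ℝ) / 2 - 1) * kStar P h s) (Ioo 0 ε) := by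
  intro hi
  refine hn (integrableAtFilter_nhdsGT_iff.2 ⟨ε, hε, ?_⟩)
  have hd' : (0 : ℝ) < d := by exact_mod_cast D.pos_dim
  have h1 : IntegrableOn (fun s : ℝ => affConst P h * s ^ ((d : ℝ) / 2)) (Ioo 0 ε) :=
    ((intervalIntegral.integrableOn_Ioo_rpow_iff hε).2 (by linarith)).const_mul _
  refine (hi.add h1).congr_fun (fun s hs => ?_) measurableSet_Ioo
  have h2 : s ^ ((d : ℝ) / 2) = s ^ ((d : ℝ) / 2 - 1) * s := by
    nth_rewrite 3 [← Real.rpow_one s]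
    rw [← Real.rpow_add hs.1]; ring_nf
  simp only [Pi.add_apply, kStar, h2]
  ring

/-- By monotonicity, failure of the limit would bound `kStar` near `0`. Then the product with `s ^
(d / 2 - 1)` would be integrable, because the exponent exceeds `-1`. -/
theorem tendsto_kStar (D : PressureData d P h)
    (hn : ¬ IntegrableAtFilter (fun s : ℝ => s ^ ((d : ℝ) / 2 - 1) * hStar h s) (𝓝[>] 0) volume) :
    Tendsto (kStar P h) (𝓝[>] 0) atTop := by
  by_contra hnt
  rw [tendsto_atTop] at hnt
  push Not at hnt
  obtain ⟨B, hB⟩ := hnt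
  have hB' : ∀ s ∈ Ioi (0 : ℝ), kStar P h s ≤ B := by
    intro s hs
    obtain ⟨r, hr, hrs⟩ := (hB.and_eventually (Ioo_mem_nhdsGT hs)).exists
    exact (D.antitoneOn_kStar hrs.1 hs hrs.2.le).trans hr.le
  refine D.not_integrableOn_kStar hn zero_lt_one ?_
  have hd' : (0 : ℝ) < d := by exact_mod_cast D.pos_dim
  have h1 : IntegrableOn (fun s : ℝ => s ^ ((d : ℝ) / 2 - 1)) (Ioo 0 1) :=
    (intervalIntegral.integrableOn_Ioo_rpow_iff zero_lt_one).2 (by linarith)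
  refine Integrable.mul_bdd (c := max |kStar P h 1| |B|) h1 ?_ ?_
  · exact (D.continuousOn_kStar.mono Ioo_subset_Ioi_self).aestronglyMeasurable measurableSet_Ioo
  · filter_upwards [ae_restrict_mem measurableSet_Ioo] with s hs
    have h2 := hB' s hs.1
    have h3 := D.antitoneOn_kStar hs.1 (mem_Ioi.2 zero_lt_one) hs.2.le
    exact abs_le_max_abs_abs h3 h2

/-- Polar coordinates give the weight `y ^ (d - 1)`, and the substitution `s = C y²` turns it into a
multiple of `s ^ (d / 2 - 1)`. This is where the exponent of the hypothesis comes from. -/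
theorem not_integrableOn_ball (D : PressureData d P h)
    (hn : ¬ IntegrableAtFilter (fun s : ℝ => s ^ ((d : ℝ) / 2 - 1) * hStar h s) (𝓝[>] 0) volume)
    {C R : ℝ} (hC : 0 < C) (hR : 0 < R) :
    ¬ IntegrableOn (fun y : Pt d => kStar P h (C * ‖y‖ ^ 2)) (Metric.ball 0 R) := by
  have hd := D.pos_dim
  have : Nonempty (Fin d) := ⟨⟨0, hd⟩⟩
  rw [integrableOn_fun_norm_addHaar volume (f := fun y => kStar P h (C * y ^ 2)),
    finrank_euclideanSpace_fin]
  intro hi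
  refine D.not_integrableOn_kStar hn (ε := C * R ^ 2) (by positivity) ?_
  have him : (fun y : ℝ => C * y ^ 2) '' Ioo 0 R = Ioo 0 (C * R ^ 2) := by
    ext s
    constructor
    · rintro ⟨y, hy, rfl⟩
      have := hy.1
      refine ⟨by positivity, ?_⟩
      have := pow_lt_pow_left₀ hy.2 hy.1.le two_ne_zero
      exact mul_lt_mul_of_pos_left this hC
    · rintro ⟨h1, h2⟩
      refine ⟨√(s / C), ⟨by positivity, ?_⟩, ?_⟩
      · rw [Real.sqrt_lt' hR, div_lt_iff₀ hC]; linarith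
      · simp only; rw [Real.sq_sqrt (by positivity)]; field_simp
  rw [← him, integrableOn_image_iff_integrableOn_abs_deriv_smul (f' := fun y => C * (2 * y))
    measurableSet_Ioo]
  · refine IntegrableOn.congr_fun (hi.const_mul (2 * C ^ ((d : ℝ) / 2))) (fun y hy => ?_)
      measurableSet_Ioo
    have hy0 : 0 < y := hy.1
    have h1 : (C * y ^ 2) ^ ((d : ℝ) / 2 - 1) = C ^ ((d : ℝ) / 2) / C * (y ^ (d - 1) / y) := by
      rw [Real.mul_rpow hC.le (by positivity), Real.rpow_sub hC, Real.rpow_one,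
        ← Real.rpow_natCast y 2, ← Real.rpow_mul hy0.le]
      congr 1
      rw [← Real.rpow_natCast, Nat.cast_sub hd]
      nth_rewrite 3 [← Real.rpow_one y]
      rw [← Real.rpow_sub hy0]
      congr 1
      push_cast
      ring
    simp only [smul_eq_mul]
    rw [h1, abs_of_pos (by positivity)]
    field_simp
  · intro y _
    have := ((hasDerivAt_pow 2 y).const_mul C).hasDerivWithinAt (s := Ioo 0 R)
    simpa using this
  · intro x hx y hy hxy
    have h1 : x ^ 2 = y ^ 2 := by
      have : C * x ^ 2 = C * y ^ 2 := hxy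
      exact mul_left_cancel₀ hC.ne' this
    exact (pow_left_inj₀ hx.1.le hy.1.le two_ne_zero).1 h1

/-- The reflection of the coordinates selected by `σ`. -/
def _root_.FokkerPlanck.signFlip (σ : Fin d → Bool) : Pt d ≃ₗᵢ[ℝ] Pt d :=
  LinearIsometryEquiv.piLpCongrRight 2 fun i =>
    if σ i then LinearIsometryEquiv.neg ℝ else LinearIsometryEquiv.refl ℝ ℝ

theorem _root_.FokkerPlanck.signFlip_apply (σ : Fin d → Bool) (y : Pt d) (i : Fin d) :
    signFlip σ y i = if σ i then -y i else y i := by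
  rw [signFlip, LinearIsometryEquiv.piLpCongrRight_apply]
  by_cases h : σ i <;> simp [h]

/-- The integrand is radial, and the ball of radius `1 / 2` is covered by the finitely many
coordinate reflections of this small cube. -/
theorem not_integrableOn_orthant (D : PressureData d P h)
    (hn : ¬ IntegrableAtFilter (fun s : ℝ => s ^ ((d : ℝ) / 2 - 1) * hStar h s) (𝓝[>] 0) volume)
    {C : ℝ} (hC : 0 < C) :
    ¬ IntegrableOn (fun y : Pt d => kStar P h (C * ‖y‖ ^ 2)) {y | ∀ i, y i ∈ Icc (0 : ℝ) (1 / 2)} := by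
  intro hi
  refine D.not_integrableOn_ball hn hC (R := 1 / 2) (by norm_num) ?_
  have h1 : ∀ σ : Fin d → Bool, IntegrableOn (fun y : Pt d => kStar P h (C * ‖y‖ ^ 2))
      (signFlip σ ⁻¹' {y | ∀ i, y i ∈ Icc (0 : ℝ) (1 / 2)}) := by
    intro σ
    have := ((signFlip σ).measurePreserving.integrableOn_comp_preimage
      (signFlip σ).toHomeomorph.measurableEmbedding).2 hi
    simpa [Function.comp_def] using this
  refine (integrableOn_finite_iUnion.2 h1).mono_set fun y hy => ?_
  rw [mem_iUnion]
  refine ⟨fun i => decide (y i < 0), fun i => ?_⟩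
  rw [signFlip_apply]
  have h2 : |y i| ≤ ‖y‖ := PiLp.norm_apply_le y i
  have h3 : ‖y‖ < 1 / 2 := by simpa using hy
  rw [abs_le] at h2
  by_cases h4 : y i < 0
  · simp only [h4, decide_true, if_true]; constructor <;> linarith
  · simp only [h4, decide_false]
    push Not at h4
    exact ⟨by simpa using h4, by simp; linarith⟩

/-- From any point of the closed cube, also from a corner, a reflected copy of the cube of side `1 /
2` fits inside: in each coordinate it points away from the nearer face. -/
theorem not_integrableOn_closedCube (D : PressureData d P h)
    (hn : ¬ IntegrableAtFilter (fun s : ℝ => s ^ ((d : ℝ) / 2 - 1) * hStar h s) (𝓝[>] 0) volume)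
    {C : ℝ} (hC : 0 < C) {x₀ : Pt d} (hx₀ : x₀ ∈ closedCube d) :
    ¬ IntegrableOn (fun x : Pt d => kStar P h (C * ‖x - x₀‖ ^ 2)) (closedCube d) := by
  intro hi
  refine D.not_integrableOn_orthant hn hC ?_
  set σ : Fin d → Bool := fun i => decide (1 / 2 < x₀ i) with hσ
  have hmp : MeasurePreserving (fun y : Pt d => signFlip σ y + x₀) volume volume :=
    (measurePreserving_add_right volume x₀).comp (signFlip σ).measurePreserving
  have hme : MeasurableEmbedding (fun y : Pt d => signFlip σ y + x₀) :=
    ((signFlip σ).toHomeomorph.trans (Homeomorph.addRight x₀)).measurableEmbedding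
  have := (hmp.integrableOn_comp_preimage hme).2 hi
  have h0 : IntegrableOn (fun y : Pt d => kStar P h (C * ‖y‖ ^ 2))
      ((fun y : Pt d => signFlip σ y + x₀) ⁻¹' closedCube d) := by
    simpa [Function.comp_def] using this
  refine h0.mono_set fun y hy i => ?_
  have h1 := hy i
  have h2 := hx₀ i
  rw [PiLp.add_apply, signFlip_apply]
  by_cases h4 : 1 / 2 < x₀ i
  · simp only [hσ, h4, decide_true, if_true]
    constructor <;> linarith [h1.1, h1.2, h2.1, h2.2]
  · simp only [hσ, h4, decide_false]
    push Not at h4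
    constructor <;> simp <;> linarith [h1.1, h1.2, h2.1, h2.2]

end PressureData

/-- Substitution `s = 1 / r`: the factor `s` in `h_*` and the Jacobian `r⁻²` contribute the
remaining powers of `r`. -/
theorem integrableAtFilter_hStar_iff (d : ℕ) (h : ℝ → ℝ) :
    IntegrableAtFilter (fun s : ℝ => s ^ ((d : ℝ) / 2 - 1) * hStar h s) (𝓝[>] 0) volume ↔
      IntegrableAtFilter (fun r : ℝ => r ^ (-((d : ℝ) / 2 + 2)) * h r) atTop volume := by
  have key : ∀ R > 0, IntegrableOn (fun s : ℝ => s ^ ((d : ℝ) / 2 - 1) * hStar h s) (Ioo 0 R⁻¹) ↔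
      IntegrableOn (fun r : ℝ => r ^ (-((d : ℝ) / 2 + 2)) * h r) (Ioi R) := by
    intro R hR
    have him : (fun r : ℝ => r⁻¹) '' Ioi R = Ioo 0 R⁻¹ := by
      rw [Set.image_inv_eq_inv, Set.inv_Ioi₀ hR]
    rw [← him, integrableOn_image_iff_integrableOn_abs_deriv_smul
      (f' := fun r => -(r ^ 2)⁻¹) measurableSet_Ioi]
    · refine integrableOn_congr_fun (fun r hr => ?_) measurableSet_Ioi
      have hr0 : 0 < r := hR.trans hr
      have h1 : r ^ (-((d : ℝ) / 2 + 2)) = (r⁻¹) ^ ((d : ℝ) / 2 - 1) * r⁻¹ * (r ^ 2)⁻¹ := by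
        rw [Real.inv_rpow hr0.le, ← Real.rpow_neg hr0.le, ← Real.rpow_neg_one r,
          ← Real.rpow_natCast r 2, ← Real.rpow_neg hr0.le, ← Real.rpow_add hr0,
          ← Real.rpow_add hr0]
        congr 1
        push_cast
        ring
      simp only [smul_eq_mul, hStar, one_div, inv_inv, h1, abs_neg]
      rw [abs_of_pos (by positivity)]
      ring
    · intro r hr
      exact (hasDerivAt_inv (hR.trans hr).ne').hasDerivWithinAt
    · exact fun x _ y _ hxy => inv_injective hxy
  rw [integrableAtFilter_nhdsGT_iff]
  constructor
  · rintro ⟨ε, hε, hi⟩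
    refine ⟨Ioi ε⁻¹, Ioi_mem_atTop _, (key _ (by positivity)).1 (by rwa [inv_inv])⟩
  · rintro ⟨s, hs, hi⟩
    obtain ⟨R, hR⟩ := mem_atTop_sets.1 hs
    have hpos : 0 < max R 1 := lt_max_of_lt_right one_pos
    refine ⟨(max R 1)⁻¹, by positivity, (key _ hpos).2 (hi.mono_set fun r hr => ?_)⟩
    exact hR r ((le_max_left _ _).trans (le_of_lt hr))

end InternalEnergy

/-! ### The drift potential: semiconvexity and strong convexity with the transport cost. -/

section Potential

variable {d : ℕ}

/-- The assumptions on the potential and the time step. -/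
structure DriftData (V : Pt d → ℝ) (lam τ : ℝ) : Prop where
  smooth : ContDiffOn ℝ ∞ V (closedCube d)
  convex : ∀ x ∈ cube d, ∀ w : Pt d, lam * ‖w‖ ^ 2 ≤ fderiv ℝ (fderiv ℝ V) x w w
  pos : 0 < τ
  coercive : 0 < lam + τ⁻¹

theorem norm_sq_combo (a b : Pt d) {α β : ℝ} (hαβ : α + β = 1) :
    ‖α • a + β • b‖ ^ 2 = α * ‖a‖ ^ 2 + β * ‖b‖ ^ 2 - α * β * ‖a - b‖ ^ 2 := by
  have hα : α = 1 - β := by linarith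
  subst hα
  rw [norm_add_sq_real, norm_sub_sq_real, norm_smul, norm_smul, inner_smul_left, inner_smul_right,
    mul_pow, mul_pow, Real.norm_eq_abs, Real.norm_eq_abs, sq_abs, sq_abs]
  simp only [conj_trivial]
  ring

namespace DriftData

variable {V : Pt d → ℝ} {lam τ : ℝ}

theorem continuousOn (H : DriftData V lam τ) : ContinuousOn V (closedCube d) :=
  H.smooth.continuousOn

theorem contDiffAt (H : DriftData V lam τ) {x : Pt d} (hx : x ∈ cube d) : ContDiffAt ℝ ∞ V x :=
  H.smooth.contDiffAt (closedCube_mem_nhds hx)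

theorem convexOn_cube (H : DriftData V lam τ) :
    ConvexOn ℝ (cube d) fun y => V y - lam / 2 * ‖y‖ ^ 2 := by
  refine ⟨convex_cube, fun x hx y hy α β hα hβ hαβ => ?_⟩
  set v := y - x with hv
  have hmem : ∀ s ∈ Icc (0 : ℝ) 1, x + s • v ∈ cube d := fun s hs =>
    convex_cube.add_smul_sub_mem hx hy hs
  have hline : ∀ s : ℝ, HasDerivAt (fun s : ℝ => x + s • v) v s := fun s => by
    simpa using ((hasDerivAt_id s).smul_const v).const_add x
  have hcont : Continuous fun s : ℝ => x + s • v := by fun_prop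
  -- Openness of the parameter set lets the formula for the first derivative hold near each point,
  -- so that it can be differentiated again.
  set S : Set ℝ := (fun s : ℝ => x + s • v) ⁻¹' cube d with hS
  have hSo : IsOpen S := isOpen_cube.preimage hcont
  have hd1 : ∀ s ∈ S, HasDerivAt (fun s : ℝ => V (x + s • v) - lam / 2 * ‖x + s • v‖ ^ 2)
      (fderiv ℝ V (x + s • v) v - lam * inner ℝ (x + s • v) v) s := by
    intro s hs
    have h1 := (((H.contDiffAt hs).differentiableAt (by simp)).hasFDerivAt).comp_hasDerivAt s
      (hline s)
    have h2 := ((hline s).norm_sq).const_mul (lam / 2)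
    refine (h1.sub h2).congr_deriv ?_
    ring
  have hd2 : ∀ s ∈ S, HasDerivAt (fun s : ℝ => fderiv ℝ V (x + s • v) v -
      lam * inner ℝ (x + s • v) v)
      (fderiv ℝ (fderiv ℝ V) (x + s • v) v v - lam * ‖v‖ ^ 2) s := by
    intro s hs
    have h0 : DifferentiableAt ℝ (fderiv ℝ V) (x + s • v) :=
      ((H.contDiffAt hs).fderiv_right (m := 1)
        (by rw [one_add_one_eq_two]; exact ENat.LEInfty.out)).differentiableAt
        (by simp)
    have h1 : HasDerivAt (fun s : ℝ => fderiv ℝ V (x + s • v) v)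
        (fderiv ℝ (fderiv ℝ V) (x + s • v) v v) s :=
      (ContinuousLinearMap.apply ℝ ℝ v).hasFDerivAt.comp_hasDerivAt s
        (h0.hasFDerivAt.comp_hasDerivAt s (hline s))
    have h2 := ((hline s).inner ℝ (hasDerivAt_const s v)).const_mul lam
    refine (h1.sub h2).congr_deriv ?_
    simp
  have hc : ConvexOn ℝ (Icc (0 : ℝ) 1)
      fun s : ℝ => V (x + s • v) - lam / 2 * ‖x + s • v‖ ^ 2 := by
    have hderiv : ∀ s ∈ S, deriv (fun s : ℝ => V (x + s • v) - lam / 2 * ‖x + s • v‖ ^ 2) =ᶠ[𝓝 s]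
        fun s => fderiv ℝ V (x + s • v) v - lam * inner ℝ (x + s • v) v := fun s hs => by
      filter_upwards [hSo.mem_nhds hs] with r hr using (hd1 r hr).deriv
    refine convexOn_of_deriv2_nonneg (convex_Icc _ _)
      (fun s hs => (hd1 s (hmem s hs)).continuousAt.continuousWithinAt) ?_ ?_ ?_
    · intro s hs
      exact (hd1 s (hmem s (interior_subset hs))).differentiableAt.differentiableWithinAt
    · intro s hs
      have hs' := hmem s (interior_subset hs)
      exact ((hd2 s hs').congr_of_eventuallyEq
        (hderiv s hs')).differentiableAt.differentiableWithinAt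
    · intro s hs
      have hs' := hmem s (interior_subset hs)
      rw [Function.iterate_succ, Function.iterate_one, Function.comp,
        ((hd2 s hs').congr_of_eventuallyEq (hderiv s hs')).deriv]
      linarith [H.convex _ hs' v]
  have h1 := hc.2 (left_mem_Icc.2 zero_le_one) (right_mem_Icc.2 zero_le_one) hα hβ hαβ
  have h2 : x + (α • (0 : ℝ) + β • (1 : ℝ)) • v = α • x + β • y := by
    have hα' : α = 1 - β := by linarith
    subst hα'
    simp only [smul_eq_mul, hv]
    module
  simp only [h2] at h1
  simpa [hv] using h1

/-- Admissible maps may send interior points to the boundary, so convexity is needed up to the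
boundary. All points are moved slightly towards the center, followed by a limit. -/
theorem convexOn_closedCube (H : DriftData V lam τ) :
    ConvexOn ℝ (closedCube d) fun y => V y - lam / 2 * ‖y‖ ^ 2 := by
  refine ⟨convex_closedCube, fun x hx y hy α β hα hβ hαβ => ?_⟩
  set U : Pt d → ℝ := fun y => V y - lam / 2 * ‖y‖ ^ 2 with hU
  have hUc : ContinuousOn U (closedCube d) := by
    have := H.continuousOn
    fun_prop
  have hlim : ∀ z ∈ closedCube d,
      Tendsto (fun s : ℝ => U ((1 - s) • z + s • center d)) (𝓝[>] 0) (𝓝 (U z)) := by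
    intro z hz
    have h1 : Continuous fun s : ℝ => (1 - s) • z + s • center d := by fun_prop
    have h2 : Tendsto (fun s : ℝ => (1 - s) • z + s • center d) (𝓝[>] 0) (𝓝[closedCube d] z) := by
      refine tendsto_nhdsWithin_iff.2 ⟨?_, ?_⟩
      · have := h1.tendsto 0
        simp only [sub_zero, one_smul, zero_smul, add_zero] at this
        exact this.mono_left nhdsWithin_le_nhds
      · filter_upwards [Ioc_mem_nhdsGT (zero_lt_one' ℝ)] with s hs
        exact cube_subset_closedCube (combo_mem_cube hz center_mem_cube hs)
    exact (hUc z hz).tendsto.comp h2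
  refine le_of_tendsto_of_tendsto (hlim _ (convex_closedCube hx hy hα hβ hαβ))
    (((hlim x hx).const_smul α).add ((hlim y hy).const_smul β)) ?_
  filter_upwards [Ioc_mem_nhdsGT (zero_lt_one' ℝ)] with s hs
  have h1 := H.convexOn_cube.2 (combo_mem_cube hx center_mem_cube hs)
    (combo_mem_cube hy center_mem_cube hs) hα hβ hαβ
  convert h1 using 2
  have hα' : α = 1 - β := by linarith
  subst hα'
  module

/-- Strong convexity of the transport cost plus the potential. -/
theorem strong_convex (H : DriftData V lam τ) {x y z : Pt d} (hy : y ∈ closedCube d)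
    (hz : z ∈ closedCube d) {α β : ℝ} (hα : 0 ≤ α) (hβ : 0 ≤ β) (hαβ : α + β = 1) :
    V (α • y + β • z) + ‖α • y + β • z - x‖ ^ 2 / (2 * τ) +
      (lam + τ⁻¹) / 2 * (α * β) * ‖y - z‖ ^ 2 ≤
    α * (V y + ‖y - x‖ ^ 2 / (2 * τ)) + β * (V z + ‖z - x‖ ^ 2 / (2 * τ)) := by
  have h1 := H.convexOn_closedCube.2 hy hz hα hβ hαβ
  simp only [smul_eq_mul] at h1
  have h2 : α • y + β • z - x = α • (y - x) + β • (z - x) := by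
    have hα' : α = 1 - β := by linarith
    subst hα'
    module
  rw [h2, norm_sq_combo (y - x) (z - x) hαβ, sub_sub_sub_cancel_right]
  rw [norm_sq_combo y z hαβ] at h1
  have h3 : ∀ a : ℝ, a / (2 * τ) = τ⁻¹ / 2 * a := fun a => by field_simp
  simp only [h3]
  nlinarith

end DriftData
end Potential

/-! ### Extended integrals as Lebesgue integrals of nonnegative functions. -/

section Functional

variable {d : ℕ} {P h : ℝ → ℝ} {V : Pt d → ℝ} {lam τ : ℝ} {ρ : Pt d → ℝ}

/-- The splitting into positive and negative parts, written with sums only, so that it can be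
integrated without differences of infinities. -/
theorem toENNReal_add_identity {a : EReal} {b : ℝ} (ha : a ≠ ⊥) (hab : 0 ≤ a + b) :
    a.toENNReal + ENNReal.ofReal b = (a + b).toENNReal + ((-a).toENNReal + ENNReal.ofReal (-b)) := by
  induction a using EReal.rec with
  | bot => exact absurd rfl ha
  | top => simp
  | coe a =>
    have hab' : 0 ≤ a + b := by exact_mod_cast hab
    rw [← EReal.coe_add, ← EReal.coe_neg, EReal.toENNReal_of_ne_top (EReal.coe_ne_top _),
      EReal.toENNReal_of_ne_top (EReal.coe_ne_top _), EReal.toENNReal_of_ne_top (EReal.coe_ne_top _)]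
    simp only [EReal.toReal_coe]
    rcases le_total 0 a with h1 | h1 <;> rcases le_total 0 b with h2 | h2
    · rw [ENNReal.ofReal_of_nonpos (neg_nonpos.2 h1), ENNReal.ofReal_of_nonpos (neg_nonpos.2 h2),
        ENNReal.ofReal_add h1 h2]; simp
    · rw [ENNReal.ofReal_of_nonpos (neg_nonpos.2 h1), ENNReal.ofReal_of_nonpos h2, zero_add,
        ← ENNReal.ofReal_add hab' (neg_nonneg.2 h2)]; simp
    · rw [ENNReal.ofReal_of_nonpos h1, ENNReal.ofReal_of_nonpos (neg_nonpos.2 h2), zero_add,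
        add_zero, ← ENNReal.ofReal_add hab' (neg_nonneg.2 h1)]; simp
    · rw [ENNReal.ofReal_of_nonpos h1, ENNReal.ofReal_of_nonpos h2,
        show a = 0 by linarith, show b = 0 by linarith]; simp

theorem neg_le_of_zero_le_add {a : EReal} {b : ℝ} (ha : a ≠ ⊥) (hab : 0 ≤ a + b) :
    -a ≤ (b : EReal) := by
  induction a using EReal.rec with
  | bot => exact absurd rfl ha
  | top => simp
  | coe a =>
    have hab' : 0 ≤ a + b := by exact_mod_cast hab
    exact_mod_cast (by linarith : -a ≤ b)

/-- An extended integral becomes a Lebesgue integral after adding an integrable function. -/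
theorem extIntegral_add_integral {μ : Measure (Pt d)} {f : Pt d → EReal} {g : Pt d → ℝ}
    (hf : AEMeasurable f μ) (hg : Integrable g μ) (hbot : ∀ x, f x ≠ ⊥)
    (hfg : ∀ᵐ x ∂μ, 0 ≤ f x + g x) :
    extIntegral f μ + ((∫ x, g x ∂μ : ℝ) : EReal) =
      ((∫⁻ x, (f x + g x).toENNReal ∂μ : ℝ≥0∞) : EReal) := by
  have hgm := hg.aestronglyMeasurable.aemeasurable
  have hgn : AEMeasurable (fun x => ENNReal.ofReal (-g x)) μ := hgm.neg.ennreal_ofReal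
  have key : (∫⁻ x, (f x).toENNReal ∂μ) + ∫⁻ x, ENNReal.ofReal (g x) ∂μ =
      (∫⁻ x, (f x + g x).toENNReal ∂μ) + ((∫⁻ x, (-f x).toENNReal ∂μ) +
        ∫⁻ x, ENNReal.ofReal (-g x) ∂μ) := by
    rw [← lintegral_add_right' _ hgm.ennreal_ofReal, ← lintegral_add_right' _ hgn,
      ← lintegral_add_right']
    · refine lintegral_congr_ae ?_
      filter_upwards [hfg] with x hx using toENNReal_add_identity (hbot x) hx
    · exact (hf.neg.ereal_toENNReal).add hgn
  have h1 : ∫⁻ x, ENNReal.ofReal (g x) ∂μ ≠ ⊤ :=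
    ((lintegral_ofReal_le_lintegral_enorm g).trans_lt hg.2).ne
  have h2 : ∫⁻ x, ENNReal.ofReal (-g x) ∂μ ≠ ⊤ :=
    ((lintegral_ofReal_le_lintegral_enorm _).trans_lt hg.neg.2).ne
  -- Since `f + g ≥ 0`, the negative part of `f` is dominated by the positive part of `g`; only the
  -- positive part of `f` can have an infinite integral.
  have h3 : ∫⁻ x, (-f x).toENNReal ∂μ ≠ ⊤ := by
    refine ne_top_of_le_ne_top h1 (lintegral_mono_ae ?_)
    filter_upwards [hfg] with x hx
    refine EReal.toENNReal_le_toENNReal (y := (g x : EReal)) ?_ |>.trans_eq ?_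
    · exact neg_le_of_zero_le_add (hbot x) hx
    · rw [EReal.toENNReal_of_ne_top (EReal.coe_ne_top _), EReal.toReal_coe]
  rw [extIntegral, integral_eq_lintegral_pos_part_sub_lintegral_neg_part hg]
  set A := ∫⁻ x, (f x).toENNReal ∂μ
  set B := ∫⁻ x, (f x + g x).toENNReal ∂μ
  set F := ∫⁻ x, (-f x).toENNReal ∂μ
  set G := ∫⁻ x, ENNReal.ofReal (g x) ∂μ
  set G' := ∫⁻ x, ENNReal.ofReal (-g x) ∂μ
  clear_value A B F G G'
  lift F to NNReal using h3
  lift G to NNReal using h1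
  lift G' to NNReal using h2
  by_cases hA : A = ⊤
  · have hB : B = ⊤ := by
      rw [hA, top_add] at key
      rcases ENNReal.add_eq_top.1 key.symm with h | h
      · exact h
      · exact absurd h (by simp)
    rw [hA, hB]
    simp
    rfl
  · have hB : B ≠ ⊤ := by
      intro h
      rw [h, top_add] at key
      exact absurd key (by simp [hA])
    lift A to NNReal using hA
    lift B to NNReal using hB
    have : (A : ℝ) + G = B + (F + G') := by exact_mod_cast key
    simp only [ENNReal.coe_toReal]
    have e : ∀ x : NNReal, ((x : ℝ≥0∞) : EReal) = ((x : ℝ) : EReal) := fun x => rfl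
    rw [e, e, e, ← EReal.coe_sub, ← EReal.coe_add]
    congr 1
    linarith

end Functional

/-! ### The step functional as a Lebesgue integral: convexity, semicontinuity, degenerate points. -/

section Penalized

variable {d : ℕ} {P h : ℝ → ℝ} {V : Pt d → ℝ} {lam τ m : ℝ} {ρ : Pt d → ℝ} {t s : Pt d → Pt d}

/-- The extension of `(s, w) ↦ k(s) + w` by `⊤` to `s ≤ 0`. -/
def phiExt (P h : ℝ → ℝ) (p : ℝ × ℝ) : ℝ≥0∞ :=
  if 0 < p.1 then ENNReal.ofReal (kStar P h p.1 + p.2) else ⊤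

/-- Potential energy plus transport cost of the displacement from `x` to `t x`. -/
def costAt (V : Pt d → ℝ) (τ : ℝ) (t : Pt d → Pt d) (x : Pt d) : ℝ :=
  V (t x) + ‖t x - x‖ ^ 2 / (2 * τ)

/-- The integrand of the step functional, shifted by `m`. -/
def stepDensity (P h : ℝ → ℝ) (V ρ : Pt d → ℝ) (τ m : ℝ) (t : Pt d → Pt d) (x : Pt d) : ℝ≥0∞ :=
  phiExt P h ((fderiv ℝ t x).det / ρ x, costAt V τ t x + m)

/-- The step functional up to an additive constant, as a Lebesgue integral. -/
def stepEnergy (P h : ℝ → ℝ) (V ρ : Pt d → ℝ) (τ m : ℝ) (t : Pt d → Pt d) : ℝ≥0∞ :=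
  ∫⁻ x, stepDensity P h V ρ τ m t x ∂densMeasure ρ

/-- The shift `m` makes the integrand of the step functional nonnegative. -/
def LowerBd (P h : ℝ → ℝ) (V ρ : Pt d → ℝ) (τ m : ℝ) (t : Pt d → Pt d) : Prop :=
  ∀ x ∈ cube d, 0 < (fderiv ℝ t x).det →
    0 ≤ kStar P h ((fderiv ℝ t x).det / ρ x) + (costAt V τ t x + m)

theorem stepDensity_of_pos (hρ : 0 < ρ x) (hdet : 0 < (fderiv ℝ t x).det) :
    stepDensity P h V ρ τ m t x =
      ENNReal.ofReal (kStar P h ((fderiv ℝ t x).det / ρ x) + (costAt V τ t x + m)) :=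
  if_pos (div_pos hdet hρ)

theorem stepDensity_of_zero (hdet : (fderiv ℝ t x).det = 0) :
    stepDensity P h V ρ τ m t x = ⊤ :=
  if_neg (by simp [hdet])

theorem PressureData.measurable_phiExt (D : PressureData d P h) : Measurable (phiExt P h) := by
  have h1 : ContinuousOn (fun p : ℝ × ℝ => ENNReal.ofReal (kStar P h p.1 + p.2))
      (Prod.fst ⁻¹' Ioi 0) :=
    ENNReal.continuous_ofReal.comp_continuousOn
      ((D.continuousOn_kStar.comp continuousOn_fst fun p hp => hp).add continuousOn_snd)
  classical
  have h2 := h1.measurable_piecewise (g := fun _ => ⊤) continuousOn_const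
    (measurableSet_Ioi.preimage measurable_fst)
  convert h2 using 1
  ext p
  simp [phiExt, Set.piecewise]

theorem PressureData.measurable_hStarExt_add (D : PressureData d P h) :
    Measurable fun p : ℝ × ℝ => hStarExt h p.1 + (p.2 : EReal) := by
  have h0 : ContinuousOn (hStar h) (Ioi 0) := by
    have h1 : ContinuousOn (fun s => kStar P h s + affConst P h * s) (Ioi 0) :=
      D.continuousOn_kStar.add (by fun_prop)
    refine h1.congr fun s _ => ?_
    simp [kStar]
  have h1 : ContinuousOn (fun p : ℝ × ℝ => ((hStar h p.1 + p.2 : ℝ) : EReal))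
      (Prod.fst ⁻¹' Ioi 0) :=
    continuous_coe_real_ereal.comp_continuousOn
      ((h0.comp continuousOn_fst fun p hp => hp).add continuousOn_snd)
  classical
  have h2 := h1.measurable_piecewise (g := fun _ => ⊤) continuousOn_const
    (measurableSet_Ioi.preimage measurable_fst)
  convert h2 using 1
  ext p
  by_cases hp : 0 < p.1 <;> simp [hStarExt, Set.piecewise, hp]

theorem Adm.continuousOn_costAt (ht : Adm t) (H : DriftData V lam τ) :
    ContinuousOn (costAt V τ t) (closedCube d) := by
  have h1 := H.continuousOn.comp ht.continuous.continuousOn ht.mapsTo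
  have h2 : Continuous fun x => ‖t x - x‖ ^ 2 / (2 * τ) := by
    have := ht.continuous
    fun_prop
  exact h1.add h2.continuousOn

theorem Adm.continuousOn_det_div (ht : Adm t) (hρ : PosCont ρ) :
    ContinuousOn (fun x => (fderiv ℝ t x).det / ρ x) (closedCube d) :=
  ht.continuous_det.continuousOn.div hρ.cont fun x hx => (hρ.pos x hx).ne'

theorem Adm.aemeasurable_stepDensity (ht : Adm t) (D : PressureData d P h)
    (H : DriftData V lam τ) (hρ : PosCont ρ) :
    AEMeasurable (stepDensity P h V ρ τ m t) (densMeasure ρ) := by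
  refine D.measurable_phiExt.comp_aemeasurable (AEMeasurable.prodMk ?_ ?_)
  · exact (aemeasurable_cube (ht.continuousOn_det_div hρ)).mono_ac (densMeasure_ac ρ)
  · exact ((aemeasurable_cube (ht.continuousOn_costAt H)).mono_ac (densMeasure_ac ρ)).add_const m

/-- The step functional is a Lebesgue integral up to an additive constant. -/
theorem stepFunctional_eq_stepEnergy (ht : Adm t) (D : PressureData d P h)
    (H : DriftData V lam τ) (hρ : PosCont ρ) (hm : LowerBd P h V ρ τ m t) :
    stepFunctional h V ρ τ id t = (stepEnergy P h V ρ τ m t : EReal) +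
      ((affConst P h - m * (densMeasure ρ).real univ : ℝ) : EReal) := by
  have := hρ.isFiniteMeasure
  set f : Pt d → EReal := fun x => hStarExt h (jac (t ∘ id) x / ρ x) + (V ((t ∘ id) x) : EReal)
    with hf
  set c := affConst P h with hc
  -- Adding `g` to the energy integrand inserts the transport cost and the shift `m`, and replaces
  -- `h_*` by `kStar`. The last term integrates to `c`, since the determinant has integral `1`.
  set g : Pt d → ℝ := fun x =>
    1 / (2 * τ) * ‖t x - x‖ ^ 2 + m - c * ((fderiv ℝ t x).det / ρ x) with hg
  have hjac : ∀ x ∈ cube d, jac t x = (fderiv ℝ t x).det := fun x hx =>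
    Reg.jac_eq (ht.differentiable x) (cube_subset_closedCube hx)
  have hfg : ∀ x ∈ cube d, 0 ≤ f x + g x ∧ (f x + g x).toENNReal = stepDensity P h V ρ τ m t x := by
    intro x hx
    have hρx := hρ.pos x (cube_subset_closedCube hx)
    simp only [hf, hg, Function.comp_id, hjac x hx]
    rcases (ht.det_nonneg (cube_subset_closedCube hx)).eq_or_lt with h0 | hpos
    · rw [stepDensity_of_zero h0.symm, ← h0, hStarExt, if_neg (by simp), EReal.top_add_coe,
        EReal.top_add_coe]
      simp
    · rw [stepDensity_of_pos hρx hpos, hStarExt, if_pos (div_pos hpos hρx), ← EReal.coe_add,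
        ← EReal.coe_add]
      have h1 : hStar h ((fderiv ℝ t x).det / ρ x) + V (t x) +
          (1 / (2 * τ) * ‖t x - x‖ ^ 2 + m - c * ((fderiv ℝ t x).det / ρ x)) =
          kStar P h ((fderiv ℝ t x).det / ρ x) + (costAt V τ t x + m) := by
        rw [kStar, costAt]; ring
      rw [h1, EReal.toENNReal_of_ne_top (EReal.coe_ne_top _), EReal.toReal_coe]
      exact ⟨by exact_mod_cast hm x hx hpos, rfl⟩
  have hgi1 : Integrable (fun x => ‖t x - x‖ ^ 2) (densMeasure ρ) := by
    refine hρ.integrable_of_continuousOn (Continuous.continuousOn ?_)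
    have := ht.continuous
    fun_prop
  have hgi2 : Integrable (fun x => (fderiv ℝ t x).det / ρ x) (densMeasure ρ) :=
    hρ.integrable_of_continuousOn (ht.continuousOn_det_div hρ)
  have hgi : Integrable g (densMeasure ρ) :=
    ((hgi1.const_mul _).add (integrable_const m)).sub (hgi2.const_mul c)
  have hfm : AEMeasurable f (densMeasure ρ) := by
    have h1 : AEMeasurable (fun x => ((fderiv ℝ t x).det / ρ x, V (t x))) (densMeasure ρ) :=
      AEMeasurable.prodMk ((aemeasurable_cube (ht.continuousOn_det_div hρ)).mono_ac
        (densMeasure_ac ρ)) ((aemeasurable_cube (H.continuousOn.comp ht.continuous.continuousOn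
          ht.mapsTo)).mono_ac (densMeasure_ac ρ))
    refine (D.measurable_hStarExt_add.comp_aemeasurable h1).congr ?_
    filter_upwards [ae_densMeasure_mem ρ] with x hx
    simp only [hf, Function.comp_id, hjac x hx]
    rfl
  have hbot : ∀ x, f x ≠ ⊥ := by
    intro x
    simp only [hf, hStarExt]
    split_ifs
    · rw [← EReal.coe_add]; exact EReal.coe_ne_bot _
    · simp
  have key := extIntegral_add_integral hfm hgi hbot (by
    filter_upwards [ae_densMeasure_mem ρ] with x hx using (hfg x hx).1)
  have hint : ∫ x, g x ∂densMeasure ρ = 1 / (2 * τ) * ∫ x, ‖t x - x‖ ^ 2 ∂densMeasure ρ +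
      m * (densMeasure ρ).real univ - c := by
    have h1 : ∫ x, (fderiv ℝ t x).det / ρ x ∂densMeasure ρ = 1 := by
      rw [hρ.integral_densMeasure, ← ht.integral_det D.pos_dim]
      refine setIntegral_congr_fun measurableSet_cube fun x hx => ?_
      have := (hρ.pos x (cube_subset_closedCube hx)).ne'
      simp only [smul_eq_mul]
      field_simp
    have h2 : ∫ x, g x ∂densMeasure ρ = (∫ x, (1 / (2 * τ) * ‖t x - x‖ ^ 2 + m) ∂densMeasure ρ) -
        ∫ x, c * ((fderiv ℝ t x).det / ρ x) ∂densMeasure ρ :=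
      integral_sub ((hgi1.const_mul _).add (integrable_const m)) (hgi2.const_mul c)
    rw [h2, integral_add (hgi1.const_mul _) (integrable_const m), integral_const_mul,
      integral_const_mul, h1, integral_const, smul_eq_mul]
    ring
  have hE : (∫⁻ x, (f x + g x).toENNReal ∂densMeasure ρ) = stepEnergy P h V ρ τ m t :=
    lintegral_congr_ae (by
      filter_upwards [ae_densMeasure_mem ρ] with x hx using (hfg x hx).2)
  rw [hE, hint] at key
  rw [stepFunctional, energy, pushMeasure_id, ← key]
  set Q := 1 / (2 * τ) * ∫ x, ‖t x - x‖ ^ 2 ∂densMeasure ρ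
  set E := extIntegral f (densMeasure ρ)
  rw [add_assoc, ← EReal.coe_add, add_comm]
  congr 2
  ring

/-- Pointwise sum of displacement convexity and strong convexity of the cost. Where one of the two
maps degenerates, the right-hand side is `⊤`. -/
theorem stepDensity_combo (D : PressureData d P h) (H : DriftData V lam τ) (hρ : PosCont ρ)
    (ht : Adm t) (hs : Adm s) (hmt : LowerBd P h V ρ τ m t) (hms : LowerBd P h V ρ τ m s)
    {α β : ℝ} (hmc : LowerBd P h V ρ τ m (α • t + β • s))
    (hα : 0 < α) (hβ : 0 < β) (hαβ : α + β = 1) {x : Pt d} (hx : x ∈ cube d) :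
    stepDensity P h V ρ τ m (α • t + β • s) x +
        ENNReal.ofReal ((lam + τ⁻¹) / 2 * (α * β) * ‖t x - s x‖ ^ 2) ≤
      ENNReal.ofReal α * stepDensity P h V ρ τ m t x +
        ENNReal.ofReal β * stepDensity P h V ρ τ m s x := by
  have hxc := cube_subset_closedCube hx
  have hρx := hρ.pos x hxc
  have hα0 : ENNReal.ofReal α ≠ 0 := by simpa using hα
  have hβ0 : ENNReal.ofReal β ≠ 0 := by simpa using hβ
  rcases (ht.det_nonneg hxc).eq_or_lt with h0 | hpt
  · rw [stepDensity_of_zero h0.symm, ENNReal.mul_top hα0, top_add]; exact le_top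
  rcases (hs.det_nonneg hxc).eq_or_lt with h0 | hps
  · rw [stepDensity_of_zero h0.symm, ENNReal.mul_top hβ0, add_top]; exact le_top
  have hpc : 0 < (fderiv ℝ (α • t + β • s) x).det := by
    rw [ht.fderiv_combo hs]
    exact det_pos_add D.pos_dim (ht.psd x hxc) (hs.psd x hxc) hα hβ (Or.inl hpt)
  rw [stepDensity_of_pos hρx hpt, stepDensity_of_pos hρx hps, stepDensity_of_pos hρx hpc]
  have h1 := D.kStar_det_convex (ht.psd x hxc) (hs.psd x hxc) hpt hps hα hβ hαβ hρx
  have h2 := H.strong_convex (x := x) (ht.mapsTo hxc) (hs.mapsTo hxc) hα.le hβ.le hαβ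
  rw [← ht.fderiv_combo hs] at h1
  have h3 := hmt x hx hpt
  have h4 := hms x hx hps
  have h5 : 0 ≤ (lam + τ⁻¹) / 2 * (α * β) * ‖t x - s x‖ ^ 2 := by
    have := H.coercive
    positivity
  rw [← ENNReal.ofReal_mul hα.le, ← ENNReal.ofReal_mul hβ.le, ← ENNReal.ofReal_add
    (mul_nonneg hα.le h3) (mul_nonneg hβ.le h4)]
  rw [← ENNReal.ofReal_add (hmc x hx hpc) h5]
  refine ENNReal.ofReal_le_ofReal ?_
  simp only [costAt, Pi.add_apply, Pi.smul_apply]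
  have h7 : m = α * m + β * m := by rw [← add_mul, hαβ, one_mul]
  linarith

/-- Strong convexity of the step functional. -/
theorem stepEnergy_combo (D : PressureData d P h) (H : DriftData V lam τ) (hρ : PosCont ρ)
    (ht : Adm t) (hs : Adm s) (hmt : LowerBd P h V ρ τ m t) (hms : LowerBd P h V ρ τ m s)
    {α β : ℝ} (hmc : LowerBd P h V ρ τ m (α • t + β • s))
    (hα : 0 < α) (hβ : 0 < β) (hαβ : α + β = 1) :
    stepEnergy P h V ρ τ m (α • t + β • s) +
        ∫⁻ x, ENNReal.ofReal ((lam + τ⁻¹) / 2 * (α * β) * ‖t x - s x‖ ^ 2) ∂densMeasure ρ ≤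
      ENNReal.ofReal α * stepEnergy P h V ρ τ m t +
        ENNReal.ofReal β * stepEnergy P h V ρ τ m s := by
  have hmeas : Measurable fun x => ENNReal.ofReal ((lam + τ⁻¹) / 2 * (α * β) * ‖t x - s x‖ ^ 2) := by
    have h1 := ht.continuous
    have h2 := hs.continuous
    have : Continuous fun x => (lam + τ⁻¹) / 2 * (α * β) * ‖t x - s x‖ ^ 2 := by fun_prop
    exact this.measurable.ennreal_ofReal
  rw [stepEnergy, stepEnergy, stepEnergy, ← lintegral_add_right _ hmeas,
    ← lintegral_const_mul' _ _ ENNReal.ofReal_ne_top, ← lintegral_const_mul' _ _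
      ENNReal.ofReal_ne_top, ← lintegral_add_left' ((ht.aemeasurable_stepDensity D H hρ).const_mul _)]
  refine lintegral_mono_ae ?_
  filter_upwards [ae_densMeasure_mem ρ] with x hx
  exact stepDensity_combo D H hρ ht hs hmt hms hmc hα hβ hαβ hx

/-- The blow-up of `kStar` at `0` makes the value `⊤` the continuous one there. Integrands therefore
converge pointwise even at degenerate points of the limit, as needed for Fatou's lemma. -/
theorem PressureData.continuousOn_phiExt (D : PressureData d P h)
    (hblow : Tendsto (kStar P h) (𝓝[>] 0) atTop) :
    ContinuousOn (phiExt P h) (Prod.fst ⁻¹' Ici 0) := by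
  rintro ⟨r, w⟩ hr
  rcases (show (0 : ℝ) ≤ r from hr).eq_or_lt with rfl | hr
  · have h0 : phiExt P h (0, w) = ⊤ := if_neg (lt_irrefl _)
    rw [ContinuousWithinAt, h0, ENNReal.tendsto_nhds_top_iff_nnreal]
    intro M
    have h1 : ∀ᶠ s in 𝓝[≥] (0 : ℝ), 0 < s → M + 1 - (w - 1) < kStar P h s := by
      have h2 := hblow.eventually_gt_atTop (M + 1 - (w - 1))
      rw [eventually_nhdsWithin_iff] at h2 ⊢
      filter_upwards [h2] with s hs _ hs' using hs hs'
    have h3 : Tendsto (Prod.fst : ℝ × ℝ → ℝ) (𝓝[Prod.fst ⁻¹' Ici 0] (0, w)) (𝓝[≥] 0) :=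
      tendsto_nhdsWithin_iff.2 ⟨continuous_fst.continuousWithinAt,
        eventually_mem_nhdsWithin⟩
    have h4 : Tendsto (Prod.snd : ℝ × ℝ → ℝ) (𝓝[Prod.fst ⁻¹' Ici 0] (0, w)) (𝓝 w) :=
      continuous_snd.continuousWithinAt
    filter_upwards [h3.eventually h1, h4.eventually (lt_mem_nhds (sub_one_lt w))] with p hp1 hp2
    rw [phiExt]
    split_ifs with hp
    · have := hp1 hp
      rw [← ENNReal.ofReal_coe_nnreal]
      refine (ENNReal.ofReal_lt_ofReal_iff_of_nonneg M.coe_nonneg).2 ?_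
      linarith
    · exact ENNReal.coe_lt_top
  · refine ContinuousAt.continuousWithinAt ?_
    have hk : ContinuousAt (kStar P h) ((r, w) : ℝ × ℝ).1 := (D.hasDerivAt_kStar hr).continuousAt
    have h0 : ContinuousAt (fun p : ℝ × ℝ => kStar P h p.1 + p.2) (r, w) :=
      (hk.comp continuousAt_fst).add continuousAt_snd
    have h1 : ContinuousAt (fun p : ℝ × ℝ => ENNReal.ofReal (kStar P h p.1 + p.2)) (r, w) :=
      ENNReal.continuous_ofReal.continuousAt.comp h0
    refine h1.congr ?_
    have : ∀ᶠ p : ℝ × ℝ in 𝓝 (r, w), 0 < p.1 :=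
      continuous_fst.continuousAt.eventually (lt_mem_nhds hr)
    filter_upwards [this] with p hp
    exact (if_pos hp).symm

/-- Lower semicontinuity along pointwise convergence of maps and derivatives. -/
theorem stepEnergy_le_of_tendsto (D : PressureData d P h)
    (hblow : Tendsto (kStar P h) (𝓝[>] 0) atTop) (H : DriftData V lam τ) (hρ : PosCont ρ)
    {u : ℕ → Pt d → Pt d} (hu : ∀ n, Adm (u n)) (ht : Adm t)
    (h1 : ∀ x ∈ cube d, Tendsto (fun n => u n x) atTop (𝓝 (t x)))
    (h2 : ∀ x ∈ cube d, Tendsto (fun n => fderiv ℝ (u n) x) atTop (𝓝 (fderiv ℝ t x)))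
    {c : ℝ≥0∞} (hc : Tendsto (fun n => stepEnergy P h V ρ τ m (u n)) atTop (𝓝 c)) :
    stepEnergy P h V ρ τ m t ≤ c := by
  have hlim : ∀ x ∈ cube d, Tendsto (fun n => stepDensity P h V ρ τ m (u n) x) atTop
      (𝓝 (stepDensity P h V ρ τ m t x)) := by
    intro x hx
    have hxc := cube_subset_closedCube hx
    have hρx := hρ.pos x hxc
    have hV : Tendsto (fun n => V (u n x)) atTop (𝓝 (V (t x))) :=
      (H.continuousOn (t x) (ht.mapsTo hxc)).tendsto.comp
        (tendsto_nhdsWithin_iff.2 ⟨h1 x hx, Eventually.of_forall fun n => (hu n).mapsTo hxc⟩)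
    have hcost : Tendsto (fun n => costAt V τ (u n) x + m) atTop (𝓝 (costAt V τ t x + m)) :=
      (hV.add ((((h1 x hx).sub_const x).norm.pow 2).div_const _)).add_const m
    have hdet : Tendsto (fun n => (fderiv ℝ (u n) x).det / ρ x) atTop
        (𝓝 ((fderiv ℝ t x).det / ρ x)) :=
      ((contDiff_det.continuous.tendsto _).comp (h2 x hx)).div_const _
    have hmem : ((fderiv ℝ t x).det / ρ x, costAt V τ t x + m) ∈
        (Prod.fst ⁻¹' Ici 0 : Set (ℝ × ℝ)) := div_nonneg (ht.det_nonneg hxc) hρx.le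
    exact (D.continuousOn_phiExt hblow _ hmem).tendsto.comp
      (tendsto_nhdsWithin_iff.2 ⟨hdet.prodMk_nhds hcost, Eventually.of_forall fun n =>
        div_nonneg ((hu n).det_nonneg hxc) hρx.le⟩)
  calc stepEnergy P h V ρ τ m t
      = ∫⁻ x, liminf (fun n => stepDensity P h V ρ τ m (u n) x) atTop ∂densMeasure ρ := by
        refine lintegral_congr_ae ?_
        filter_upwards [ae_densMeasure_mem ρ] with x hx using (hlim x hx).liminf_eq.symm
    _ ≤ liminf (fun n => stepEnergy P h V ρ τ m (u n)) atTop :=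
        lintegral_liminf_le' fun n => (hu n).aemeasurable_stepDensity D H hρ
    _ = c := hc.liminf_eq

theorem exists_bound_of_continuousOn {f : Pt d → ℝ} (hf : ContinuousOn f (closedCube d)) :
    ∃ B > 0, ∀ x ∈ closedCube d, |f x| ≤ B := by
  obtain ⟨B, hB⟩ := isCompact_closedCube.exists_bound_of_continuousOn hf
  exact ⟨max B 1, by positivity, fun x hx => (hB x hx).trans (le_max_left _ _)⟩

theorem Reg.stepEnergy_ne_top (ht : Reg t) (D : PressureData d P h) (H : DriftData V lam τ)
    (hρ : PosCont ρ) : stepEnergy P h V ρ τ m t ≠ ⊤ := by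
  have := hρ.isFiniteMeasure
  have hdp : ∀ x ∈ closedCube d, 0 < (fderiv ℝ t x).det / ρ x := fun x hx =>
    div_pos (ht.det_pos x hx) (hρ.pos x hx)
  have h1 : ContinuousOn (fun x => kStar P h ((fderiv ℝ t x).det / ρ x) + (costAt V τ t x + m))
      (closedCube d) :=
    (D.continuousOn_kStar.comp (ht.continuousOn_det_div hρ) hdp).add
      ((ht.continuousOn_costAt H).add continuousOn_const)
  obtain ⟨B, -, hB⟩ := exists_bound_of_continuousOn h1
  have h2 : stepEnergy P h V ρ τ m t ≤ ∫⁻ _, ENNReal.ofReal B ∂densMeasure ρ := by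
    refine lintegral_mono_ae ?_
    filter_upwards [ae_densMeasure_mem ρ] with x hx
    have hxc := cube_subset_closedCube hx
    rw [stepDensity_of_pos (hρ.pos x hxc) (ht.det_pos x hxc)]
    exact ENNReal.ofReal_le_ofReal ((le_abs_self _).trans (hB x hxc))
  refine ne_top_of_le_ne_top ?_ h2
  rw [lintegral_const]
  exact ENNReal.mul_ne_top ENNReal.ofReal_ne_top (measure_ne_top _ _)

/-- At a degenerate point the Jacobian determinant vanishes to second order. -/
theorem Adm.det_le_of_eq_zero (ht : Adm t) {x₀ : Pt d} (hx₀ : x₀ ∈ closedCube d)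
    (h0 : (fderiv ℝ t x₀).det = 0) :
    ∃ C > 0, ∀ x ∈ closedCube d, (fderiv ℝ t x).det ≤ C * ‖x - x₀‖ ^ 2 := by
  have hf := ht.field
  set J : Pt d → ℝ := fun x => (1 + fderiv ℝ (t - _root_.id) x).det with hJ
  have hJt : ∀ x, (fderiv ℝ t x).det = J x := fun x => by rw [hf.fderiv_of_sub_id]
  have hJc : ContDiff ℝ ∞ J := hf.contDiff_det
  have hJ' : fderiv ℝ J x₀ = 0 := hf.fderiv_det_eq_zero
    (fun x hx => by rw [← hf.fderiv_of_sub_id]; exact ht.det_nonneg hx) hx₀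
    (by rw [← hf.fderiv_of_sub_id]; exact h0)
  have hG : ContDiff ℝ ∞ (fderiv ℝ J) := hJc.fderiv_right (by simp)
  -- `C` bounds the second derivative of the determinant. Two applications of the mean value
  -- inequality, first to the derivative and then to the determinant, give the quadratic bound.
  obtain ⟨C, hC0, hC⟩ := exists_bound_of_continuousOn
    (hG.continuous_fderiv (by simp)).norm.continuousOn (d := d)
  have hG' : ∀ y ∈ closedCube d, ‖fderiv ℝ J y‖ ≤ C * ‖y - x₀‖ := by
    intro y hy
    have := Convex.norm_image_sub_le_of_norm_fderiv_le (f := fderiv ℝ J) (𝕜 := ℝ)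
      (fun z _ => (hG.differentiable (by simp)) z)
      (fun z hz => (le_abs_self _).trans (hC z hz)) (convex_closedCube (d := d)) hx₀ hy
    rwa [hJ', sub_zero] at this
  refine ⟨C, hC0, fun x hx => ?_⟩
  have hseg : ∀ z ∈ segment ℝ x₀ x, ‖fderiv ℝ J z‖ ≤ C * ‖x - x₀‖ := by
    intro z hz
    refine (hG' z ((convex_closedCube (d := d)).segment_subset hx₀ hx hz)).trans ?_
    gcongr
    obtain ⟨a, b, ha, hb, hab, rfl⟩ := hz
    have : a • x₀ + b • x - x₀ = b • (x - x₀) := by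
      rw [← eq_sub_iff_add_eq] at hab
      rw [hab]
      module
    rw [this, norm_smul, Real.norm_of_nonneg hb]
    exact mul_le_of_le_one_left (norm_nonneg _) (by linarith)
  have h2 := Convex.norm_image_sub_le_of_norm_fderiv_le (f := J) (𝕜 := ℝ)
    (fun z _ => (hJc.differentiable (by simp)) z) hseg (convex_segment x₀ x)
    (left_mem_segment ℝ x₀ x) (right_mem_segment ℝ x₀ x)
  rw [← hJt x₀, h0, sub_zero, Real.norm_eq_abs] at h2
  rw [hJt, sq, ← mul_assoc]
  exact (le_abs_self _).trans h2

end Penalized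

/-! ### Non-degeneracy, compactness, and the unique minimizer. -/

section Minimization

variable {d : ℕ} {P h : ℝ → ℝ} {V : Pt d → ℝ} {lam τ m : ℝ} {ρ : Pt d → ℝ} {t s : Pt d → Pt d}

theorem norm_sub_sq_le {x y : Pt d} (hx : x ∈ closedCube d) (hy : y ∈ closedCube d) :
    ‖x - y‖ ^ 2 ≤ d := by
  rw [EuclideanSpace.norm_sq_eq]
  calc ∑ i, ‖(x - y) i‖ ^ 2 ≤ ∑ _i : Fin d, (1 : ℝ) := by
        refine Finset.sum_le_sum fun i _ => ?_
        rw [Real.norm_eq_abs, sq_abs, PiLp.sub_apply]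
        nlinarith [(hx i).1, (hx i).2, (hy i).1, (hy i).2]
    _ = d := by simp

/-- Finite energy forces non-degeneracy. -/
theorem Adm.reg_of_stepEnergy_ne_top (ht : Adm t) (D : PressureData d P h)
    (hn : ¬ IntegrableAtFilter (fun s : ℝ => s ^ ((d : ℝ) / 2 - 1) * hStar h s) (𝓝[>] 0) volume)
    (H : DriftData V lam τ) (hρ : PosCont ρ) (hfin : stepEnergy P h V ρ τ m t ≠ ⊤) : Reg t := by
  have := hρ.isFiniteMeasure
  refine ⟨ht, fun x₀ hx₀ => (ht.det_nonneg hx₀).lt_of_ne' fun h0 => ?_⟩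
  obtain ⟨C, hC0, hC⟩ := ht.det_le_of_eq_zero hx₀ h0
  obtain ⟨a, b, ha, hab⟩ := hρ.exists_bounds
  obtain ⟨B, hB0, hB⟩ := exists_bound_of_continuousOn
    ((ht.continuousOn_costAt H).add (continuousOn_const (c := m)))
  have hd0 : (0 : ℝ) < d := by exact_mod_cast D.pos_dim
  set F : Pt d → ℝ := fun x => kStar P h (C / a * ‖x - x₀‖ ^ 2) with hF
  -- Since `‖x - x₀‖² ≤ d` on the cube and `kStar` is nonincreasing, `F ≥ -L`.
  set L : ℝ := |kStar P h (C / a * d)|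
  have hCa : 0 < C / a := div_pos hC0 ha
  refine D.not_integrableOn_closedCube hn hCa hx₀ ?_
  have : Nonempty (Fin d) := ⟨⟨0, D.pos_dim⟩⟩
  have hne : ∀ᵐ x ∂densMeasure ρ, x ≠ x₀ :=
    ((densMeasure_ac ρ).trans Measure.absolutelyContinuous_restrict).ae_le
      (compl_mem_ae_iff.2 (measure_singleton x₀))
  have hFm : AEStronglyMeasurable F (volume.restrict (cube d)) := by
    have hc : ContinuousOn F {x₀}ᶜ := by
      refine D.continuousOn_kStar.comp (Continuous.continuousOn (by fun_prop)) fun x hx => ?_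
      have : 0 < ‖x - x₀‖ := norm_pos_iff.2 (sub_ne_zero.2 hx)
      exact mem_Ioi.2 (by positivity)
    have h1 := hc.aestronglyMeasurable (μ := (volume : Measure (Pt d)))
      (measurableSet_singleton x₀).compl
    have h2 : ∀ᵐ x, x ∈ ({x₀}ᶜ : Set (Pt d)) := compl_mem_ae_iff.2 (measure_singleton x₀)
    rw [Measure.restrict_eq_self_of_ae_mem h2] at h1
    exact h1.mono_measure Measure.restrict_le_self
  -- The quadratic bound on the determinant gives `F ≤ kStar (det / ρ)`, and cost plus shift is at
  -- least `-B`. So finite energy would make `F` integrable.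
  have hle : ∀ᵐ x ∂densMeasure ρ,
      ENNReal.ofReal ‖F x‖ ≤ stepDensity P h V ρ τ m t x + ENNReal.ofReal (B + 2 * L) := by
    filter_upwards [ae_densMeasure_mem ρ, hne] with x hx hxne
    have hxc := cube_subset_closedCube hx
    have hρx := hρ.pos x hxc
    rcases (ht.det_nonneg hxc).eq_or_lt with h0 | hpos
    · rw [stepDensity_of_zero h0.symm, top_add]; exact le_top
    rw [stepDensity_of_pos hρx hpos]
    refine (ENNReal.ofReal_le_ofReal ?_).trans ENNReal.ofReal_add_le
    have hx0 : 0 < ‖x - x₀‖ := norm_pos_iff.2 (sub_ne_zero.2 hxne)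
    have h1 : F x ≤ kStar P h ((fderiv ℝ t x).det / ρ x) := by
      refine D.antitoneOn_kStar (mem_Ioi.2 (div_pos hpos hρx)) (mem_Ioi.2 (by positivity)) ?_
      calc (fderiv ℝ t x).det / ρ x ≤ C * ‖x - x₀‖ ^ 2 / a :=
            div_le_div₀ (by positivity) (hC x hxc) ha (hab x hxc).1
        _ = C / a * ‖x - x₀‖ ^ 2 := by ring
    have h2 : kStar P h (C / a * d) ≤ F x := by
      refine D.antitoneOn_kStar (mem_Ioi.2 (by positivity)) (mem_Ioi.2 (by positivity)) ?_
      gcongr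
      exact norm_sub_sq_le hxc hx₀
    have h3 := neg_abs_le (kStar P h (C / a * d))
    have h4 := (abs_le.1 (hB x hxc)).1
    have h5 : 0 ≤ L := abs_nonneg _
    rw [Real.norm_eq_abs, abs_le]
    simp only [Pi.add_apply] at h4
    constructor <;> linarith
  have hint : Integrable F (densMeasure ρ) := by
    refine ⟨hFm.mono_ac (densMeasure_ac ρ), ?_⟩
    rw [hasFiniteIntegral_iff_norm]
    refine (lintegral_mono_ae hle).trans_lt ?_
    rw [lintegral_add_right _ measurable_const, lintegral_const]
    exact ENNReal.add_lt_top.2 ⟨hfin.lt_top, ENNReal.mul_lt_top ENNReal.ofReal_lt_top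
      (measure_lt_top _ _)⟩
  rw [IntegrableOn, ← restrict_cube]
  have h1 := hρ.integrable_densMeasure.1 hint
  refine (h1.norm.const_mul a⁻¹).mono' hFm ?_
  filter_upwards [ae_cube_mem] with x hx
  have hxc := cube_subset_closedCube hx
  have hρx := hρ.pos x hxc
  rw [norm_smul, Real.norm_of_nonneg hρx.le, ← mul_assoc]
  refine le_mul_of_one_le_left (norm_nonneg _) ?_
  rw [inv_mul_eq_div, one_le_div ha]
  exact (hab x hxc).1

/-- Distinct admissible maps have positive distance in `L²`. -/
theorem Adm.lintegral_pos (ht : Adm t) (hs : Adm s) (hρ : PosCont ρ) (hne : t ≠ s) {c : ℝ}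
    (hc : 0 < c) : 0 < ∫⁻ x, ENNReal.ofReal (c * ‖t x - s x‖ ^ 2) ∂densMeasure ρ := by
  rw [pos_iff_ne_zero]
  intro h0
  apply hne
  rw [hρ.lintegral_densMeasure, lintegral_eq_zero_iff'] at h0
  · have hc1 := ht.continuous
    have hc2 := hs.continuous
    have h1 : t =ᵐ[volume.restrict (cube d)] s := by
      filter_upwards [h0, ae_cube_mem] with x hx hxc
      have hρx := hρ.pos x (cube_subset_closedCube hxc)
      simp only [Pi.zero_apply, mul_eq_zero, ENNReal.ofReal_eq_zero] at hx
      have h2 : c * ‖t x - s x‖ ^ 2 ≤ 0 := hx.resolve_left (by linarith)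
      have h3 : ‖t x - s x‖ ^ 2 ≤ 0 := by
        by_contra! hcon
        nlinarith
      have h4 : ‖t x - s x‖ = 0 := by
        have := sq_nonneg ‖t x - s x‖
        exact pow_eq_zero_iff (two_ne_zero) |>.1 (le_antisymm h3 this)
      exact sub_eq_zero.1 (norm_eq_zero.1 h4)
    -- Equality almost everywhere extends by continuity to the closed cube and then by symmetry to
    -- the whole space.
    have h2 : EqOn t s (cube d) :=
      Measure.eqOn_open_of_ae_eq h1 isOpen_cube hc1.continuousOn hc2.continuousOn
    have h3 : EqOn t s (closedCube d) := by
      rw [← closure_cube]; exact h2.closure hc1 hc2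
    have h4 : IsField (t - s) := by
      have := ht.field.add (hs.field.smul (-1))
      convert this using 1
      module
    exact sub_eq_zero.1 (h4.eq_zero_of_eqOn fun x hx => by simp [h3 hx])
  · have hc1 := ht.continuous
    have hc2 := hs.continuous
    have : Continuous fun x => c * ‖t x - s x‖ ^ 2 := by fun_prop
    exact hρ.aemeasurable_ofReal.mul this.measurable.ennreal_ofReal.aemeasurable

variable {G : Submodule ℝ (Pt d → Pt d)} [FiniteDimensional ℝ G]

/-- The field with given coordinates in a finite-dimensional space of fields. -/
def fieldOf (G : Submodule ℝ (Pt d → Pt d)) [FiniteDimensional ℝ G] :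
    (Fin (Module.finrank ℝ G) → ℝ) →ₗ[ℝ] (Pt d → Pt d) :=
  G.subtype ∘ₗ ((Module.finBasis ℝ G).equivFun.symm : (Fin (Module.finrank ℝ G) → ℝ) →ₗ[ℝ] G)

theorem fieldOf_mem (z) : fieldOf G z ∈ G := ((Module.finBasis ℝ G).equivFun.symm z).2

theorem exists_fieldOf_eq {g : Pt d → Pt d} (hg : g ∈ G) : ∃ z, fieldOf G z = g :=
  ⟨(Module.finBasis ℝ G).equivFun ⟨g, hg⟩, by simp [fieldOf]⟩

theorem fieldOf_injective : Function.Injective (fieldOf G) :=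
  Subtype.val_injective.comp (Module.finBasis ℝ G).equivFun.symm.injective

theorem fieldOf_eq (z) :
    fieldOf G z = fun x => ∑ i, z i • (Module.finBasis ℝ G i : Pt d → Pt d) x := by
  ext1 x
  simp [fieldOf, Module.Basis.equivFun_symm_apply, Finset.sum_apply]

theorem continuous_fieldOf (hG : ∀ g ∈ G, IsField g) :
    Continuous fun p : (Fin (Module.finrank ℝ G) → ℝ) × Pt d => fieldOf G p.1 p.2 := by
  simp only [fieldOf_eq]
  have := fun i => (hG _ (Module.finBasis ℝ G i).2).contDiff.continuous
  fun_prop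

theorem continuous_fderiv_fieldOf (hG : ∀ g ∈ G, IsField g) :
    Continuous fun p : (Fin (Module.finrank ℝ G) → ℝ) × Pt d => fderiv ℝ (fieldOf G p.1) p.2 := by
  have h1 : ∀ p : (Fin (Module.finrank ℝ G) → ℝ) × Pt d, fderiv ℝ (fieldOf G p.1) p.2 =
      ∑ i, p.1 i • fderiv ℝ (Module.finBasis ℝ G i : Pt d → Pt d) p.2 := by
    intro p
    rw [fieldOf_eq]
    exact (HasFDerivAt.fun_sum fun i _ =>
      ((hG _ (Module.finBasis ℝ G i).2).differentiable p.2).hasFDerivAt.const_smul (p.1 i)).fderiv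
  simp only [h1]
  have := fun i => (hG _ (Module.finBasis ℝ G i).2).continuous_fderiv
  fun_prop

/-- The coordinates of admissible maps. -/
def admCoords (G : Submodule ℝ (Pt d → Pt d)) [FiniteDimensional ℝ G] :
    Set (Fin (Module.finrank ℝ G) → ℝ) := {z | Adm (id + fieldOf G z)}

theorem fderiv_id_add_fieldOf (hG : ∀ g ∈ G, IsField g) (z) (x : Pt d) :
    fderiv ℝ (id + fieldOf G z) x = 1 + fderiv ℝ (fieldOf G z) x := by
  have h1 := hG _ (fieldOf_mem z)
  rw [IsField.fderiv_of_sub_id (by rwa [add_sub_cancel_left]), add_sub_cancel_left]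

/-- Closed, because positive semidefiniteness is a family of closed conditions. Bounded, because
admissible maps preserve the closed cube, so displacements are bounded there, and the linear map
from coordinates to fields on the closed cube is injective, hence antilipschitz in finite dimension.
-/
theorem isCompact_admCoords (hG : ∀ g ∈ G, IsField g) : IsCompact (admCoords G) := by
  refine Metric.isCompact_of_isClosed_isBounded ?_ ?_
  · have h1 : admCoords G = ⋂ x ∈ closedCube d, ⋂ v : Pt d,
        {z | 0 ≤ inner ℝ ((1 + fderiv ℝ (fieldOf G z) x) v) v} := by
      ext z
      have hf := hG _ (fieldOf_mem z)
      have hf' : IsField (id + fieldOf G z - id) := by rwa [add_sub_cancel_left]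
      simp only [admCoords, mem_iInter, mem_ofPred_eq, ← fderiv_id_add_fieldOf hG]
      exact ⟨fun H x hx => hf'.isPositive_iff.1 (H.psd x hx),
        fun H => ⟨hf', fun x hx => hf'.isPositive_iff.2 (H x hx)⟩⟩
    rw [h1]
    refine isClosed_biInter fun x _ => isClosed_iInter fun v => isClosed_le continuous_const ?_
    have h2 : Continuous fun z => fderiv ℝ (fieldOf G z) x :=
      (continuous_fderiv_fieldOf hG).comp (Continuous.prodMk_left x)
    fun_prop
  · have : CompactSpace (closedCube d) := isCompact_iff_compactSpace.1 isCompact_closedCube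
    let L : (Fin (Module.finrank ℝ G) → ℝ) →ₗ[ℝ] C(closedCube d, Pt d) :=
      { toFun := fun z => ⟨fun x => fieldOf G z x,
          (hG _ (fieldOf_mem z)).contDiff.continuous.comp continuous_subtype_val⟩
        map_add' := fun z w => by ext1 x; simp
        map_smul' := fun c z => by ext1 x; simp }
    have hL : LinearMap.ker L = ⊥ := by
      rw [LinearMap.ker_eq_bot']
      intro z hz
      have h1 : fieldOf G z = 0 := (hG _ (fieldOf_mem z)).eq_zero_of_eqOn fun x hx =>
        DFunLike.congr_fun hz ⟨x, hx⟩
      exact fieldOf_injective (by rw [h1, map_zero])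
    obtain ⟨K, -, hK⟩ := L.exists_antilipschitzWith hL
    refine (Metric.isBounded_closedBall (x := (0 : Fin (Module.finrank ℝ G) → ℝ))
      (r := K * (d + 1))).subset fun z hz => ?_
    have hz' : Adm (id + fieldOf G z) := hz
    have h1 := hK.le_mul_dist z 0
    rw [map_zero] at h1
    rw [Metric.mem_closedBall]
    refine h1.trans (mul_le_mul_of_nonneg_left ?_ K.2)
    rw [dist_zero_right]
    refine (ContinuousMap.norm_le _ (by positivity)).2 fun x => ?_
    have h2 := norm_sub_sq_le (hz'.mapsTo x.2) x.2
    simp only [Pi.add_apply, id, add_sub_cancel_left] at h2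
    change ‖fieldOf G z x‖ ≤ _
    have h3 : (0 : ℝ) ≤ d := by positivity
    nlinarith [norm_nonneg (fieldOf G z x)]

/-- A common lower bound for the integrands of the step functional. -/
theorem exists_lowerBd (hG : ∀ g ∈ G, IsField g) (D : PressureData d P h)
    (H : DriftData V lam τ) (hρ : PosCont ρ) :
    ∃ m, ∀ t, Adm t → t - id ∈ G → LowerBd P h V ρ τ m t := by
  have hK := (isCompact_admCoords hG).prod (isCompact_closedCube (d := d))
  have hc : Continuous fun p : (Fin (Module.finrank ℝ G) → ℝ) × Pt d =>
      (1 + fderiv ℝ (fieldOf G p.1) p.2).det :=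
    contDiff_det.continuous.comp (continuous_const.add (continuous_fderiv_fieldOf hG))
  obtain ⟨M, hM⟩ := hK.exists_bound_of_continuousOn hc.continuousOn
  obtain ⟨a, b, ha, hab⟩ := hρ.exists_bounds
  obtain ⟨B, -, hB⟩ := exists_bound_of_continuousOn H.continuousOn
  -- `M` bounds all determinants by compactness of the coordinates, so `kStar (det / ρ) ≥ kStar (M /
  -- a)`; also `V ≥ -B`, and the transport cost is nonnegative.
  refine ⟨B - kStar P h (M / a), fun t ht htG x hx hpos => ?_⟩
  have hxc := cube_subset_closedCube hx
  obtain ⟨z, hz⟩ := exists_fieldOf_eq htG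
  have hz' : t = id + fieldOf G z := by rw [hz, add_sub_cancel]
  have h1 : (fderiv ℝ t x).det ≤ M := by
    have h2 := hM (z, x) ⟨by rwa [admCoords, mem_ofPred_eq, ← hz'], hxc⟩
    rw [hz', fderiv_id_add_fieldOf hG]
    exact (le_abs_self _).trans h2
  have hρx := hρ.pos x hxc
  have h2 : kStar P h (M / a) ≤ kStar P h ((fderiv ℝ t x).det / ρ x) :=
    D.antitoneOn_kStar (mem_Ioi.2 (div_pos hpos hρx)) (mem_Ioi.2 (div_pos (hpos.trans_le h1) ha))
      (div_le_div₀ (hpos.le.trans h1) h1 ha (hab x hxc).1)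
  have h3 := (abs_le.1 (hB _ (ht.mapsTo hxc))).1
  have h4 : 0 ≤ ‖t x - x‖ ^ 2 / (2 * τ) := by
    have := H.pos
    positivity
  rw [costAt]
  linarith

theorem tendsto_id_add_fieldOf (hG : ∀ g ∈ G, IsField g)
    {w : ℕ → Fin (Module.finrank ℝ G) → ℝ} {z} (hw : Tendsto w atTop (𝓝 z)) (x : Pt d) :
    Tendsto (fun n => (id + fieldOf G (w n) : Pt d → Pt d) x) atTop
      (𝓝 ((id + fieldOf G z : Pt d → Pt d) x)) := by
  have h1 : Continuous fun z => fieldOf G z x :=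
    (continuous_fieldOf hG).comp (Continuous.prodMk_left x)
  exact ((h1.tendsto z).comp hw).const_add x

theorem tendsto_fderiv_id_add_fieldOf (hG : ∀ g ∈ G, IsField g)
    {w : ℕ → Fin (Module.finrank ℝ G) → ℝ} {z} (hw : Tendsto w atTop (𝓝 z)) (x : Pt d) :
    Tendsto (fun n => fderiv ℝ (id + fieldOf G (w n)) x) atTop
      (𝓝 (fderiv ℝ (id + fieldOf G z) x)) := by
  simp only [fderiv_id_add_fieldOf hG]
  have h1 : Continuous fun z => fderiv ℝ (fieldOf G z) x :=
    (continuous_fderiv_fieldOf hG).comp (Continuous.prodMk_left x)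
  exact ((h1.tendsto z).comp hw).const_add 1

/-- Existence and uniqueness of the minimizer, which is regular. -/
theorem exists_unique_minimizer (hG : ∀ g ∈ G, IsField g) (D : PressureData d P h)
    (hn : ¬ IntegrableAtFilter (fun s : ℝ => s ^ ((d : ℝ) / 2 - 1) * hStar h s) (𝓝[>] 0) volume)
    (H : DriftData V lam τ) (hρ : PosCont ρ)
    (hm : ∀ t, Adm t → t - id ∈ G → LowerBd P h V ρ τ m t) :
    ∃ t, Reg t ∧ t - id ∈ G ∧ ∀ s, Adm s → s - id ∈ G → s ≠ t →
      stepEnergy P h V ρ τ m t < stepEnergy P h V ρ τ m s := by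
  set E := stepEnergy P h V ρ τ m with hE
  -- Direct method: a minimizing sequence of coordinates subconverges, and the energy is lower
  -- semicontinuous along it.
  obtain ⟨z, hzK, hzmin⟩ : ∃ z ∈ admCoords G, ∀ w ∈ admCoords G,
      E (id + fieldOf G z) ≤ E (id + fieldOf G w) := by
    have hne : ((fun z => E (id + fieldOf G z)) '' admCoords G).Nonempty :=
      ⟨_, 0, by simpa [admCoords] using Adm.id, rfl⟩
    obtain ⟨u, -, hu, hmem⟩ := exists_seq_tendsto_sInf hne (OrderBot.bddBelow _)
    choose w hw hwu using hmem
    obtain ⟨z, hz, φ, hφ, hlim⟩ := (isCompact_admCoords hG).tendsto_subseq hw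
    have hu' := (hu.comp hφ.tendsto_atTop).congr fun n => (hwu (φ n)).symm
    refine ⟨z, hz, fun v hv => ?_⟩
    refine le_trans ?_ (sInf_le (mem_image_of_mem (fun z => E (id + fieldOf G z)) hv))
    exact stepEnergy_le_of_tendsto D (D.tendsto_kStar hn) H hρ (fun n => hw (φ n)) hz
      (fun x _ => tendsto_id_add_fieldOf hG hlim x)
      (fun x _ => tendsto_fderiv_id_add_fieldOf hG hlim x) hu'
  set t := id + fieldOf G z with ht
  have htA : Adm t := hzK
  have htG : t - id ∈ G := by rw [ht, add_sub_cancel_left]; exact fieldOf_mem z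
  have hmin : ∀ s, Adm s → s - id ∈ G → E t ≤ E s := by
    intro s hs hsG
    obtain ⟨w, hw⟩ := exists_fieldOf_eq hsG
    have hw' : s = id + fieldOf G w := by rw [hw, add_sub_cancel]
    rw [hw'] at hs ⊢
    exact hzmin w hs
  -- The identity is a competitor of finite energy.
  have hfin : E t ≠ ⊤ := ne_top_of_le_ne_top (Reg.id.stepEnergy_ne_top D H hρ)
    (hmin _ Adm.id (by rw [sub_self]; exact G.zero_mem))
  refine ⟨t, htA.reg_of_stepEnergy_ne_top D hn H hρ hfin, htG, fun s hs hsG hne => ?_⟩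
  refine (hmin s hs hsG).lt_of_ne fun heq => ?_
  -- With two minimizers, the midpoint would have strictly smaller energy by strong convexity.
  have h2 : (0 : ℝ) < 1 / 2 := by norm_num
  have hcA := htA.combo hs h2.le h2.le (by norm_num)
  have hcG : (1 / 2 : ℝ) • t + (1 / 2 : ℝ) • s - id ∈ G := by
    rw [Adm.combo_sub_id t s (by norm_num)]
    exact G.add_mem (G.smul_mem _ htG) (G.smul_mem _ hsG)
  have h3 := stepEnergy_combo D H hρ htA hs (hm t htA htG) (hm s hs hsG) (hm _ hcA hcG) h2 h2
    (by norm_num)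
  have h4 := hmin _ hcA hcG
  have hc : 0 < (lam + τ⁻¹) / 2 * (1 / 2 * (1 / 2)) := by
    have := H.coercive
    positivity
  have h5 := htA.lintegral_pos hs hρ hne.symm hc
  simp only [hE] at heq hfin h4
  rw [← heq, ← add_mul, ← ENNReal.ofReal_add h2.le h2.le] at h3
  norm_num at h3 h4 h5
  have h6 := (ENNReal.lt_add_right hfin h5.ne').trans_le ((add_le_add_left h4 _).trans h3)
  exact lt_irrefl _ h6

end Minimization

/-! ### First variation of the step functional at regular maps. -/

section FirstVariation

variable {d : ℕ} {P h : ℝ → ℝ} {V : Pt d → ℝ} {lam τ m : ℝ} {ρ : Pt d → ℝ}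
  {t s g : Pt d → Pt d}

/-- The integrand of the step functional, real-valued, up to a null Lagrangian. -/
def stepReal (P h : ℝ → ℝ) (V ρ : Pt d → ℝ) (τ : ℝ) (t : Pt d → Pt d) (x : Pt d) : ℝ :=
  kStar P h ((fderiv ℝ t x).det / ρ x) - P 0 * ((fderiv ℝ t x).det / ρ x) + costAt V τ t x

/-- The step functional on regular maps, up to an additive constant. -/
def stepIntegral (P h : ℝ → ℝ) (V ρ : Pt d → ℝ) (τ : ℝ) (t : Pt d → Pt d) : ℝ :=
  ∫ x, stepReal P h V ρ τ t x ∂densMeasure ρ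

theorem Reg.continuousOn_stepReal (ht : Reg t) (D : PressureData d P h) (H : DriftData V lam τ)
    (hρ : PosCont ρ) : ContinuousOn (stepReal P h V ρ τ t) (closedCube d) := by
  have h1 := ht.continuousOn_det_div hρ
  exact ((D.continuousOn_kStar.comp h1 fun x hx => div_pos (ht.det_pos x hx) (hρ.pos x hx)).sub
    (h1.const_smul (P 0))).add (ht.continuousOn_costAt H)

/-- Passage to real values for differentiation. The term with `P 0` in `stepReal` integrates to a
constant; the nonnegativity makes `ENNReal.ofReal` faithful. -/
theorem Reg.stepEnergy_eq (ht : Reg t) (D : PressureData d P h) (H : DriftData V lam τ)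
    (hρ : PosCont ρ) (hm : LowerBd P h V ρ τ m t) :
    0 ≤ stepIntegral P h V ρ τ t + (P 0 + m * (densMeasure ρ).real univ) ∧
      stepEnergy P h V ρ τ m t =
        ENNReal.ofReal (stepIntegral P h V ρ τ t + (P 0 + m * (densMeasure ρ).real univ)) := by
  have := hρ.isFiniteMeasure
  set f : Pt d → ℝ := fun x =>
    kStar P h ((fderiv ℝ t x).det / ρ x) + (costAt V τ t x + m) with hf
  have h1 : Integrable (stepReal P h V ρ τ t) (densMeasure ρ) :=
    hρ.integrable_of_continuousOn (ht.continuousOn_stepReal D H hρ)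
  have h2 : Integrable (fun x => (fderiv ℝ t x).det / ρ x) (densMeasure ρ) :=
    hρ.integrable_of_continuousOn (ht.continuousOn_det_div hρ)
  have hfe : f = fun x => stepReal P h V ρ τ t x + (P 0 * ((fderiv ℝ t x).det / ρ x) + m) := by
    ext1 x; simp only [hf, stepReal]; ring
  have hfi : Integrable f (densMeasure ρ) := by
    rw [hfe]; exact h1.add ((h2.const_mul _).add (integrable_const m))
  have hf0 : 0 ≤ᵐ[densMeasure ρ] f := by
    filter_upwards [ae_densMeasure_mem ρ] with x hx
    exact hm x hx (ht.det_pos x (cube_subset_closedCube hx))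
  have hint : ∫ x, f x ∂densMeasure ρ =
      stepIntegral P h V ρ τ t + (P 0 + m * (densMeasure ρ).real univ) := by
    have h3 : ∫ x, (fderiv ℝ t x).det / ρ x ∂densMeasure ρ = 1 := by
      rw [hρ.integral_densMeasure, ← ht.integral_det D.pos_dim]
      refine setIntegral_congr_fun measurableSet_cube fun x hx => ?_
      have := (hρ.pos x (cube_subset_closedCube hx)).ne'
      simp only [smul_eq_mul]
      field_simp
    have h4 : Integrable (fun x => P 0 * ((fderiv ℝ t x).det / ρ x)) (densMeasure ρ) :=
      h2.const_mul _
    have h5 : Integrable (fun x => P 0 * ((fderiv ℝ t x).det / ρ x) + m) (densMeasure ρ) :=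
      h4.add (integrable_const m)
    simp only [hfe]
    rw [integral_add h1 h5, integral_add h4 (integrable_const m), integral_const_mul, h3,
      integral_const, smul_eq_mul, stepIntegral]
    ring
  rw [← hint]
  refine ⟨integral_nonneg_of_ae hf0, ?_⟩
  rw [ofReal_integral_eq_lintegral_ofReal hfi hf0, stepEnergy]
  refine lintegral_congr_ae ?_
  filter_upwards [ae_densMeasure_mem ρ] with x hx
  have hxc := cube_subset_closedCube hx
  exact stepDensity_of_pos (hρ.pos x hxc) (ht.det_pos x hxc)

theorem Reg.stepEnergy_lt_iff (ht : Reg t) (hs : Reg s) (D : PressureData d P h)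
    (H : DriftData V lam τ) (hρ : PosCont ρ) (hmt : LowerBd P h V ρ τ m t)
    (hms : LowerBd P h V ρ τ m s) :
    stepEnergy P h V ρ τ m t < stepEnergy P h V ρ τ m s ↔
      stepIntegral P h V ρ τ t < stepIntegral P h V ρ τ s := by
  obtain ⟨h1, h2⟩ := ht.stepEnergy_eq D H hρ hmt
  obtain ⟨h3, h4⟩ := hs.stepEnergy_eq D H hρ hms
  rw [h2, h4, ENNReal.ofReal_lt_ofReal_iff_of_nonneg h1, add_lt_add_iff_right]

theorem Adm.fderiv_add_smul (hs : Adm s) (hg : IsField g) (ε : ℝ) (x : Pt d) :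
    fderiv ℝ (s + ε • g) x = fderiv ℝ s x + ε • fderiv ℝ g x :=
  ((hs.differentiable x).hasFDerivAt.add ((hg.differentiable x).hasFDerivAt.const_smul ε)).fderiv

/-- Regularity is stable under small perturbations. -/
theorem Reg.eventually_add_smul (hs : Reg s) (hg : IsField g) :
    ∀ᶠ ε : ℝ in 𝓝 0, Reg (s + ε • g) := by
  -- The quadratic form of `Ds` is positive on this compact set of points and unit vectors, hence
  -- stays positive uniformly for small `ε`.
  have hK := (isCompact_closedCube (d := d)).prod (isCompact_sphere (0 : Pt d) 1)
  have h1 := hs.continuous_fderiv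
  have h2 := hg.continuous_fderiv
  have hc : Continuous fun p : ℝ × (Pt d × Pt d) =>
      (inner ℝ ((fderiv ℝ s p.2.1 + p.1 • fderiv ℝ g p.2.1) p.2.2) p.2.2 : ℝ) := by fun_prop
  have h3 := hK.eventually_forall_of_forall_eventually (x₀ := (0 : ℝ))
    (P := fun ε p => 0 < (inner ℝ ((fderiv ℝ s p.1 + ε • fderiv ℝ g p.1) p.2) p.2 : ℝ))
    (fun p hp => by
      refine hc.continuousAt.eventually (lt_mem_nhds ?_)
      have hp0 : p.2 ≠ 0 := by
        intro h0
        have := hp.2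
        simp [h0] at this
      simpa using hs.inner_pos hp.1 hp0)
  filter_upwards [h3] with ε hε
  have hf : IsField (s + ε • g - _root_.id) := by
    have := hs.field.add (hg.smul ε)
    convert this using 1
    abel
  have hpos : ∀ x ∈ closedCube d, ∀ v ≠ 0, 0 < inner ℝ (fderiv ℝ (s + ε • g) x v) v := by
    intro x hx v hv
    have hv' : 0 < ‖v‖ := norm_pos_iff.2 hv
    have h4 := hε (x, ‖v‖⁻¹ • v) ⟨hx, by simp [norm_smul, hv'.ne']⟩
    rw [← hs.fderiv_add_smul hg, map_smul, inner_smul_left, inner_smul_right] at h4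
    simp only [conj_trivial] at h4
    have h5 := inv_pos.2 hv'
    exact pos_of_mul_pos_right (pos_of_mul_pos_right h4 h5.le) h5.le
  have hpsd : ∀ x ∈ closedCube d, (fderiv ℝ (s + ε • g) x).IsPositive := fun x hx =>
    hf.isPositive_iff.2 fun v => by
      by_cases hv : v = 0
      · simp [hv]
      · exact (hpos x hx v hv).le
  exact ⟨⟨hf, hpsd⟩, fun x hx => det_pos_of_inner_pos (hpsd x hx) (hpos x hx)⟩

/-- The derivative of the integrand of the step functional along `s + ε g`. -/
def stepVariation (P : ℝ → ℝ) (V ρ : Pt d → ℝ) (τ : ℝ) (s g : Pt d → Pt d) (ε : ℝ) (x : Pt d) : ℝ :=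
  -P (1 / ((fderiv ℝ s x + ε • fderiv ℝ g x).det / ρ x)) *
      (fderiv ℝ (fun A : Pt d →L[ℝ] Pt d => A.det) (fderiv ℝ s x + ε • fderiv ℝ g x)
        (fderiv ℝ g x) / ρ x) +
    (fderivWithin ℝ V (closedCube d) (s x + ε • g x) (g x) +
      inner ℝ (s x + ε • g x - x) (g x) / τ)

theorem DriftData.hasFDerivAt (H : DriftData V lam τ) {x : Pt d} (hx : x ∈ cube d) :
    HasFDerivAt V (fderivWithin ℝ V (closedCube d) x) x := by
  rw [fderivWithin_of_mem_nhds (closedCube_mem_nhds hx)]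
  exact ((H.contDiffAt hx).differentiableAt (by simp)).hasFDerivAt

theorem hasDerivAt_stepReal (D : PressureData d P h) (H : DriftData V lam τ) (hρ : PosCont ρ)
    (hs : Adm s) (hg : IsField g) {ε : ℝ} (hreg : Reg (s + ε • g)) {x : Pt d} (hx : x ∈ cube d) :
    HasDerivAt (fun ε => stepReal P h V ρ τ (s + ε • g) x) (stepVariation P V ρ τ s g ε x) ε := by
  have hxc := cube_subset_closedCube hx
  have hρx := hρ.pos x hxc
  set M := fderiv ℝ s x
  set N := fderiv ℝ g x
  have hline : HasDerivAt (fun ε : ℝ => M + ε • N) N ε := by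
    simpa using ((hasDerivAt_id ε).smul_const N).const_add M
  have hdet : HasDerivAt (fun ε : ℝ => (M + ε • N).det / ρ x)
      (fderiv ℝ (fun A : Pt d →L[ℝ] Pt d => A.det) (M + ε • N) N / ρ x) ε :=
    (((contDiff_det.differentiable (by simp)) _).hasFDerivAt.comp_hasDerivAt ε hline).div_const _
  have hpos : 0 < (M + ε • N).det / ρ x := by
    have := hreg.det_pos x hxc
    rw [hs.fderiv_add_smul hg] at this
    exact div_pos this hρx
  have hk := (D.hasDerivAt_kStar hpos).comp ε hdet
  have hpt : HasDerivAt (fun ε : ℝ => s x + ε • g x) (g x) ε := by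
    simpa using ((hasDerivAt_id ε).smul_const (g x)).const_add (s x)
  have hV : HasDerivAt (fun ε : ℝ => V (s x + ε • g x))
      (fderivWithin ℝ V (closedCube d) (s x + ε • g x) (g x)) ε :=
    (H.hasFDerivAt (hreg.mapsTo_cube hx)).comp_hasDerivAt ε hpt
  have hn : HasDerivAt (fun ε : ℝ => ‖s x + ε • g x - x‖ ^ 2 / (2 * τ))
      (2 * inner ℝ (s x + ε • g x - x) (g x) / (2 * τ)) ε :=
    ((hpt.sub_const x).norm_sq).div_const _
  -- The subtracted null Lagrangian cancels the `P 0` in the derivative of `kStar`; what remains is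
  -- `-P (1 / s)`, as in the weak pairing.
  have h1 := (hk.sub (hdet.const_mul (P 0))).add (hV.add hn)
  refine (h1.congr_deriv ?_).congr_of_eventuallyEq (Eventually.of_forall fun ε => ?_)
  · rw [stepVariation, mul_div_mul_left _ _ two_ne_zero]
    ring
  · simp only [stepReal, costAt, hs.fderiv_add_smul hg, Pi.add_apply, Pi.smul_apply]
    rfl

theorem continuousOn_stepVariation (D : PressureData d P h) (H : DriftData V lam τ)
    (hρ : PosCont ρ) (hs : Adm s) (hg : IsField g) {S : Set ℝ} (hS : ∀ ε ∈ S, Reg (s + ε • g)) :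
    ContinuousOn (fun p : ℝ × Pt d => stepVariation P V ρ τ s g p.1 p.2) (S ×ˢ closedCube d) := by
  have h1 := hs.continuous_fderiv
  have h2 := hg.continuous_fderiv
  have h3 := hs.continuous
  have h4 := hg.contDiff.continuous
  have hline : Continuous fun p : ℝ × Pt d => fderiv ℝ s p.2 + p.1 • fderiv ℝ g p.2 := by fun_prop
  have hρc : ContinuousOn (fun p : ℝ × Pt d => ρ p.2) (S ×ˢ closedCube d) :=
    hρ.cont.comp continuousOn_snd fun p hp => hp.2
  have hρ0 : ∀ p ∈ S ×ˢ closedCube d, ρ p.2 ≠ 0 := fun p hp => (hρ.pos _ hp.2).ne'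
  have hpos : ∀ p ∈ S ×ˢ closedCube d,
      0 < (fderiv ℝ s p.2 + p.1 • fderiv ℝ g p.2).det / ρ p.2 := by
    intro p hp
    have := (hS _ hp.1).det_pos _ hp.2
    rw [hs.fderiv_add_smul hg] at this
    exact div_pos this (hρ.pos _ hp.2)
  have hdet : ContinuousOn (fun p : ℝ × Pt d =>
      (fderiv ℝ s p.2 + p.1 • fderiv ℝ g p.2).det / ρ p.2) (S ×ˢ closedCube d) :=
    (contDiff_det.continuous.comp hline).continuousOn.div hρc hρ0
  have hP : ContinuousOn (fun p : ℝ × Pt d =>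
      P (1 / ((fderiv ℝ s p.2 + p.1 • fderiv ℝ g p.2).det / ρ p.2))) (S ×ˢ closedCube d) :=
    D.P_cont.comp (continuousOn_const.div hdet fun p hp => (hpos p hp).ne') fun p hp =>
      mem_Ici.2 (by have := hpos p hp; positivity)
  have hD : Continuous fun p : ℝ × Pt d =>
      fderiv ℝ (fun A : Pt d →L[ℝ] Pt d => A.det) (fderiv ℝ s p.2 + p.1 • fderiv ℝ g p.2)
        (fderiv ℝ g p.2) :=
    ((contDiff_det.continuous_fderiv (by simp)).comp hline).clm_apply (h2.comp continuous_snd)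
  have hpt : Continuous fun p : ℝ × Pt d => s p.2 + p.1 • g p.2 := by fun_prop
  have hV : ContinuousOn (fun p : ℝ × Pt d =>
      fderivWithin ℝ V (closedCube d) (s p.2 + p.1 • g p.2) (g p.2)) (S ×ˢ closedCube d) :=
    ((H.smooth.continuousOn_fderivWithin uniqueDiffOn_closedCube (by simp)).comp hpt.continuousOn
      fun p hp => (hS _ hp.1).mapsTo hp.2).clm_apply (h4.comp continuous_snd).continuousOn
  have hn : Continuous fun p : ℝ × Pt d => inner ℝ (s p.2 + p.1 • g p.2 - p.2) (g p.2) / τ := by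
    fun_prop
  exact (hP.neg.mul (hD.continuousOn.div hρc hρ0)).add (hV.add hn.continuousOn)

/-- Differentiation under the integral. The maps stay regular for small `ε`, so the variation is
continuous on a compact product and bounded by a constant. -/
theorem hasDerivAt_stepIntegral (D : PressureData d P h) (H : DriftData V lam τ)
    (hρ : PosCont ρ) (hs : Reg s) (hg : IsField g) :
    HasDerivAt (fun ε : ℝ => stepIntegral P h V ρ τ (s + ε • g))
      (∫ x, stepVariation P V ρ τ s g 0 x ∂densMeasure ρ) 0 := by
  have := hρ.isFiniteMeasure
  have hev := hs.eventually_add_smul hg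
  obtain ⟨δ, hδ, hball⟩ := Metric.eventually_nhds_iff_ball.1 hev
  have hS : ∀ ε ∈ Metric.closedBall (0 : ℝ) (δ / 2), Reg (s + ε • g) := fun ε hε =>
    hball ε (Metric.closedBall_subset_ball (by linarith) hε)
  have hc := continuousOn_stepVariation D H hρ hs.toAdm hg hS
  obtain ⟨B, hB⟩ := ((isCompact_closedBall (0 : ℝ) (δ / 2)).prod
    (isCompact_closedCube (d := d))).exists_bound_of_continuousOn hc
  have h0 : (0 : ℝ) ∈ Metric.closedBall (0 : ℝ) (δ / 2) := Metric.mem_closedBall_self (by linarith)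
  have hi : ∀ ε : ℝ, Reg (s + ε • g) →
      Integrable (stepReal P h V ρ τ (s + ε • g)) (densMeasure ρ) := fun ε hε =>
    hρ.integrable_of_continuousOn (hε.continuousOn_stepReal D H hρ)
  refine (hasDerivAt_integral_of_dominated_loc_of_deriv_le (bound := fun _ => B)
    (Metric.closedBall_mem_nhds (0 : ℝ) (half_pos hδ)) ?_ (hi 0 (hS 0 h0)) ?_ ?_
    (integrable_const B) ?_).2
  · filter_upwards [hev] with ε hε using (hi ε hε).aestronglyMeasurable
  · exact (hρ.integrable_of_continuousOn (hc.comp (f := fun x : Pt d => ((0 : ℝ), x))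
      (by fun_prop) fun x hx => ⟨h0, hx⟩)).aestronglyMeasurable
  · filter_upwards [ae_densMeasure_mem ρ] with x hx ε hε
    exact hB (ε, x) ⟨hε, cube_subset_closedCube hx⟩
  · filter_upwards [ae_densMeasure_mem ρ] with x hx ε hε
    exact hasDerivAt_stepReal D H hρ hs.toAdm hg (hS ε hε) hx

end FirstVariation

/-! ### The weak Euler–Lagrange system and its unique solution. -/

section EulerLagrange

variable {d : ℕ} {P h : ℝ → ℝ} {V : Pt d → ℝ} {lam τ m : ℝ} {ρ : Pt d → ℝ}
  {t s g : Pt d → Pt d}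

/-- The inverse of a regular map is smooth up to the boundary. -/
theorem Reg.contDiffOn_inv (hs : Reg s) :
    ContDiffOn ℝ ∞ (Function.invFunOn s (closedCube d)) (closedCube d) := by
  intro y hy
  have hS := hs.isDiffPlus
  set x := Function.invFunOn s (closedCube d) y with hx
  have hxc : x ∈ closedCube d := hS.inv_mem hy
  have hsx : s x = y := hS.apply_inv hy
  -- The map is smooth on the whole space, so even at a boundary point there is a smooth local
  -- inverse on a full neighbourhood; on the closed cube it agrees with the global inverse, by
  -- continuity of the latter.
  obtain ⟨e, he⟩ := hs.exists_equiv hxc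
  have h1 := hs.contDiff.contDiffAt.to_localInverse (a := x) he.hasFDerivAt (by simp)
  rw [hsx] at h1
  refine h1.contDiffWithinAt.congr_of_eventuallyEq_of_mem ?_ hy
  have h2 := (hs.contDiff.contDiffAt.hasStrictFDerivAt' he.hasFDerivAt
    (by simp : (∞ : WithTop ℕ∞) ≠ 0)).eventually_left_inverse
  have h3 : Tendsto (Function.invFunOn s (closedCube d)) (𝓝[closedCube d] y) (𝓝 x) :=
    hS.continuousOn_inv y hy
  filter_upwards [h3.eventually h2, self_mem_nhdsWithin] with z hz hzc
  rw [hS.apply_inv hzc] at hz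
  exact hz.symm

/-- The pushed-forward field `g ∘ s⁻¹` is smooth up to the boundary. -/
theorem Reg.contDiffOn_field_inv (hs : Reg s) (hg : IsField g) :
    ContDiffOn ℝ ∞ (fun y => g (Function.invFunOn s (closedCube d) y)) (closedCube d) :=
  hg.contDiff.comp_contDiffOn hs.contDiffOn_inv

theorem fderiv_add_zero_smul (s g : Pt d → Pt d) (x : Pt d) :
    fderiv ℝ s x + (0 : ℝ) • fderiv ℝ g x = fderiv ℝ s x := by
  ext v; simp

/-- First variation of the Jacobian determinant, through the divergence of the pushed-forward
field. -/
theorem Reg.fderiv_det_eq (hs : Reg s) (hg : IsField g) {x : Pt d} (hx : x ∈ cube d) :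
    fderiv ℝ (fun A : Pt d →L[ℝ] Pt d => A.det) (fderiv ℝ s x) (fderiv ℝ g x) =
      (fderiv ℝ s x).det * LinearMap.trace ℝ (Pt d)
        (fderiv ℝ (fun y => g (Function.invFunOn s (closedCube d) y)) (s x) : Pt d →ₗ[ℝ] Pt d) := by
  have hxc := cube_subset_closedCube hx
  have hS := hs.isDiffPlus
  obtain ⟨e, he⟩ := hs.exists_equiv hxc
  have hM : fderiv ℝ s x = e := he.hasFDerivAt.fderiv
  set ζ : Pt d → Pt d := fun y => g (Function.invFunOn s (closedCube d) y)
  have hζ : DifferentiableAt ℝ ζ (s x) :=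
    ((hs.contDiffOn_field_inv hg).contDiffAt (closedCube_mem_nhds (hs.mapsTo_cube hx))).differentiableAt
      (by simp)
  have h1 : HasFDerivAt (ζ ∘ s) (fderiv ℝ ζ (s x) ∘L fderiv ℝ s x) x :=
    hζ.hasFDerivAt.comp x (hs.differentiable x).hasFDerivAt
  have h2 : ζ ∘ s =ᶠ[𝓝 x] g := by
    filter_upwards [isOpen_cube.mem_nhds hx] with z hz
    simp only [ζ, Function.comp_apply, hS.inv_apply (cube_subset_closedCube hz)]
  -- Near `x` the field is `g = ζ ∘ s`, so the trace of `Dg (Ds)⁻¹` in Jacobi's formula is the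
  -- divergence of `ζ` at `s x`.
  have h3 : fderiv ℝ g x = fderiv ℝ ζ (s x) ∘L fderiv ℝ s x := by
    rw [← h2.fderiv_eq, h1.fderiv]
  have h4 : fderiv ℝ ζ (s x) = fderiv ℝ g x ∘L (e.symm : Pt d →L[ℝ] Pt d) := by
    rw [h3, hM, ContinuousLinearMap.comp_assoc]
    ext v; simp
  have h5 : HasDerivAt (fun ε : ℝ => (fderiv ℝ s x + ε • fderiv ℝ g x).det)
      (fderiv ℝ (fun A : Pt d →L[ℝ] Pt d => A.det) (fderiv ℝ s x) (fderiv ℝ g x)) 0 := by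
    have hline : HasDerivAt (fun ε : ℝ => fderiv ℝ s x + ε • fderiv ℝ g x) (fderiv ℝ g x) 0 := by
      simpa using ((hasDerivAt_id (0 : ℝ)).smul_const (fderiv ℝ g x)).const_add (fderiv ℝ s x)
    have h6 := ((contDiff_det.differentiable (by simp))
      (fderiv ℝ s x + (0 : ℝ) • fderiv ℝ g x)).hasFDerivAt.comp_hasDerivAt (0 : ℝ) hline
    rwa [fderiv_add_zero_smul] at h6
  have h7 := hasDerivAt_det_add_smul (fderiv ℝ s x) (fderiv ℝ g x) (e.symm : Pt d →L[ℝ] Pt d)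
    (by rw [hM]; ext v; simp)
  rw [h5.unique h7, h4]

/-- The weak Euler--Lagrange expression at `s` in direction `g`. -/
def weakExpr (P : ℝ → ℝ) (V ρ : Pt d → ℝ) (τ : ℝ) (s g : Pt d → Pt d) : ℝ :=
  (∫ x, inner ℝ (τ⁻¹ • (s x - x)) (g x) ∂densMeasure ρ) -
    weakVelocityPairing P V (pushDensity s ρ)
      (fun y => g (Function.invFunOn s (closedCube d) y))

/-- Change of variables `y = s x`: the argument `1 / (det Ds / ρ)` of `P` is the pushed-forward
density at `s x`, and the variation of the determinant is the determinant times the divergence of `g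
∘ s⁻¹`. -/
theorem integral_stepVariation (D : PressureData d P h) (H : DriftData V lam τ)
    (hρ : PosCont ρ) (hs : Reg s) (hg : IsField g) :
    ∫ x, stepVariation P V ρ τ s g 0 x ∂densMeasure ρ = weakExpr P V ρ τ s g := by
  have hS := hs.isDiffPlus
  set ζ : Pt d → Pt d := fun y => g (Function.invFunOn s (closedCube d) y) with hζ
  have hjac : ∀ x ∈ closedCube d, jac s x = (fderiv ℝ s x).det := fun x hx =>
    Reg.jac_eq (hs.differentiable x) hx
  have hu : ∀ x ∈ closedCube d, pushDensity s ρ (s x) = ρ x / (fderiv ℝ s x).det := fun x hx => by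
    rw [hS.pushDensity_apply ρ hx, hjac x hx]
  have hc3 := hs.continuous
  have hc4 := hg.contDiff.continuous
  set f1 : Pt d → ℝ := fun x => P (1 / ((fderiv ℝ s x).det / ρ x)) *
    (fderiv ℝ (fun A : Pt d →L[ℝ] Pt d => A.det) (fderiv ℝ s x) (fderiv ℝ g x) / ρ x) with hf1
  set f2 : Pt d → ℝ := fun x => fderivWithin ℝ V (closedCube d) (s x) (g x) with hf2
  set f3 : Pt d → ℝ := fun x => inner ℝ (τ⁻¹ • (s x - x)) (g x) with hf3
  have i2 : Integrable f2 (densMeasure ρ) := by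
    refine hρ.integrable_of_continuousOn ?_
    exact ((H.smooth.continuousOn_fderivWithin uniqueDiffOn_closedCube (by simp)).comp
      hc3.continuousOn hs.mapsTo).clm_apply hc4.continuousOn
  have i3 : Integrable f3 (densMeasure ρ) :=
    hρ.integrable_of_continuousOn (Continuous.continuousOn (by fun_prop))
  have hS0 : ∀ ε ∈ ({0} : Set ℝ), Reg (s + ε • g) := by
    rintro ε rfl; simpa using hs
  have hv : stepVariation P V ρ τ s g 0 = fun x => f3 x - (f1 x - f2 x) := by
    ext1 x
    simp only [stepVariation, hf1, hf2, hf3, fderiv_add_zero_smul, zero_smul, add_zero, inner_smul_left, conj_trivial]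
    ring
  have i0 : Integrable (stepVariation P V ρ τ s g 0) (densMeasure ρ) :=
    hρ.integrable_of_continuousOn ((continuousOn_stepVariation D H hρ hs.toAdm hg hS0).comp
      (f := fun x : Pt d => ((0 : ℝ), x)) (by fun_prop) fun x hx => ⟨rfl, hx⟩)
  have i1 : Integrable f1 (densMeasure ρ) := by
    have : f1 = fun x => f3 x + f2 x - stepVariation P V ρ τ s g 0 x := by
      rw [hv]; ext1 x; ring
    rw [this]
    exact (i3.add i2).sub i0
  have i12 : Integrable (fun x => f1 x - f2 x) (densMeasure ρ) := i1.sub i2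
  simp only [hv]
  rw [integral_sub i3 i12, integral_sub i1 i2, weakExpr, weakVelocityPairing]
  congr 2
  · refine (hρ.integral_densMeasure _).trans (Eq.trans ?_ (hS.integral_comp _).symm)
    refine setIntegral_congr_fun measurableSet_cube fun x hx => ?_
    have hxc := cube_subset_closedCube hx
    have hρx := (hρ.pos x hxc).ne'
    have hdet := (hs.det_pos x hxc).ne'
    simp only [hf1, smul_eq_mul, hjac x hxc, hu x hxc, hs.fderiv_det_eq hg hx, one_div_div]
    field_simp
  · refine (hρ.integral_densMeasure _).trans (Eq.trans ?_ (hS.integral_comp _).symm)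
    refine setIntegral_congr_fun measurableSet_cube fun x hx => ?_
    have hxc := cube_subset_closedCube hx
    have hdet := (hs.det_pos x hxc).ne'
    simp only [hf2, smul_eq_mul, hjac x hxc, hu x hxc, hS.inv_apply hxc]
    have h1 := (H.hasFDerivAt (hs.mapsTo_cube hx))
    rw [← h1.fderiv, inner_gradient_left]
    field_simp

theorem hasDerivAt_stepIntegral_weakExpr (D : PressureData d P h) (H : DriftData V lam τ)
    (hρ : PosCont ρ) (hs : Reg s) (hg : IsField g) :
    HasDerivAt (fun ε : ℝ => stepIntegral P h V ρ τ (s + ε • g)) (weakExpr P V ρ τ s g) 0 := by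
  rw [← integral_stepVariation D H hρ hs hg]
  exact hasDerivAt_stepIntegral D H hρ hs hg

variable {G : Submodule ℝ (Pt d → Pt d)}

/-- The minimizer is the unique regular critical point. -/
theorem weakExpr_eq_zero_iff (hG : ∀ g ∈ G, IsField g) (D : PressureData d P h)
    (H : DriftData V lam τ) (hρ : PosCont ρ)
    (hm : ∀ t, Adm t → t - id ∈ G → LowerBd P h V ρ τ m t) (ht : Reg t) (htG : t - id ∈ G)
    (hmin : ∀ s, Adm s → s - id ∈ G → s ≠ t →
      stepEnergy P h V ρ τ m t < stepEnergy P h V ρ τ m s) (hs : Reg s) (hsG : s - id ∈ G) :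
    (∀ g ∈ G, weakExpr P V ρ τ s g = 0) ↔ s = t := by
  constructor
  · intro hcrit
    by_contra hne
    have hlt := (ht.stepEnergy_lt_iff hs D H hρ (hm t ht.toAdm htG) (hm s hs.toAdm hsG)).1
      (hmin s hs.toAdm hsG hne)
    have hgG : t - s ∈ G := by
      have := G.sub_mem htG hsG
      rwa [sub_sub_sub_cancel_right] at this
    have hder := hasDerivAt_stepIntegral_weakExpr D H hρ hs (hG _ hgG)
    rw [hcrit _ hgG, hasDerivAt_iff_tendsto_slope] at hder
    have hder' := hder.mono_left (nhdsWithin_mono (0 : ℝ) (fun x (hx : x ∈ Ioi (0 : ℝ)) => (mem_Ioi.1 hx).ne'))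
    set c := stepIntegral P h V ρ τ t - stepIntegral P h V ρ τ s with hc
    -- By convexity the difference quotients from `s` towards `t` are at most `c`, which is
    -- negative, whereas they tend to `0` at a critical point.
    have hle : ∀ᶠ ε in 𝓝[>] (0 : ℝ),
        slope (fun ε : ℝ => stepIntegral P h V ρ τ (s + ε • (t - s))) 0 ε ≤ c := by
      filter_upwards [Ioo_mem_nhdsGT (zero_lt_one (α := ℝ))] with ε hε
      have h1ε : 0 < 1 - ε := by linarith [hε.2]
      have hsum : 1 - ε + ε = 1 := by ring
      have heq : s + ε • (t - s) = (1 - ε) • s + ε • t := by module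
      have hreg := Reg.combo D.pos_dim hs.toAdm ht.toAdm (Or.inl hs) h1ε hε.1 hsum
      have hregG : (1 - ε) • s + ε • t - id ∈ G := by
        rw [Adm.combo_sub_id s t hsum]
        exact G.add_mem (G.smul_mem _ hsG) (G.smul_mem _ htG)
      have h2 := le_trans le_self_add (stepEnergy_combo D H hρ hs.toAdm ht.toAdm
        (hm s hs.toAdm hsG) (hm t ht.toAdm htG) (hm _ hreg.toAdm hregG) h1ε hε.1 hsum)
      obtain ⟨a1, a2⟩ := hs.stepEnergy_eq D H hρ (hm s hs.toAdm hsG)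
      obtain ⟨b1, b2⟩ := ht.stepEnergy_eq D H hρ (hm t ht.toAdm htG)
      obtain ⟨c1, c2⟩ := hreg.stepEnergy_eq D H hρ (hm _ hreg.toAdm hregG)
      rw [a2, b2, c2, ← ENNReal.ofReal_mul h1ε.le, ← ENNReal.ofReal_mul hε.1.le,
        ← ENNReal.ofReal_add (mul_nonneg h1ε.le a1) (mul_nonneg hε.1.le b1),
        ENNReal.ofReal_le_ofReal_iff (add_nonneg (mul_nonneg h1ε.le a1)
          (mul_nonneg hε.1.le b1))] at h2
      rw [slope_def_field, sub_zero, div_le_iff₀ hε.1, zero_smul, add_zero, heq]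
      simp only [hc]
      linarith
    have h3 := le_of_tendsto hder' hle
    linarith
  · rintro rfl g hg
    have hder := hasDerivAt_stepIntegral_weakExpr D H hρ hs (hG _ hg)
    -- Small perturbations stay regular and in the affine space, so they are competitors for both
    -- signs of `ε`.
    refine IsLocalMin.hasDerivAt_eq_zero ?_ hder
    filter_upwards [hs.eventually_add_smul (hG g hg)] with ε hε
    simp only [zero_smul, add_zero]
    by_cases h0 : s + ε • g = s
    · rw [h0]
    have hεG : s + ε • g - id ∈ G := by
      rw [add_sub_right_comm]
      exact G.add_mem hsG (G.smul_mem _ hg)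
    exact ((hs.stepEnergy_lt_iff hε D H hρ (hm s hs.toAdm hsG) (hm _ hε.toAdm hεG)).1
      (hmin _ hε.toAdm hεG h0)).le

end EulerLagrange

/-! ### The classical system for densities that are `C¹` up to the boundary. -/

section Classical

variable {d : ℕ} {P h : ℝ → ℝ} {V : Pt d → ℝ} {lam τ m : ℝ} {ρ u : Pt d → ℝ}
  {s g ζ : Pt d → Pt d}

theorem trace_eq_sum (A : Pt d →L[ℝ] Pt d) :
    LinearMap.trace ℝ (Pt d) (A : Pt d →ₗ[ℝ] Pt d) =
      ∑ i, A (EuclideanSpace.single i 1) i := by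
  rw [LinearMap.trace_eq_sum_inner _ (EuclideanSpace.basisFun (Fin d) ℝ)]
  simp [EuclideanSpace.inner_single_left]

/-- The divergence theorem on the cube for tangential fields. -/
theorem integral_trace_fderiv_eq_zero (hd : 0 < d) {F : Pt d → Pt d}
    (hF : ContDiffOn ℝ 1 F (closedCube d))
    (htan : ∀ x ∈ closedCube d, ∀ i, x i = 0 ∨ x i = 1 → F x i = 0) :
    ∫ x in cube d, LinearMap.trace ℝ (Pt d) (fderiv ℝ F x : Pt d →ₗ[ℝ] Pt d) = 0 := by
  obtain ⟨n, rfl⟩ : ∃ n, d = n + 1 := ⟨d - 1, by omega⟩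
  set e : (Fin (n + 1) → ℝ) ≃L[ℝ] Pt (n + 1) :=
    (PiLp.continuousLinearEquiv 2 ℝ (fun _ : Fin (n + 1) => ℝ)).symm with he
  have hea : ∀ y i, e y i = y i := fun y i => rfl
  have hmem : ∀ y ∈ Icc (0 : Fin (n + 1) → ℝ) 1, e y ∈ closedCube (n + 1) := fun y hy i =>
    ⟨hy.1 i, hy.2 i⟩
  set f' : Fin (n + 1) → (Fin (n + 1) → ℝ) → (Fin (n + 1) → ℝ) →L[ℝ] ℝ := fun i y =>
    (EuclideanSpace.proj i : Pt (n + 1) →L[ℝ] ℝ) ∘L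
      fderivWithin ℝ F (closedCube (n + 1)) (e y) ∘L (e : (Fin (n + 1) → ℝ) →L[ℝ] Pt (n + 1))
    with hf'
  have hDc : ContinuousOn (fun y => fderivWithin ℝ F (closedCube (n + 1)) (e y)) (Icc 0 1) :=
    (hF.continuousOn_fderivWithin uniqueDiffOn_closedCube le_rfl).comp
      e.continuous.continuousOn hmem
  have hsum : ∀ y, ∑ i, f' i y (Pi.single i 1) = LinearMap.trace ℝ (Pt (n + 1))
      (fderivWithin ℝ F (closedCube (n + 1)) (e y) : Pt (n + 1) →ₗ[ℝ] Pt (n + 1)) := by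
    intro y
    rw [trace_eq_sum]
    rfl
  -- The divergence theorem on a box in the product space. Its boundary terms contain only the
  -- `i`-th component on the `i`-faces, which vanishes for tangential fields.
  have key := integral_divergence_of_hasFDerivAt_off_countable' (0 : Fin (n + 1) → ℝ) 1
    (fun i => by simp) (fun i y => F (e y) i) f' ∅ countable_empty
    (fun i => (EuclideanSpace.proj i : Pt (n + 1) →L[ℝ] ℝ).continuous.comp_continuousOn
      (hF.continuousOn.comp e.continuous.continuousOn hmem))
    (fun y hy i => by
      have hy' : e y ∈ cube (n + 1) := fun j => by
        simpa [hea] using hy.1 j (mem_univ j)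
      have h1 : HasFDerivAt F (fderivWithin ℝ F (closedCube (n + 1)) (e y)) (e y) := by
        rw [fderivWithin_of_mem_nhds (closedCube_mem_nhds hy')]
        exact ((hF.contDiffAt (closedCube_mem_nhds hy')).differentiableAt (by simp)).hasFDerivAt
      exact (EuclideanSpace.proj i : Pt (n + 1) →L[ℝ] ℝ).hasFDerivAt.comp y
        (h1.comp y e.hasFDerivAt))
    (by
      refine ContinuousOn.integrableOn_compact isCompact_Icc ?_
      exact continuousOn_finsetSum _ fun i _ =>
        (continuousOn_const.clm_comp (hDc.clm_comp continuousOn_const)).clm_apply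
          continuousOn_const)
  rw [Finset.sum_eq_zero] at key
  · calc ∫ x in cube (n + 1), LinearMap.trace ℝ (Pt (n + 1))
            (fderiv ℝ F x : Pt (n + 1) →ₗ[ℝ] Pt (n + 1))
        = ∫ x in closedCube (n + 1), LinearMap.trace ℝ (Pt (n + 1))
            (fderivWithin ℝ F (closedCube (n + 1)) x : Pt (n + 1) →ₗ[ℝ] Pt (n + 1)) := by
          rw [← restrict_cube]
          refine setIntegral_congr_fun measurableSet_cube fun x hx => ?_
          simp only [fderivWithin_of_mem_nhds (closedCube_mem_nhds hx)]
      _ = ∫ y in Icc (0 : Fin (n + 1) → ℝ) 1, ∑ i, f' i y (Pi.single i 1) := by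
          have h1 := (PiLp.volume_preserving_toLp (Fin (n + 1))).setIntegral_preimage_emb
            (MeasurableEquiv.toLp 2 (Fin (n + 1) → ℝ)).measurableEmbedding
            (fun x => LinearMap.trace ℝ (Pt (n + 1))
              (fderivWithin ℝ F (closedCube (n + 1)) x : Pt (n + 1) →ₗ[ℝ] Pt (n + 1)))
            (closedCube (n + 1))
          rw [← h1]
          have h2 : (WithLp.toLp 2 ⁻¹' closedCube (n + 1) : Set (Fin (n + 1) → ℝ)) = Icc 0 1 := by
            ext y
            simp [closedCube, Pi.le_def, forall_and]
          rw [h2]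
          exact setIntegral_congr_fun measurableSet_Icc fun y _ => (hsum y).symm
      _ = 0 := key
  · intro i _
    have hface : ∀ c : ℝ, c = 0 ∨ c = 1 → ∀ y ∈ Icc ((0 : Fin (n + 1) → ℝ) ∘ i.succAbove)
        ((1 : Fin (n + 1) → ℝ) ∘ i.succAbove), F (e (i.insertNth c y)) i = 0 := by
      intro c hc y hy
      refine htan _ (hmem _ ⟨fun j => ?_, fun j => ?_⟩) i (by simpa [hea] using hc)
      · rcases Fin.eq_self_or_eq_succAbove i j with rfl | ⟨k, rfl⟩
        · rcases hc with rfl | rfl <;> simp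
        · simpa using hy.1 k
      · rcases Fin.eq_self_or_eq_succAbove i j with rfl | ⟨k, rfl⟩
        · rcases hc with rfl | rfl <;> simp
        · simpa using hy.2 k
    exact (congrArg₂ (· - ·)
      (setIntegral_eq_zero_of_forall_eq_zero fun y hy => hface 1 (Or.inr rfl) y hy)
      (setIntegral_eq_zero_of_forall_eq_zero fun y hy => hface 0 (Or.inl rfl) y hy)).trans
        (sub_zero 0)

/-- The classical pairing `⟨v[u], ζ⟩`, continuous up to the boundary. -/
def classicalPairing (P : ℝ → ℝ) (V u : Pt d → ℝ) (ζ : Pt d → Pt d) (x : Pt d) : ℝ :=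
  -(deriv P (u x) / u x * fderivWithin ℝ u (closedCube d) x (ζ x) +
    fderivWithin ℝ V (closedCube d) x (ζ x))

theorem PressureData.continuousOn_deriv_P (D : PressureData d P h) :
    ContinuousOn (deriv P) (Ioi 0) :=
  D.P_smooth.continuousOn_deriv_of_isOpen isOpen_Ioi (by simp)

theorem continuousOn_classicalPairing (D : PressureData d P h) (H : DriftData V lam τ)
    (hu : PosCont u) (hu1 : ContDiffOn ℝ 1 u (closedCube d)) (hζ : ContinuousOn ζ (closedCube d)) :
    ContinuousOn (classicalPairing P V u ζ) (closedCube d) :=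
  ((((D.continuousOn_deriv_P.comp hu.cont fun x hx => hu.pos x hx).div hu.cont
    fun x hx => (hu.pos x hx).ne').mul
      ((hu1.continuousOn_fderivWithin uniqueDiffOn_closedCube le_rfl).clm_apply hζ)).add
        ((H.smooth.continuousOn_fderivWithin uniqueDiffOn_closedCube (by simp)).clm_apply hζ)).neg

theorem hasFDerivAt_of_contDiffOn (hu1 : ContDiffOn ℝ 1 u (closedCube d)) {x : Pt d}
    (hx : x ∈ cube d) : HasFDerivAt u (fderivWithin ℝ u (closedCube d) x) x := by
  rw [fderivWithin_of_mem_nhds (closedCube_mem_nhds hx)]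
  exact ((hu1.contDiffAt (closedCube_mem_nhds hx)).differentiableAt (by simp)).hasFDerivAt

/-- Chain rule with `h'' (u) = P' (u) / u`. The right-hand side uses derivatives within the closed
cube and is therefore continuous up to the boundary. -/
theorem inner_velocity (D : PressureData d P h) (H : DriftData V lam τ)
    (hu : PosCont u) (hu1 : ContDiffOn ℝ 1 u (closedCube d)) {x : Pt d} (hx : x ∈ cube d) :
    inner ℝ (velocity h V u x) (ζ x) = classicalPairing P V u ζ x := by
  have hux := hu.pos x (cube_subset_closedCube hx)
  have h1 := (D.hasDerivAt_deriv_h hux).comp_hasFDerivAt x (hasFDerivAt_of_contDiffOn hu1 hx)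
  have h2 := h1.add (H.hasFDerivAt hx)
  have h3 : fderiv ℝ (fun y => deriv h (u y) + V y) x = _ := h2.fderiv
  rw [velocity, inner_neg_left, inner_gradient_left, h3, classicalPairing, D.deriv_P _ hux,
    mul_div_cancel_left₀ _ hux.ne']
  simp

/-- Integration by parts: the divergence theorem for the tangential field `P(u) ζ`. -/
theorem weakVelocityPairing_eq_integral (D : PressureData d P h) (H : DriftData V lam τ)
    (hu : PosCont u) (hu1 : ContDiffOn ℝ 1 u (closedCube d))
    (hζ : ContDiffOn ℝ 1 ζ (closedCube d))
    (htan : ∀ x ∈ closedCube d, ∀ i, x i = 0 ∨ x i = 1 → ζ x i = 0) :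
    weakVelocityPairing P V u ζ = ∫ x in cube d, u x * classicalPairing P V u ζ x := by
  have hζc := hζ.continuousOn
  have hDu := hu1.continuousOn_fderivWithin uniqueDiffOn_closedCube le_rfl
  have hDζ := hζ.continuousOn_fderivWithin uniqueDiffOn_closedCube le_rfl
  have hDV := H.smooth.continuousOn_fderivWithin uniqueDiffOn_closedCube (by simp)
  set A : Pt d → ℝ := fun x => P (u x) * LinearMap.trace ℝ (Pt d)
    (fderivWithin ℝ ζ (closedCube d) x : Pt d →ₗ[ℝ] Pt d)
  set B : Pt d → ℝ := fun x => deriv P (u x) * fderivWithin ℝ u (closedCube d) x (ζ x)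
  set E : Pt d → ℝ := fun x => u x * fderivWithin ℝ V (closedCube d) x (ζ x)
  have hPu : ContDiffOn ℝ 1 (fun x => P (u x)) (closedCube d) :=
    (D.P_smooth.of_le (by simp)).comp hu1 fun x hx => hu.pos x hx
  have iA : IntegrableOn A (cube d) := by
    refine integrable_cube (hPu.continuousOn.mul ?_)
    simp only [trace_eq_sum]
    exact continuousOn_finsetSum _ fun i _ =>
      (EuclideanSpace.proj i : Pt d →L[ℝ] ℝ).continuous.comp_continuousOn
        (hDζ.clm_apply continuousOn_const)
  have iB : IntegrableOn B (cube d) :=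
    integrable_cube ((D.continuousOn_deriv_P.comp hu.cont fun x hx => hu.pos x hx).mul
      (hDu.clm_apply hζc))
  have iE : IntegrableOn E (cube d) := integrable_cube (hu.cont.mul (hDV.clm_apply hζc))
  have hdiv : ∫ x in cube d, (A x + B x) = 0 := by
    rw [← integral_trace_fderiv_eq_zero D.pos_dim (hPu.smul hζ) fun x hx i hi => by
      simp [htan x hx i hi]]
    refine setIntegral_congr_fun measurableSet_cube fun x hx => ?_
    have hux := hu.pos x (cube_subset_closedCube hx)
    have h1 := (D.hasDerivAt_P hux).comp_hasFDerivAt x (hasFDerivAt_of_contDiffOn hu1 hx)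
    have h2 : HasFDerivAt ζ (fderivWithin ℝ ζ (closedCube d) x) x := by
      rw [fderivWithin_of_mem_nhds (closedCube_mem_nhds hx)]
      exact ((hζ.contDiffAt (closedCube_mem_nhds hx)).differentiableAt (by simp)).hasFDerivAt
    have h3 : fderiv ℝ (fun x => P (u x) • ζ x) x = _ := (h1.smul h2).fderiv
    simp only [A, B]
    rw [show ((fun x => P (u x)) • ζ) = fun x => P (u x) • ζ x from rfl, h3]
    simp [LinearMap.trace_smulRight]
  rw [integral_add iA iB] at hdiv
  have hA : ∫ x in cube d, A x = ∫ x in cube d,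
      P (u x) * LinearMap.trace ℝ (Pt d) (fderiv ℝ ζ x : Pt d →ₗ[ℝ] Pt d) :=
    setIntegral_congr_fun measurableSet_cube fun x hx => by
      simp only [A, fderivWithin_of_mem_nhds (closedCube_mem_nhds hx)]
  have hE : ∫ x in cube d, E x = ∫ x in cube d, u x * inner ℝ (gradient V x) (ζ x) :=
    setIntegral_congr_fun measurableSet_cube fun x hx => by
      simp only [E, fderivWithin_of_mem_nhds (closedCube_mem_nhds hx), inner_gradient_left]
  have hR : ∫ x in cube d, u x * classicalPairing P V u ζ x =
      ∫ x in cube d, (-B x - E x) :=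
    setIntegral_congr_fun measurableSet_cube fun x hx => by
      have hux := (hu.pos x (cube_subset_closedCube hx)).ne'
      simp only [B, E, classicalPairing]
      field_simp
      ring
  have iB' : IntegrableOn (fun x => -B x) (cube d) := iB.neg
  rw [hR, integral_sub iB' iE, integral_neg, weakVelocityPairing, ← hA, ← hE]
  linarith

/-- A regular map and its inverse are smooth up to the boundary, so no derivative is lost. Hence
`C¹` regularity of the first density propagates through the scheme. -/
theorem Reg.contDiffOn_pushDensity (hs : Reg s) (hρ1 : ContDiffOn ℝ 1 ρ (closedCube d)) :
    ContDiffOn ℝ 1 (pushDensity s ρ) (closedCube d) := by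
  have hS := hs.isDiffPlus
  have hinv : ContDiffOn ℝ 1 (Function.invFunOn s (closedCube d)) (closedCube d) :=
    hs.contDiffOn_inv.of_le (by simp)
  have hm : MapsTo (Function.invFunOn s (closedCube d)) (closedCube d) (closedCube d) :=
    fun y hy => hS.inv_mem hy
  have hdet : ContDiff ℝ 1 fun x => (fderiv ℝ s x).det :=
    (contDiff_det.of_le (by simp)).comp (hs.contDiff.fderiv_right (m := 1) (by norm_cast))
  refine ((hρ1.comp hinv hm).div (hdet.comp_contDiffOn hinv) fun y hy =>
    (hs.det_pos _ (hm hy)).ne').congr fun y hy => ?_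
  rw [pushDensity, Reg.jac_eq (hs.differentiable _) (hm hy)]
  rfl

/-- For densities that are `C¹` up to the boundary, the classical system is the weak one. -/
theorem integral_inner_velocityAlong (D : PressureData d P h) (H : DriftData V lam τ)
    (hρ : PosCont ρ) (hρ1 : ContDiffOn ℝ 1 ρ (closedCube d)) (hs : Reg s) (hg : IsField g) :
    ∫ x, inner ℝ (τ⁻¹ • (s x - x) - velocityAlong h V ρ s id x) (g x) ∂densMeasure ρ =
      weakExpr P V ρ τ s g := by
  have hS := hs.isDiffPlus
  set u := pushDensity s ρ with hu
  have hup : PosCont u := hS.posCont_pushDensity hρ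
  have hu1 : ContDiffOn ℝ 1 u (closedCube d) := hs.contDiffOn_pushDensity hρ1
  set ζ : Pt d → Pt d := fun y => g (Function.invFunOn s (closedCube d) y) with hζ
  have hζ1 : ContDiffOn ℝ 1 ζ (closedCube d) := (hs.contDiffOn_field_inv hg).of_le (by simp)
  -- The preimage of a point of an `i`-face lies on an `i`-face, where `g` is tangential.
  have htan : ∀ y ∈ closedCube d, ∀ i, y i = 0 ∨ y i = 1 → ζ y i = 0 := by
    intro y hy i hi
    refine hg.tangential ?_
    have hxc := hS.inv_mem hy
    have hsx : s (Function.invFunOn s (closedCube d) y) = y := hS.apply_inv hy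
    by_contra! hcon
    have h1 := hs.coord_mem hxc (i := i)
      ⟨(hxc i).1.lt_of_ne' hcon.1, (hxc i).2.lt_of_ne hcon.2⟩
    rw [hsx] at h1
    rcases hi with hi | hi <;> simp [hi] at h1
  have hBc := continuousOn_classicalPairing D H hup hu1 hζ1.continuousOn
  have hc3 := hs.continuous
  have hc4 := hg.contDiff.continuous
  have i3 : Integrable (fun x => (inner ℝ (τ⁻¹ • (s x - x)) (g x) : ℝ)) (densMeasure ρ) :=
    hρ.integrable_of_continuousOn (Continuous.continuousOn (by fun_prop))
  have iB : Integrable (fun x => classicalPairing P V u ζ (s x)) (densMeasure ρ) :=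
    hρ.integrable_of_continuousOn (hBc.comp hc3.continuousOn hs.mapsTo)
  calc ∫ x, inner ℝ (τ⁻¹ • (s x - x) - velocityAlong h V ρ s id x) (g x) ∂densMeasure ρ
      = ∫ x, (inner ℝ (τ⁻¹ • (s x - x)) (g x) - classicalPairing P V u ζ (s x))
          ∂densMeasure ρ := by
        refine integral_congr_ae ?_
        filter_upwards [ae_densMeasure_mem ρ] with x hx
        have hgx : g x = ζ (s x) := by
          simp only [hζ, hS.inv_apply (cube_subset_closedCube hx)]
        rw [inner_sub_left, ← inner_velocity D H hup hu1 (hs.mapsTo_cube hx), ← hgx]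
        rfl
    _ = weakExpr P V ρ τ s g := by
        rw [integral_sub i3 iB, weakExpr,
          weakVelocityPairing_eq_integral D H hup hu1 hζ1 htan]
        congr 1
        refine (hρ.integral_densMeasure _).trans (Eq.trans ?_ (hS.integral_comp _).symm)
        refine setIntegral_congr_fun measurableSet_cube fun x hx => ?_
        simp only [smul_eq_mul]
        rw [← mul_assoc, hS.jac_mul_pushDensity ρ (cube_subset_closedCube hx)]

end Classical

/-! ### One step of the scheme, and uniqueness under iteration. -/

section Scheme

variable {d : ℕ} {P h : ℝ → ℝ} {V : Pt d → ℝ} {lam τ m : ℝ} {ubar : Pt d → ℝ}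
  {ι : Type*} {b : ι → Pt d → ℝ} {I : Finset ι} {T T0 : Pt d → Pt d}

/-- Carries convexity from the Lebesgue integral to the step functional, which differs by the real
constant `c`; the constant is reproduced because `α + β = 1`. -/
theorem coe_add_le_combo {a b e : ℝ≥0∞} {c α β : ℝ} (hα : 0 < α) (hβ : 0 < β) (hαβ : α + β = 1)
    (h : e ≤ ENNReal.ofReal α * a + ENNReal.ofReal β * b) :
    (e : EReal) + (c : EReal) ≤ (α : EReal) * (a + (c : EReal)) + (β : EReal) * (b + (c : EReal)) := by
  by_cases ha : a = ⊤
  · subst ha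
    by_cases hb : b = ⊤
    · subst hb
      simp [EReal.coe_mul_top_of_pos hα, EReal.coe_mul_top_of_pos hβ]
    · lift b to NNReal using hb
      simp only [EReal.coe_ennreal_top, EReal.top_add_coe, EReal.coe_mul_top_of_pos hα]
      rw [show ((b : ℝ≥0∞) : EReal) = ((b : ℝ) : EReal) from rfl, ← EReal.coe_add, ← EReal.coe_mul,
        EReal.top_add_coe]
      exact le_top
  · lift a to NNReal using ha
    by_cases hb : b = ⊤
    · subst hb
      simp only [EReal.coe_ennreal_top, EReal.top_add_coe, EReal.coe_mul_top_of_pos hβ]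
      rw [show ((a : ℝ≥0∞) : EReal) = ((a : ℝ) : EReal) from rfl, ← EReal.coe_add, ← EReal.coe_mul,
        EReal.coe_add_top]
      exact le_top
    · lift b to NNReal using hb
      have hne : ENNReal.ofReal α * (a : ℝ≥0∞) + ENNReal.ofReal β * (b : ℝ≥0∞) ≠ ⊤ :=
        ENNReal.add_ne_top.2 ⟨ENNReal.mul_ne_top ENNReal.ofReal_ne_top ENNReal.coe_ne_top,
          ENNReal.mul_ne_top ENNReal.ofReal_ne_top ENNReal.coe_ne_top⟩
      have he : e ≠ ⊤ := ne_top_of_le_ne_top hne h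
      have h1 := ENNReal.toReal_mono hne h
      rw [ENNReal.toReal_add (ENNReal.mul_ne_top ENNReal.ofReal_ne_top ENNReal.coe_ne_top)
        (ENNReal.mul_ne_top ENNReal.ofReal_ne_top ENNReal.coe_ne_top), ENNReal.toReal_mul,
        ENNReal.toReal_mul, ENNReal.toReal_ofReal hα.le, ENNReal.toReal_ofReal hβ.le] at h1
      lift e to NNReal using he
      simp only [ENNReal.coe_toReal] at h1
      rw [show ((a : ℝ≥0∞) : EReal) = ((a : ℝ) : EReal) from rfl,
        show ((b : ℝ≥0∞) : EReal) = ((b : ℝ) : EReal) from rfl,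
        show ((e : ℝ≥0∞) : EReal) = ((e : ℝ) : EReal) from rfl, ← EReal.coe_add, ← EReal.coe_add,
        ← EReal.coe_add, ← EReal.coe_mul, ← EReal.coe_mul, ← EReal.coe_add, EReal.coe_le_coe_iff]
      have h2 : α = 1 - β := by linarith
      subst h2
      linarith

theorem convex_regularGradMaps (hd : 0 < d) (hb : ∀ k ∈ I, ContDiff ℝ ∞ (b k))
    (hs : ∀ k ∈ I, IsSymPeriodic (b k)) : Convex ℝ (regularGradMaps b I) := by
  intro x hx y hy α β hα hβ hαβ
  rw [mem_regularGradMaps_iff hb hs] at hx hy ⊢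
  rcases hα.eq_or_lt with rfl | hα
  · obtain rfl : β = 1 := by linarith
    simpa using hy
  rcases hβ.eq_or_lt with rfl | hβ
  · obtain rfl : α = 1 := by linarith
    simpa using hx
  refine ⟨Reg.combo hd hx.1.toAdm hy.1.toAdm (Or.inl hx.1) hα hβ hαβ, ?_⟩
  rw [Adm.combo_sub_id x y hαβ]
  exact Submodule.add_mem _ (Submodule.smul_mem _ _ hx.2) (Submodule.smul_mem _ _ hy.2)

/-- The conclusions about a single minimization step. -/
structure IsStep (P h : ℝ → ℝ) (V ubar : Pt d → ℝ) (τ : ℝ) (b : ι → Pt d → ℝ) (I : Finset ι)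
    (T t : Pt d → Pt d) : Prop where
  convex : IsConvexProblem (gradMaps b I) (stepFunctional h V ubar τ T)
  convex_regular : IsConvexProblem (regularGradMaps b I) (stepFunctional h V ubar τ T)
  ne_bot : ∀ s ∈ gradMaps b I, stepFunctional h V ubar τ T s ≠ ⊥
  ne_top : ∀ s ∈ regularGradMaps b I, stepFunctional h V ubar τ T s ≠ ⊤
  mem : t ∈ regularGradMaps b I
  lt : ∀ s ∈ gradMaps b I, s ≠ t →
    stepFunctional h V ubar τ T t < stepFunctional h V ubar τ T s
  weak : ∀ s ∈ regularGradMaps b I, WeakEulerLagrange P V ubar τ b I T s ↔ s = t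
  classical : ContDiffOn ℝ 1 (pushDensity T ubar) (closedCube d) →
    ∀ s ∈ regularGradMaps b I, EulerLagrange h V ubar τ b I T s ↔ s = t

theorem exists_isStep (D : PressureData d P h)
    (hn : ¬ IntegrableAtFilter (fun s : ℝ => s ^ ((d : ℝ) / 2 - 1) * hStar h s) (𝓝[>] 0) volume)
    (H : DriftData V lam τ) (hb : ∀ k ∈ I, ContDiff ℝ ∞ (b k))
    (hs : ∀ k ∈ I, IsSymPeriodic (b k)) (hu : PosCont ubar) (hT : IsDiffPlus T) :
    ∃ t, IsStep P h V ubar τ b I T t := by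
  set G := fieldSpan b I with hGdef
  have hG : ∀ g ∈ G, IsField g := fun g hg => isField_of_mem_fieldSpan hb hs hg
  set ρ := pushDensity T ubar with hρdef
  have hρ : PosCont ρ := hT.posCont_pushDensity hu
  obtain ⟨m, hm⟩ := exists_lowerBd hG D H hρ
  obtain ⟨t, ht, htG, hmin⟩ := exists_unique_minimizer hG D hn H hρ hm
  set c : ℝ := affConst P h - m * (densMeasure ρ).real univ
  set Φ := stepFunctional h V ubar τ T with hΦdef
  have hA : ∀ s ∈ gradMaps b I, Adm s ∧ s - id ∈ G := fun s h => adm_of_mem_gradMaps hb hs h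
  have hR : ∀ s, s ∈ regularGradMaps b I ↔ Reg s ∧ s - id ∈ G := fun s =>
    mem_regularGradMaps_iff hb hs
  have hΦ : ∀ s ∈ gradMaps b I, Φ s = (stepEnergy P h V ρ τ m s : EReal) + (c : EReal) := by
    intro s hsm
    obtain ⟨hs1, hs2⟩ := hA s hsm
    rw [hΦdef, hT.stepFunctional_eq hu h V τ hs1.differentiable]
    exact stepFunctional_eq_stepEnergy hs1 D H hρ (hm s hs1 hs2)
  have hconv : IsConvexProblem (gradMaps b I) Φ := by
    refine ⟨convex_gradMaps hb, fun x hx y hy α β hα hβ hαβ => ?_⟩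
    rcases hα.eq_or_lt with rfl | hα
    · obtain rfl : β = 1 := by linarith
      simp
    rcases hβ.eq_or_lt with rfl | hβ
    · obtain rfl : α = 1 := by linarith
      simp
    have hc := convex_gradMaps hb hx hy hα.le hβ.le hαβ
    obtain ⟨hx1, hx2⟩ := hA x hx
    obtain ⟨hy1, hy2⟩ := hA y hy
    obtain ⟨hc1, hc2⟩ := hA _ hc
    rw [hΦ _ hx, hΦ _ hy, hΦ _ hc]
    exact coe_add_le_combo hα hβ hαβ (le_self_add.trans (stepEnergy_combo D H hρ hx1 hy1
      (hm x hx1 hx2) (hm y hy1 hy2) (hm _ hc1 hc2) hα hβ hαβ))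
  have hEL : ∀ s ∈ regularGradMaps b I, (∀ ψ ∈ ansatzSpace b I, weakExpr P V ρ τ s (gradient ψ) = 0)
      ↔ s = t := by
    intro s hsm
    obtain ⟨hs1, hs2⟩ := (hR s).1 hsm
    rw [← weakExpr_eq_zero_iff hG D H hρ hm ht htG hmin hs1 hs2]
    constructor
    · intro h1 g hg
      obtain ⟨ψ, hψ, rfl⟩ := (mem_fieldSpan_iff hb).1 hg
      exact h1 ψ hψ
    · intro h1 ψ hψ
      exact h1 _ ((mem_fieldSpan_iff hb).2 ⟨ψ, hψ, rfl⟩)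
  have htm : t ∈ regularGradMaps b I := (hR t).2 ⟨ht, htG⟩
  refine ⟨t, hconv, ⟨convex_regularGradMaps D.pos_dim hb hs, fun x hx y hy =>
    hconv.2 x (regularGradMaps_subset hx) y (regularGradMaps_subset hy)⟩, fun s hsm => ?_,
    fun s hsm => ?_, htm, fun s hsm hne => ?_, fun s hsm => ?_, fun hρ1 s hsm => ?_⟩
  · change Φ s ≠ ⊥
    rw [hΦ s hsm]
    exact EReal.add_ne_bot_iff.2 ⟨EReal.coe_ennreal_ne_bot _, EReal.coe_ne_bot _⟩
  · change Φ s ≠ ⊤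
    rw [hΦ s (regularGradMaps_subset hsm)]
    have h1 := ((hR s).1 hsm).1.stepEnergy_ne_top D H hρ (m := m)
    exact EReal.add_ne_top (by simpa using h1) (EReal.coe_ne_top _)
  · obtain ⟨hs1, hs2⟩ := hA s hsm
    change Φ t < Φ s
    rw [hΦ s hsm, hΦ t (regularGradMaps_subset htm)]
    exact EReal.add_lt_add_right_coe (by exact_mod_cast hmin s hs1 hs2 hne) _
  · have hs1 := ((hR s).1 hsm).1
    rw [hT.weakEulerLagrange_iff hu hs1.isDiffPlus, ← hEL s hsm]
    simp only [WeakEulerLagrange, weakExpr, pushMeasure_id, Function.comp_id, ← hρdef]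
  · have hs1 := ((hR s).1 hsm).1
    rw [hT.eulerLagrange_iff hu hs1.isDiffPlus hs1.mapsTo_cube, ← hEL s hsm]
    refine forall₂_congr fun ψ hψ => ?_
    rw [pushMeasure_id, ← integral_inner_velocityAlong D H hρ hρ1 hs1 (ansatz_isField hb hs hψ)]

/-- Iteration of a step operator. -/
def iterMap (F : (Pt d → Pt d) → Pt d → Pt d) (T0 : Pt d → Pt d) : ℕ → Pt d → Pt d
  | 0 => T0
  | n + 1 => F (iterMap F T0 n) ∘ iterMap F T0 n

theorem lagrangianMap_iterMap (F : (Pt d → Pt d) → Pt d → Pt d) (T0 : Pt d → Pt d) (n : ℕ) :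
    lagrangianMap T0 (fun n => F (iterMap F T0 n)) n = iterMap F T0 n := by
  induction n with
  | zero => rfl
  | succ n ih => rw [lagrangianMap, ih, iterMap]

/-- A sequence of strict minimizers is the only solution of the scheme. -/
theorem isScheme_iff {A B : Set (Pt d → Pt d)} (hAB : A ⊆ B) {t : ℕ → Pt d → Pt d}
    (htA : ∀ n, t n ∈ A) (hlt : ∀ n, ∀ s ∈ B, s ≠ t n →
      stepFunctional h V ubar τ (lagrangianMap T0 t n) (t n) <
        stepFunctional h V ubar τ (lagrangianMap T0 t n) s) (s : ℕ → Pt d → Pt d) :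
    IsScheme h V ubar τ A T0 s ↔ s = t := by
  constructor
  · intro hs
    -- As long as the concatenated maps agree, both sequences minimize the same functional in the
    -- next step, and its strict minimizer is unique.
    have key : ∀ n, lagrangianMap T0 s n = lagrangianMap T0 t n → s n = t n := by
      intro n hn
      by_contra hne
      have h1 := (hs n).2 (htA n)
      rw [mem_ofPred_eq, hn] at h1
      exact absurd (hlt n _ (hAB (hs n).1) hne) h1.not_gt
    have hL : ∀ n, lagrangianMap T0 s n = lagrangianMap T0 t n := by
      intro n
      induction n with
      | zero => rfl
      | succ n ih => rw [lagrangianMap, lagrangianMap, key n ih, ih]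
    exact funext fun n => key n (hL n)
  · rintro rfl n
    refine ⟨htA n, fun r hr => ?_⟩
    by_cases hne : r = s n
    · rw [hne]; exact (le_refl _ : _ ≤ stepFunctional h V ubar τ (lagrangianMap T0 s n) (s n))
    · exact (hlt n r (hAB hr) hne).le

end Scheme
end FokkerPlanck

end

/-! ### The main theorem, by iteration of the one-step result. -/

theorem theorem4p1 (d : ℕ) (hd : 0 < d)
    -- the pressure function and the internal energy density
    (P h : ℝ → ℝ)
    (hP_cont : ContinuousOn P (Set.Ici 0))
    (hP_smooth : ContDiffOn ℝ ∞ P (Set.Ioi 0))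
    (hP_mono : StrictMonoOn P (Set.Ici 0))
    (hP_mccann : ∀ r > 0, ((d : ℝ) - 1) * (P r - P 0) ≤ (d : ℝ) * (r * deriv P r))
    (hh : ContDiffOn ℝ 2 h (Set.Ioi 0))
    (hPh : ∀ r > 0, deriv P r = r * deriv (deriv h) r)
    -- the potential
    (V : FokkerPlanck.Pt d → ℝ) (hV : ContDiffOn ℝ ∞ V (FokkerPlanck.closedCube d))
    (lam : ℝ)
    (hV_conv : ∀ x ∈ FokkerPlanck.cube d, ∀ w : FokkerPlanck.Pt d,
      lam * ‖w‖ ^ 2 ≤ fderiv ℝ (fderiv ℝ V) x w w)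
    -- the reference density
    (ubar : FokkerPlanck.Pt d → ℝ)
    (hu_cont : ContinuousOn ubar (FokkerPlanck.closedCube d))
    (hu_pos : ∀ x ∈ FokkerPlanck.closedCube d, 0 < ubar x)
    -- the time step
    (τ : ℝ) (hτ : 0 < τ) (hτ_lam : 0 < lam + τ⁻¹)
    -- the ansatz functions
    {ι : Type*} (b : ι → FokkerPlanck.Pt d → ℝ) (I : Finset ι)
    (hb_smooth : ∀ k ∈ I, ContDiff ℝ ∞ (b k))
    (hb_symm : ∀ k ∈ I, FokkerPlanck.IsSymPeriodic (b k))
    -- the initial map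
    (T0 : FokkerPlanck.Pt d → FokkerPlanck.Pt d) (hT0 : FokkerPlanck.IsDiffPlus T0) :
    -- the two forms of the condition on the energy density are equivalent
    (¬ IntegrableAtFilter (fun s : ℝ => s ^ ((d : ℝ) / 2 - 1) * FokkerPlanck.hStar h s)
          (𝓝[>] 0) volume ↔
      ¬ IntegrableAtFilter (fun r : ℝ => r ^ (-((d : ℝ) / 2 + 2)) * h r) atTop volume) ∧
    (¬ IntegrableAtFilter (fun s : ℝ => s ^ ((d : ℝ) / 2 - 1) * FokkerPlanck.hStar h s)
          (𝓝[>] 0) volume →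
      ∃ t : ℕ → FokkerPlanck.Pt d → FokkerPlanck.Pt d,
        -- the scheme can be solved inductively, and `t` is its only solution
        (∀ s : ℕ → FokkerPlanck.Pt d → FokkerPlanck.Pt d,
          FokkerPlanck.IsScheme h V ubar τ (FokkerPlanck.regularGradMaps b I) T0 s ↔ s = t) ∧
        (∀ s : ℕ → FokkerPlanck.Pt d → FokkerPlanck.Pt d,
          FokkerPlanck.IsScheme h V ubar τ (FokkerPlanck.gradMaps b I) T0 s ↔ s = t) ∧
        ∀ n : ℕ,
          FokkerPlanck.IsDiffPlus (FokkerPlanck.lagrangianMap T0 t n) ∧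
          -- each step is a convex problem for a proper functional
          FokkerPlanck.IsConvexProblem (FokkerPlanck.gradMaps b I)
            (FokkerPlanck.stepFunctional h V ubar τ (FokkerPlanck.lagrangianMap T0 t n)) ∧
          FokkerPlanck.IsConvexProblem (FokkerPlanck.regularGradMaps b I)
            (FokkerPlanck.stepFunctional h V ubar τ (FokkerPlanck.lagrangianMap T0 t n)) ∧
          (∀ s ∈ FokkerPlanck.gradMaps b I,
            FokkerPlanck.stepFunctional h V ubar τ (FokkerPlanck.lagrangianMap T0 t n) s ≠ ⊥) ∧
          (∀ s ∈ FokkerPlanck.regularGradMaps b I,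
            FokkerPlanck.stepFunctional h V ubar τ (FokkerPlanck.lagrangianMap T0 t n) s ≠ ⊤) ∧
          -- `t n` is regular and is the unique minimizer among all admissible maps
          t n ∈ FokkerPlanck.regularGradMaps b I ∧
          (∀ s ∈ FokkerPlanck.gradMaps b I, s ≠ t n →
            FokkerPlanck.stepFunctional h V ubar τ (FokkerPlanck.lagrangianMap T0 t n) (t n) <
              FokkerPlanck.stepFunctional h V ubar τ (FokkerPlanck.lagrangianMap T0 t n) s) ∧
          -- `t n` is the unique solution of the Euler--Lagrange system
          (∀ s ∈ FokkerPlanck.regularGradMaps b I,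
            FokkerPlanck.WeakEulerLagrange P V ubar τ b I
              (FokkerPlanck.lagrangianMap T0 t n) s ↔ s = t n) ∧
          (ContDiffOn ℝ 1 (FokkerPlanck.pushDensity T0 ubar) (FokkerPlanck.closedCube d) →
            ∀ s ∈ FokkerPlanck.regularGradMaps b I,
              FokkerPlanck.EulerLagrange h V ubar τ b I
                (FokkerPlanck.lagrangianMap T0 t n) s ↔ s = t n)) := by
  have D : FokkerPlanck.PressureData d P h :=
    ⟨hd, hP_cont, hP_smooth, hP_mono, hP_mccann, hh, hPh⟩
  have H : FokkerPlanck.DriftData V lam τ := ⟨hV, hV_conv, hτ, hτ_lam⟩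
  have hu : FokkerPlanck.PosCont ubar := ⟨hu_cont, hu_pos⟩
  refine ⟨not_congr (FokkerPlanck.integrableAtFilter_hStar_iff d h), fun hn => ?_⟩
  -- The step operator is chosen for all maps `T`, with an irrelevant value off the diffeomorphisms,
  -- so that it can be iterated before the iterates are known to be diffeomorphisms.
  have hex : ∀ T : FokkerPlanck.Pt d → FokkerPlanck.Pt d, ∃ t, FokkerPlanck.IsDiffPlus T →
      FokkerPlanck.IsStep P h V ubar τ b I T t := by
    intro T
    by_cases hT : FokkerPlanck.IsDiffPlus T
    · obtain ⟨t, ht⟩ := FokkerPlanck.exists_isStep D hn H hb_smooth hb_symm hu hT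
      exact ⟨t, fun _ => ht⟩
    · exact ⟨id, fun h => absurd h hT⟩
  choose F hF using hex
  set t : ℕ → FokkerPlanck.Pt d → FokkerPlanck.Pt d := fun n => F (FokkerPlanck.iterMap F T0 n)
    with ht
  have hL : ∀ n, FokkerPlanck.lagrangianMap T0 t n = FokkerPlanck.iterMap F T0 n :=
    FokkerPlanck.lagrangianMap_iterMap F T0
  have hstep : ∀ n, FokkerPlanck.IsDiffPlus (FokkerPlanck.lagrangianMap T0 t n) →
      FokkerPlanck.IsStep P h V ubar τ b I (FokkerPlanck.lagrangianMap T0 t n) (t n) := by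
    intro n hn
    rw [hL n] at hn ⊢
    exact hF _ hn
  have hreg : ∀ n, FokkerPlanck.IsDiffPlus (FokkerPlanck.lagrangianMap T0 t n) →
      FokkerPlanck.Reg (t n) := fun n hn =>
    ((FokkerPlanck.mem_regularGradMaps_iff hb_smooth hb_symm).1 (hstep n hn).mem).1
  have hdiff : ∀ n, FokkerPlanck.IsDiffPlus (FokkerPlanck.lagrangianMap T0 t n) := by
    intro n
    induction n with
    | zero => exact hT0
    | succ n ih => exact (hreg n ih).isDiffPlus.comp ih
  have hs := fun n => hstep n (hdiff n)
  have hC1 : ContDiffOn ℝ 1 (FokkerPlanck.pushDensity T0 ubar) (FokkerPlanck.closedCube d) → ∀ n,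
      ContDiffOn ℝ 1 (FokkerPlanck.pushDensity (FokkerPlanck.lagrangianMap T0 t n) ubar)
        (FokkerPlanck.closedCube d) := by
    intro h0 n
    induction n with
    | zero => exact h0
    | succ n ih =>
      exact ((hreg n (hdiff n)).contDiffOn_pushDensity ih).congr fun y hy =>
        (hreg n (hdiff n)).isDiffPlus.pushDensity_comp (hdiff n) ubar hy
  exact ⟨t, FokkerPlanck.isScheme_iff FokkerPlanck.regularGradMaps_subset (fun n => (hs n).mem)
      fun n => (hs n).lt,
    FokkerPlanck.isScheme_iff subset_rfl (fun n => FokkerPlanck.regularGradMaps_subset (hs n).mem)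
      fun n => (hs n).lt,
    fun n => ⟨hdiff n, (hs n).convex, (hs n).convex_regular, (hs n).ne_bot, (hs n).ne_top,
      (hs n).mem, (hs n).lt, (hs n).weak, fun h0 => (hs n).classical (hC1 h0 n)⟩⟩
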